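/- A box in $\mathbb{R}^3$ is a closed axis-parallel box $[x^-,x^+]\times[y^-,y^+]\times[z^-,z^+]$ with real coordinates $x^-\le x^+$, $y^-\le y^+$, $z^-\le z^+$; two boxes intersect if they have a common point. The model of computation is the real RAM with $\Theta(\log n)$-bit words: a random access machine that stores words and exact real numbers, with unit-cost arithmetic and comparisons on both and no conversion of reals to words; $n$ is the number of input boxes, each given by its six coordinates. $\tilde O(f(n))$ means $O(f(n)\log^k n)$ for some constant $k$. (a) There is a deterministic algorithm which, given three finite lists $P,Q,R$ of boxes in $\mathbb{R}^3$ with $n=|P|+|Q|+|R|$, decides in $\tilde O(n^{11/6})$ time whether for every pair $(p,r)\in P\times R$ there exists $q\in Q$ that intersects both $p$ and $r$. (b) There is a deterministic algorithm which, given a list of $n$ boxes in $\mathbb{R}^3$, decides in $\tilde O(n^{11/6})=\tilde O(n^{2-1/6})$ time, hence in truly subquadratic time, whether the intersection graph of the boxes (one vertex per box, two distinct vertices adjacent if and only if their boxes intersect) has diameter at most $2$, where a disconnected graph has infinite diameter. -/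

import Mathlib

/-! ### The real RAM

A random access machine with two kinds of data: `w`-bit words (natural numbers below `2 ^ w`) and
exact real numbers.  It has word registers, real registers, and random access memory for words and
for reals, divided into arrays; registers and arrays are named by constants of the program, cells
of an array are addressed by the contents of a word register.  Programs are finite and do not
depend on the input.  There is no conversion from reals to words (in particular no rounding), so
reals influence the control flow and the addresses only through comparisons.
Every instruction and every evaluation of a test costs one step. -/

namespace RealRAM

/-- Word operations; results are reduced modulo `2 ^ w` when stored. -/
inductive WordOp
  | add | sub | mul | div

/-- Subtraction is truncated at `0`, division rounds down (and division by `0` gives `0`). -/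
def WordOp.eval : WordOp → ℕ → ℕ → ℕ
  | .add, a, b => a + b
  | .sub, a, b => a - b
  | .mul, a, b => a * b
  | .div, a, b => a / b

/-- Exact operations on reals. -/
inductive RealOp
  | add | sub | mul | div

noncomputable def RealOp.eval : RealOp → ℝ → ℝ → ℝ
  | .add, a, b => a + b
  | .sub, a, b => a - b
  | .mul, a, b => a * b
  | .div, a, b => a / b

/-- Elementary instructions. -/
inductive Instr
  /-- word register `d` := the constant `c` -/
  | wconst (d c : ℕ)
  /-- word register `d` := word register `a` -/
  | wmove (d a : ℕ)
  /-- word register `d` := (word register `a`) `o` (word register `b`) -/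
  | wop (o : WordOp) (d a b : ℕ)
  /-- word register `d` := cell of word array `A` addressed by word register `i` -/
  | wload (d A i : ℕ)
  /-- cell of word array `A` addressed by word register `i` := word register `a` -/
  | wstore (A i a : ℕ)
  /-- real register `d` := the value of word register `a` -/
  | rcast (d a : ℕ)
  /-- real register `d` := real register `a` -/
  | rmove (d a : ℕ)
  /-- real register `d` := (real register `a`) `o` (real register `b`) -/
  | rop (o : RealOp) (d a b : ℕ)
  /-- real register `d` := cell of real array `A` addressed by word register `i` -/
  | rload (d A i : ℕ)
  /-- cell of real array `A` addressed by word register `i` := real register `a` -/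
  | rstore (A i a : ℕ)

inductive Rel
  | lt | le | eq | ne

/-- Comparisons of two word registers or of two real registers. -/
inductive Test
  | word (ρ : Rel) (a b : ℕ)
  | real (ρ : Rel) (a b : ℕ)

/-- Programs: `ite` is a conditional, `loop t c` repeats `c` while `t` holds. -/
inductive Prog
  | skip
  | instr (i : Instr)
  | seq (c₁ c₂ : Prog)
  | ite (t : Test) (c₁ c₂ : Prog)
  | loop (t : Test) (c : Prog)

/-- Memory contents: registers, and arrays (first argument: the array, second: the cell). -/
structure State where
  wreg : ℕ → ℕ
  rreg : ℕ → ℝ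
  wmem : ℕ → ℕ → ℕ
  rmem : ℕ → ℕ → ℝ

/-- The effect of an instruction on a machine with word size `w`. -/
noncomputable def Instr.apply (w : ℕ) (s : State) : Instr → State
  | .wconst d c => { s with wreg := Function.update s.wreg d (c % 2 ^ w) }
  | .wmove d a => { s with wreg := Function.update s.wreg d (s.wreg a) }
  | .wop o d a b =>
      { s with wreg := Function.update s.wreg d (o.eval (s.wreg a) (s.wreg b) % 2 ^ w) }
  | .wload d A i => { s with wreg := Function.update s.wreg d (s.wmem A (s.wreg i)) }
  | .wstore A i a =>
      { s with wmem := Function.update s.wmem A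
                (Function.update (s.wmem A) (s.wreg i) (s.wreg a)) }
  | .rcast d a => { s with rreg := Function.update s.rreg d (s.wreg a : ℝ) }
  | .rmove d a => { s with rreg := Function.update s.rreg d (s.rreg a) }
  | .rop o d a b => { s with rreg := Function.update s.rreg d (o.eval (s.rreg a) (s.rreg b)) }
  | .rload d A i => { s with rreg := Function.update s.rreg d (s.rmem A (s.wreg i)) }
  | .rstore A i a =>
      { s with rmem := Function.update s.rmem A
                (Function.update (s.rmem A) (s.wreg i) (s.rreg a)) }

def Rel.Holds {α : Type*} [LinearOrder α] : Rel → α → α → Prop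
  | .lt, x, y => x < y
  | .le, x, y => x ≤ y
  | .eq, x, y => x = y
  | .ne, x, y => x ≠ y

def Test.Holds (s : State) : Test → Prop
  | .word ρ a b => ρ.Holds (s.wreg a) (s.wreg b)
  | .real ρ a b => ρ.Holds (s.rreg a) (s.rreg b)

/-- `Exec w c s t s'`: on a machine with word size `w`, program `c` started in state `s` halts
after exactly `t` steps in state `s'`. -/
inductive Exec (w : ℕ) : Prog → State → ℕ → State → Prop
  | skip (s : State) : Exec w .skip s 1 s
  | instr (i : Instr) (s : State) : Exec w (.instr i) s 1 (i.apply w s)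
  | seq {c₁ c₂ : Prog} {s s' s'' : State} {t t' : ℕ} :
      Exec w c₁ s t s' → Exec w c₂ s' t' s'' → Exec w (.seq c₁ c₂) s (t + t') s''
  | ite_true {b : Test} {c₁ c₂ : Prog} {s s' : State} {t : ℕ} :
      b.Holds s → Exec w c₁ s t s' → Exec w (.ite b c₁ c₂) s (1 + t) s'
  | ite_false {b : Test} {c₁ c₂ : Prog} {s s' : State} {t : ℕ} :
      ¬ b.Holds s → Exec w c₂ s t s' → Exec w (.ite b c₁ c₂) s (1 + t) s'
  | loop_true {b : Test} {c : Prog} {s s' s'' : State} {t t' : ℕ} :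
      b.Holds s → Exec w c s t s' → Exec w (.loop b c) s' t' s'' →
      Exec w (.loop b c) s (1 + t + t') s''
  | loop_false {b : Test} {c : Prog} {s : State} :
      ¬ b.Holds s → Exec w (.loop b c) s 1 s

/-- The machine is deterministic: running time and final state are determined by the program and
the initial state. -/
theorem Exec.det {w : ℕ} {c : Prog} {s s₁ s₂ : State} {t₁ t₂ : ℕ}
    (h₁ : Exec w c s t₁ s₁) (h₂ : Exec w c s t₂ s₂) : t₁ = t₂ ∧ s₁ = s₂ := by
  induction h₁ generalizing t₂ s₂ with
  | skip s => cases h₂; exact ⟨rfl, rfl⟩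
  | instr i s => cases h₂; exact ⟨rfl, rfl⟩
  | seq _ _ ih ih' =>
    cases h₂ with
    | seq a b =>
      obtain ⟨rfl, rfl⟩ := ih a
      obtain ⟨rfl, rfl⟩ := ih' b
      exact ⟨rfl, rfl⟩
  | ite_true hb _ ih =>
    cases h₂ with
    | ite_true _ a => obtain ⟨rfl, rfl⟩ := ih a; exact ⟨rfl, rfl⟩
    | ite_false hn _ => exact absurd hb hn
  | ite_false hb _ ih =>
    cases h₂ with
    | ite_true hn _ => exact absurd hn hb
    | ite_false _ a => obtain ⟨rfl, rfl⟩ := ih a; exact ⟨rfl, rfl⟩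
  | loop_true hb _ _ ih ih' =>
    cases h₂ with
    | loop_true _ a b =>
      obtain ⟨rfl, rfl⟩ := ih a
      obtain ⟨rfl, rfl⟩ := ih' b
      exact ⟨rfl, rfl⟩
    | loop_false hn => exact absurd hb hn
  | loop_false hb =>
    cases h₂ with
    | loop_true hn _ _ => exact absurd hn hb
    | loop_false _ => exact ⟨rfl, rfl⟩

end RealRAM

/-! ### Boxes and their intersection graphs -/

/-- Closed axis-parallel boxes `[x⁻, x⁺] × [y⁻, y⁺] × [z⁻, z⁺]` in `ℝ³`, given by the corner
`b.fst` with the minimal coordinates and the corner `b.snd` with the maximal coordinates. -/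
abbrev Box3 : Type := NonemptyInterval (Fin 3 → ℝ)

namespace Box3

/-- Two boxes intersect if they have a common point. -/
def Intersects (p q : Box3) : Prop :=
  (Set.Icc p.fst p.snd ∩ Set.Icc q.fst q.snd).Nonempty

/-- The list `x⁻, x⁺, y⁻, y⁺, z⁻, z⁺` of the coordinates of a box. -/
def coords (b : Box3) : List ℝ :=
  [b.fst 0, b.snd 0, b.fst 1, b.snd 1, b.fst 2, b.snd 2]

/-- The intersection graph of a list of boxes; its vertices are the positions in the list. -/
def intersectionGraph (B : List Box3) : SimpleGraph (Fin B.length) where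
  Adj i j := i ≠ j ∧ (B.get i).Intersects (B.get j)
  symm := ⟨fun _ _ h => ⟨h.1.symm, by
    have h' := h.2
    unfold Intersects at h' ⊢
    rwa [Set.inter_comm]⟩⟩
  loopless := ⟨fun _ h => h.1 rfl⟩

/-- The initial state for an input consisting of several lists of boxes: word register `k` holds
the length of the `k`-th list, real array `k` holds the coordinates of its boxes, six consecutive
cells for each box, and everything else is `0`. -/
noncomputable def inputState (L : List (List Box3)) : RealRAM.State where
  wreg k := (L.getD k []).length
  rreg _ := 0
  wmem _ _ := 0
  rmem k c := ((L.getD k []).flatMap coords).getD c 0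

/-- The total number of boxes of an input. -/
def inputSize (L : List (List Box3)) : ℕ := (L.map List.length).sum

/-- On input `L` of total size `n`, and for every word size `w ≥ κ (⌊log₂ n⌋ + 1)`, the program
halts after at most `T n` steps, with `1` in word register `0` if `A` is true, and with `0` there
if `A` is false. -/
def Decides (prog : RealRAM.Prog) (κ : ℕ) (T : ℕ → ℕ) (L : List (List Box3)) (A : Prop) : Prop :=
  ∀ w : ℕ, κ * (Nat.log 2 (inputSize L) + 1) ≤ w →
    ∃ (t : ℕ) (s : RealRAM.State), RealRAM.Exec w prog (inputState L) t s ∧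
      t ≤ T (inputSize L) ∧ ((A ∧ s.wreg 0 = 1) ∨ (¬ A ∧ s.wreg 0 = 0))

end Box3

/-- `T = Õ(f)`: `T n = O(f n · (log n) ^ k)` as `n → ∞`, for some constant `k`. -/
def IsSoftO (T : ℕ → ℕ) (f : ℕ → ℝ) : Prop :=
  ∃ k : ℕ, (fun n => (T n : ℝ)) =O[Filter.atTop] (fun n => f n * Real.log n ^ k)

/-!
The algorithm replaces coordinates by ranks. In each of six directions (the two ends of the three
intervals) the boxes are sorted so that a box `q` intersects a box `u` of one of the other lists if
and only if `q` has the smaller rank in every direction. A pair `(p, r)` is bad if no `q` has smaller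
ranks than both, that is, if no `q` is dominated by the componentwise minimum of `p` and `r`.

The tool for all searches is a dominance table (`Cmd.insertTable`, `Cmd.queryTable`): a
multidimensional range tree stored by direct addressing in the word memory, which initially is `0`.
It returns the maximal value among the stored points below a given point, in polylogarithmic time.

Pairs `(p, r)` are classified by the set of directions in which `r` has the larger rank. If that is
all of them, the pair is bad if and only if no `q` is below `p` (`Cmd.stageZero`). Exchanging the
roles of `p` and `r`, the remaining pairs can be assumed to have their smaller rank at `r` in one,
two or three directions `x`, `y`, `z`; let `K` be the list of the others (`Cmd.stage`).
In the directions of `K` only `p` matters, and the grid that has `t ≈ n ^ (1 / 6)` slabs of width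
`w ≈ n ^ (5 / 6)` in each of them has at most `t ^ 5` cells.
* For every cell and every `r`, a look-up decides whether some `q` is below the lower corner of the
  cell in the directions of `K` and below `r` in the others; if not, `r` is open for the cell and is
  put into a table for this cell (`Cmd.fillCells`). This takes `Õ(n * t ^ 5)` time.
* Any other `q` below `p` in the directions of `K` shares a slab with `p` in one of them, so there
  are at most `5 * w` of these and they can be scanned for each `p`. The pair `(p, r)` is bad if and
  only if `r` is open for the cell of `p` and does not dominate any of the scanned points in the
  directions `x`, `y`, `z`. In three dimensions, the region of such `r` is a union of linearly many
  octants, whose corners are found by look-ups in tables of the scanned points (`exists_corner`,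
  `Params.Good.not_bad`); each corner is one query to the table of the cell (`Cmd.probe`).
  This takes `Õ(n * w)` time.

Both terms are `Õ(n ^ (11 / 6))`. The graph of `n` boxes has diameter at most `2` if and only if the
same question has a positive answer for three copies of the list, because a box intersects itself.

The algorithm is written in a small structured language `Cmd`. Its weakest preconditions
`Cmd.wp` include the absence of overflow and the bounds for the numbers of iterations, and
`Cmd.compile_exec` turns them into statements about the running time and result of the compiled
machine program. `Cmd.CostLE` collects the running times of the parts.
-/

set_option autoImplicit false

/-! ### A structured language compiled to the machine -/

namespace BoxCover

open RealRAM

/-- The word variables of the structured programs.  The constructors with an argument are families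
of variables: `c j` holds the `j`-th coordinate of a point to be stored in or looked up from a
dominance table, `a j` and `k j` are the node and the key at depth `j` of the nested search through
such a table, and `low j` bounds the coordinate `j` of a grid cell from below. -/
inductive Var
  | np | nq | nr | n | m | b | t | w | qe | pe | re | ans | res | old | val
  | lim | node | left | right | blocks | block | rem | p | q | r | u | v | x₀ | y₀ | z₀
  | c (j : ℕ) | a (j : ℕ) | k (j : ℕ) | low (j : ℕ)
  deriving DecidableEq

namespace Var

/-- The word register that holds a variable; the registers `44 + 5 * i` are left free. -/
def code : Var → ℕ
  | np => 0 | nq => 1 | nr => 2 | n => 3 | m => 4 | b => 5 | t => 6 | w => 7 | qe => 8 | pe => 9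
  | re => 10 | ans => 11 | res => 12 | old => 13 | val => 14 | lim => 15 | node => 16 | left => 17
  | right => 18 | blocks => 19 | block => 20 | rem => 21 | p => 22 | q => 23 | r => 24 | u => 25
  | v => 26 | x₀ => 27 | y₀ => 28 | z₀ => 29
  | c j => 40 + 5 * j | a j => 41 + 5 * j | k j => 42 + 5 * j | low j => 43 + 5 * j

/-- A left inverse of `code`. -/
def decode : ℕ → Var
  | 0 => np | 1 => nq | 2 => nr | 3 => n | 4 => m | 5 => b | 6 => t | 7 => w | 8 => qe | 9 => pe
  | 10 => re | 11 => ans | 12 => res | 13 => old | 14 => val | 15 => lim | 16 => node | 17 => left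
  | 18 => right | 19 => blocks | 20 => block | 21 => rem | 22 => p | 23 => q | 24 => r | 25 => u
  | 26 => v | 27 => x₀ | 28 => y₀ | 29 => z₀
  | i => if i % 5 = 0 then c (i / 5 - 8) else if i % 5 = 1 then a (i / 5 - 8)
      else if i % 5 = 2 then k (i / 5 - 8) else low (i / 5 - 8)

theorem decode_of_le (i : ℕ) (h : 30 ≤ i) : decode i =
    if i % 5 = 0 then c (i / 5 - 8) else if i % 5 = 1 then a (i / 5 - 8)
      else if i % 5 = 2 then k (i / 5 - 8) else low (i / 5 - 8) := by
  unfold decode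
  split <;> first | omega | rfl

theorem decode_code (y : Var) : decode y.code = y := by
  cases y
  case c j =>
    rw [code, decode_of_le _ (by omega)]
    rw [if_pos (by omega), show (40 + 5 * j) / 5 - 8 = j by omega]
  case a j =>
    rw [code, decode_of_le _ (by omega)]
    rw [if_neg (by omega), if_pos (by omega), show (41 + 5 * j) / 5 - 8 = j by omega]
  case k j =>
    rw [code, decode_of_le _ (by omega)]
    rw [if_neg (by omega), if_neg (by omega), if_pos (by omega),
      show (42 + 5 * j) / 5 - 8 = j by omega]
  case low j =>
    rw [code, decode_of_le _ (by omega)]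
    rw [if_neg (by omega), if_neg (by omega), if_neg (by omega),
      show (43 + 5 * j) / 5 - 8 = j by omega]
  all_goals rfl

theorem code_inj {y z : Var} : y.code = z.code ↔ y = z :=
  ⟨fun h => by rw [← decode_code y, h, decode_code], fun h => h ▸ rfl⟩

theorem code_ne_tmp (y : Var) (i : ℕ) : y.code ≠ 44 + 5 * i := by
  cases y <;> simp only [code] <;> omega

end Var

/-- Memory contents as seen by structured programs: word variables, word arrays, real arrays. -/
structure Mem where
  v : Var → ℕ
  a : ℕ → ℕ → ℕ
  x : ℕ → ℕ → ℝ

namespace Mem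

/-- Assignment to a variable. -/
def set (σ : Mem) (y : Var) (i : ℕ) : Mem := { σ with v := Function.update σ.v y i }

/-- Assignment to a cell of a word array. -/
def put (σ : Mem) (A i j : ℕ) : Mem :=
  { σ with a := Function.update σ.a A (Function.update (σ.a A) i j) }

/-- Assignment to a cell of a real array. -/
def rput (σ : Mem) (A i : ℕ) (x : ℝ) : Mem :=
  { σ with x := Function.update σ.x A (Function.update (σ.x A) i x) }

@[simp] theorem set_v (σ : Mem) (y z : Var) (i : ℕ) :
    (σ.set y i).v z = if z = y then i else σ.v z := Function.update_apply ..
@[simp] theorem set_a (σ : Mem) (y : Var) (i : ℕ) : (σ.set y i).a = σ.a := rfl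
@[simp] theorem set_x (σ : Mem) (y : Var) (i : ℕ) : (σ.set y i).x = σ.x := rfl
@[simp] theorem put_v (σ : Mem) (A i j : ℕ) : (σ.put A i j).v = σ.v := rfl
@[simp] theorem put_x (σ : Mem) (A i j : ℕ) : (σ.put A i j).x = σ.x := rfl
theorem put_a (σ : Mem) (A i j A' : ℕ) : (σ.put A i j).a A' =
    if A' = A then Function.update (σ.a A) i j else σ.a A' := Function.update_apply ..
@[simp] theorem put_a_self (σ : Mem) (A i j : ℕ) :
    (σ.put A i j).a A = Function.update (σ.a A) i j := by simp [put_a]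
theorem put_a_of_ne (σ : Mem) {A A' : ℕ} (i j : ℕ) (h : A' ≠ A) :
    (σ.put A i j).a A' = σ.a A' := by simp [put_a, h]
@[simp] theorem rput_v (σ : Mem) (A i : ℕ) (x : ℝ) : (σ.rput A i x).v = σ.v := rfl
@[simp] theorem rput_a (σ : Mem) (A i : ℕ) (x : ℝ) : (σ.rput A i x).a = σ.a := rfl
theorem rput_x (σ : Mem) (A i : ℕ) (x : ℝ) (A' : ℕ) : (σ.rput A i x).x A' =
    if A' = A then Function.update (σ.x A) i x else σ.x A' := Function.update_apply ..
@[simp] theorem rput_x_self (σ : Mem) (A i : ℕ) (x : ℝ) :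
    (σ.rput A i x).x A = Function.update (σ.x A) i x := by simp [rput_x]
theorem rput_x_of_ne (σ : Mem) {A A' : ℕ} (i : ℕ) (x : ℝ) (h : A' ≠ A) :
    (σ.rput A i x).x A' = σ.x A' := by simp [rput_x, h]

end Mem

/-- Word expressions. -/
inductive Exp
  | lit (i : ℕ)
  | var (y : Var)
  | op (o : WordOp) (e f : Exp)
  | get (A : ℕ) (e : Exp)

namespace Exp

instance : Coe Var Exp := ⟨var⟩
instance (i : ℕ) : OfNat Exp i := ⟨lit i⟩
instance : Add Exp := ⟨op .add⟩
instance : Sub Exp := ⟨op .sub⟩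
instance : Mul Exp := ⟨op .mul⟩
instance : Div Exp := ⟨op .div⟩

/-- The value of an expression, computed without overflow. -/
def eval (σ : Mem) : Exp → ℕ
  | lit i => i
  | var y => σ.v y
  | op o e f => o.eval (e.eval σ) (f.eval σ)
  | get A e => σ.a A (e.eval σ)

/-- No intermediate result of the evaluation reaches `Z`. -/
def Ok (Z : ℕ) (σ : Mem) : Exp → Prop
  | lit i => i < Z
  | var _ => True
  | op o e f => e.Ok Z σ ∧ f.Ok Z σ ∧ o.eval (e.eval σ) (f.eval σ) < Z
  | get _ e => e.Ok Z σ

section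
variable (σ : Mem) (Z : ℕ) (e f : Exp)
@[simp] theorem eval_lit (i : ℕ) : (lit i).eval σ = i := rfl
@[simp] theorem eval_ofNat (i : ℕ) : (no_index (OfNat.ofNat i : Exp)).eval σ = i := rfl
@[simp] theorem eval_var (y : Var) : (var y).eval σ = σ.v y := rfl
@[simp] theorem eval_add : (e + f).eval σ = e.eval σ + f.eval σ := rfl
@[simp] theorem eval_sub : (e - f).eval σ = e.eval σ - f.eval σ := rfl
@[simp] theorem eval_mul : (e * f).eval σ = e.eval σ * f.eval σ := rfl
@[simp] theorem eval_div : (e / f).eval σ = e.eval σ / f.eval σ := rfl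
@[simp] theorem eval_get (A : ℕ) : (get A e).eval σ = σ.a A (e.eval σ) := rfl
@[simp] theorem ok_lit (i : ℕ) : (lit i).Ok Z σ ↔ i < Z := Iff.rfl
@[simp] theorem ok_ofNat (i : ℕ) : (no_index (OfNat.ofNat i : Exp)).Ok Z σ ↔ i < Z := Iff.rfl
@[simp] theorem ok_var (y : Var) : (var y).Ok Z σ ↔ True := Iff.rfl
@[simp] theorem ok_add :
    (e + f).Ok Z σ ↔ e.Ok Z σ ∧ f.Ok Z σ ∧ e.eval σ + f.eval σ < Z := Iff.rfl
@[simp] theorem ok_sub :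
    (e - f).Ok Z σ ↔ e.Ok Z σ ∧ f.Ok Z σ ∧ e.eval σ - f.eval σ < Z := Iff.rfl
@[simp] theorem ok_mul :
    (e * f).Ok Z σ ↔ e.Ok Z σ ∧ f.Ok Z σ ∧ e.eval σ * f.eval σ < Z := Iff.rfl
@[simp] theorem ok_div :
    (e / f).Ok Z σ ↔ e.Ok Z σ ∧ f.Ok Z σ ∧ e.eval σ / f.eval σ < Z := Iff.rfl
@[simp] theorem ok_get (A : ℕ) : (get A e).Ok Z σ ↔ e.Ok Z σ := Iff.rfl
end

/-- The `i`-th scratch register. -/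
def tmp (i : ℕ) : ℕ := 44 + 5 * i

/-- Machine code that puts the value of an expression into the scratch register `tmp i`, using
only the scratch registers from `tmp i` on. -/
def code : Exp → ℕ → Prog
  | lit c, i => .instr (.wconst (tmp i) c)
  | var y, i => .instr (.wmove (tmp i) y.code)
  | op o e f, i => .seq (e.code i) (.seq (f.code (i + 1))
      (.instr (.wop o (tmp i) (tmp i) (tmp (i + 1)))))
  | get A e, i => .seq (e.code i) (.instr (.wload (tmp i) A (tmp i)))

/-- The number of steps taken by `Exp.code`. -/
def cost : Exp → ℕ
  | lit _ => 1
  | var _ => 1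
  | op _ e f => e.cost + (f.cost + 1)
  | get _ e => e.cost + 1

end Exp

/-- The machine state `s` represents the memory contents `σ`. -/
def Sim (σ : Mem) (s : State) : Prop :=
  (∀ y : Var, s.wreg y.code = σ.v y) ∧ s.wmem = σ.a ∧ s.rmem = σ.x

theorem Sim.tmp {σ : Mem} {s : State} (h : Sim σ s) (i j : ℕ) :
    Sim σ { s with wreg := Function.update s.wreg (Exp.tmp i) j } :=
  ⟨fun y => by
    rw [← h.1 y]
    exact Function.update_of_ne (Var.code_ne_tmp y i) _ _, h.2.1, h.2.2⟩

theorem Sim.rreg {σ : Mem} {s : State} (h : Sim σ s) (f : ℕ → ℝ) :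
    Sim σ { s with rreg := f } := h

theorem Sim.set {σ : Mem} {s : State} (h : Sim σ s) (y : Var) (j : ℕ) :
    Sim (σ.set y j) { s with wreg := Function.update s.wreg y.code j } :=
  ⟨fun z => by
    simp only [Mem.set_v, Function.update_apply, Var.code_inj, h.1 z], h.2.1, h.2.2⟩

theorem Exp.code_exec {w : ℕ} {σ : Mem} (e : Exp) (i : ℕ) {s : State} (h : Sim σ s)
    (ok : e.Ok (2 ^ w) σ) : ∃ s', Exec w (e.code i) s e.cost s' ∧ Sim σ s' ∧
      s'.wreg (tmp i) = e.eval σ ∧ ∀ j < i, s'.wreg (tmp j) = s.wreg (tmp j) := by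
  have tmp_ne : ∀ {i j : ℕ}, j < i → tmp j ≠ tmp i := fun hj => by unfold tmp; omega
  induction e generalizing i s with
  | lit c =>
    refine ⟨_, .instr _ _, h.tmp _ _, ?_, fun j hj => ?_⟩
    · simpa [Instr.apply, eval] using Nat.mod_eq_of_lt ok
    · exact Function.update_of_ne (tmp_ne hj) _ _
  | var y =>
    refine ⟨_, .instr _ _, h.tmp _ _, ?_, fun j hj => ?_⟩
    · simpa [Instr.apply, eval] using h.1 y
    · exact Function.update_of_ne (tmp_ne hj) _ _
  | op o e f ihe ihf =>
    obtain ⟨s₁, h₁, hs₁, he, hj₁⟩ := ihe i h ok.1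
    obtain ⟨s₂, h₂, hs₂, hf, hj₂⟩ := ihf (i + 1) hs₁ ok.2.1
    refine ⟨_, .seq h₁ (.seq h₂ (.instr _ _)), hs₂.tmp _ _, ?_, fun j hj => ?_⟩
    · simp only [Instr.apply, Function.update_self, hf, hj₂ i (by omega), he]
      exact Nat.mod_eq_of_lt ok.2.2
    · rw [← hj₁ j hj, ← hj₂ j (by omega)]
      exact Function.update_of_ne (tmp_ne hj) _ _
  | get A e ih =>
    obtain ⟨s₁, h₁, hs₁, he, hj₁⟩ := ih i h ok
    refine ⟨_, .seq h₁ (.instr _ _), hs₁.tmp _ _, ?_, fun j hj => ?_⟩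
    · simp only [Instr.apply, Function.update_self, he, hs₁.2.1]
      rfl
    · rw [← hj₁ j hj]
      exact Function.update_of_ne (tmp_ne hj) _ _

/-- Conditions: comparisons of words, and of two cells of a real array. -/
inductive Cond
  | lt (e f : Exp)
  | eq (e f : Exp)
  | rlt (A : ℕ) (e f : Exp)

namespace Cond

/-- Truth of a condition. -/
def Holds (σ : Mem) : Cond → Prop
  | lt e f => e.eval σ < f.eval σ
  | eq e f => e.eval σ = f.eval σ
  | rlt A e f => σ.x A (e.eval σ) < σ.x A (f.eval σ)

/-- No intermediate result of the evaluation reaches `Z`. -/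
def Ok (Z : ℕ) (σ : Mem) : Cond → Prop
  | lt e f | eq e f | rlt _ e f => e.Ok Z σ ∧ f.Ok Z σ

/-- Machine code that prepares the operands of `Cond.test`. -/
def code : Cond → Prog
  | lt e f | eq e f => .seq (e.code 0) (f.code 1)
  | rlt A e f => .seq (e.code 0) (.seq (f.code 1)
      (.seq (.instr (.rload 0 A (Exp.tmp 0))) (.instr (.rload 1 A (Exp.tmp 1)))))

/-- The machine test that decides a condition after `Cond.code`. -/
def test : Cond → Test
  | lt _ _ => .word .lt (Exp.tmp 0) (Exp.tmp 1)
  | eq _ _ => .word .eq (Exp.tmp 0) (Exp.tmp 1)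
  | rlt _ _ _ => .real .lt 0 1

/-- The number of steps taken by `Cond.code`. -/
def cost : Cond → ℕ
  | lt e f | eq e f => e.cost + f.cost
  | rlt _ e f => e.cost + (f.cost + (1 + 1))

theorem code_exec {w : ℕ} {σ : Mem} (b : Cond) {s : State} (h : Sim σ s)
    (ok : b.Ok (2 ^ w) σ) : ∃ s', Exec w b.code s b.cost s' ∧ Sim σ s' ∧
      (b.test.Holds s' ↔ b.Holds σ) := by
  cases b with
  | lt e f =>
    obtain ⟨s₁, h₁, hs₁, he, -⟩ := e.code_exec 0 h ok.1
    obtain ⟨s₂, h₂, hs₂, hf, hj⟩ := f.code_exec 1 hs₁ ok.2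
    refine ⟨s₂, .seq h₁ h₂, hs₂, ?_⟩
    simp [test, Test.Holds, Rel.Holds, Holds, hf, hj 0, he]
  | eq e f =>
    obtain ⟨s₁, h₁, hs₁, he, -⟩ := e.code_exec 0 h ok.1
    obtain ⟨s₂, h₂, hs₂, hf, hj⟩ := f.code_exec 1 hs₁ ok.2
    refine ⟨s₂, .seq h₁ h₂, hs₂, ?_⟩
    simp [test, Test.Holds, Rel.Holds, Holds, hf, hj 0, he]
  | rlt A e f =>
    obtain ⟨s₁, h₁, hs₁, he, -⟩ := e.code_exec 0 h ok.1
    obtain ⟨s₂, h₂, hs₂, hf, hj⟩ := f.code_exec 1 hs₁ ok.2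
    refine ⟨_, .seq h₁ (.seq h₂ (.seq (.instr _ _) (.instr _ _))), (hs₂.rreg _).rreg _, ?_⟩
    simp [test, Test.Holds, Rel.Holds, Holds, Instr.apply, hf, hj 0, he, hs₂.2.2]

end Cond

/-- The quantities that bound the number of iterations of the loops. -/
inductive Kind
  | level | item | slab | block | root

/-- Structured programs.  `rcopy A e B f` and `rneg A e B f` store the cell `f` of the real array
`B`, respectively its negative, in the cell `e` of the real array `A`.  A loop is labelled with the
quantity that bounds the number of its iterations. -/
inductive Cmd
  | skip
  | asg (y : Var) (e : Exp)
  | put (A : ℕ) (e f : Exp)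
  | rcopy (A : ℕ) (e : Exp) (B : ℕ) (f : Exp)
  | rneg (A : ℕ) (e : Exp) (B : ℕ) (f : Exp)
  | seq (c d : Cmd)
  | ite (b : Cond) (c d : Cmd)
  | loop (κ : Kind) (b : Cond) (c : Cmd)

infixr:60 " ;; " => Cmd.seq
infix:62 " ≔ " => Cmd.asg

namespace Cmd

/-- Translation into machine code.  The machine has no real constants without a preceding cast, so
the negative of `x` is computed as `(x - x) - x`. -/
def compile : Cmd → Prog
  | skip => .skip
  | asg y e => .seq (e.code 0) (.instr (.wmove y.code (Exp.tmp 0)))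
  | put A e f => .seq (e.code 0) (.seq (f.code 1) (.instr (.wstore A (Exp.tmp 0) (Exp.tmp 1))))
  | rcopy A e B f => .seq (e.code 0) (.seq (f.code 1)
      (.seq (.instr (.rload 0 B (Exp.tmp 1))) (.instr (.rstore A (Exp.tmp 0) 0))))
  | rneg A e B f => .seq (e.code 0) (.seq (f.code 1) (.seq (.instr (.rload 0 B (Exp.tmp 1)))
      (.seq (.instr (.rop .sub 1 0 0)) (.seq (.instr (.rop .sub 0 1 0))
        (.instr (.rstore A (Exp.tmp 0) 0))))))
  | seq c d => .seq c.compile d.compile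
  | ite b c d => .seq b.code (.ite b.test c.compile d.compile)
  | loop _ b c => .seq b.code (.loop b.test (.seq c.compile b.code))

/-- An upper bound for the running time, given bounds `β` for the numbers of iterations. -/
def cost (β : Kind → ℕ) : Cmd → ℕ
  | skip => 1
  | asg _ e => e.cost + 1
  | put _ e f => e.cost + (f.cost + 1)
  | rcopy _ e _ f => e.cost + (f.cost + (1 + 1))
  | rneg _ e _ f => e.cost + (f.cost + (1 + (1 + (1 + 1))))
  | seq c d => c.cost β + d.cost β
  | ite b c d => b.cost + (1 + (c.cost β + d.cost β))
  | loop κ b c => b.cost + (β κ * (1 + (c.cost β + b.cost)) + 1)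

/-- Weakest precondition: started in `σ`, on a machine whose words are below `Z`, the program
halts, without overflow and within its iteration bounds, in a state that satisfies `Q`.  For a
loop, the invariant `I k` has to guarantee that at most `k` further iterations are made. -/
def wp (Z : ℕ) (β : Kind → ℕ) : Cmd → (Mem → Prop) → Mem → Prop
  | skip, Q, σ => Q σ
  | asg y e, Q, σ => e.Ok Z σ ∧ Q (σ.set y (e.eval σ))
  | put A e f, Q, σ => e.Ok Z σ ∧ f.Ok Z σ ∧ Q (σ.put A (e.eval σ) (f.eval σ))
  | rcopy A e B f, Q, σ => e.Ok Z σ ∧ f.Ok Z σ ∧ Q (σ.rput A (e.eval σ) (σ.x B (f.eval σ)))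
  | rneg A e B f, Q, σ => e.Ok Z σ ∧ f.Ok Z σ ∧ Q (σ.rput A (e.eval σ) (-σ.x B (f.eval σ)))
  | seq c d, Q, σ => c.wp Z β (d.wp Z β Q) σ
  | ite b c d, Q, σ => b.Ok Z σ ∧ (b.Holds σ → c.wp Z β Q σ) ∧ (¬ b.Holds σ → d.wp Z β Q σ)
  | loop κ b c, Q, σ => ∃ I : ℕ → Mem → Prop, I (β κ) σ ∧ ∀ k τ, I k τ → b.Ok Z τ ∧
      (b.Holds τ → ∃ k', k = k' + 1 ∧ c.wp Z β (I k') τ) ∧ (¬ b.Holds τ → Q τ)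

theorem wp_mono {Z : ℕ} {β : Kind → ℕ} {c : Cmd} {Q Q' : Mem → Prop} {σ : Mem}
    (h : c.wp Z β Q σ) (hQ : ∀ τ, Q τ → Q' τ) : c.wp Z β Q' σ := by
  induction c generalizing Q Q' σ with
  | skip => exact hQ _ h
  | asg => exact ⟨h.1, hQ _ h.2⟩
  | put => exact ⟨h.1, h.2.1, hQ _ h.2.2⟩
  | rcopy => exact ⟨h.1, h.2.1, hQ _ h.2.2⟩
  | rneg => exact ⟨h.1, h.2.1, hQ _ h.2.2⟩
  | seq c d ihc ihd => exact ihc h fun τ hτ => ihd hτ hQ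
  | ite b c d ihc ihd => exact ⟨h.1, fun hb => ihc (h.2.1 hb) hQ, fun hb => ihd (h.2.2 hb) hQ⟩
  | loop κ b c ih =>
    obtain ⟨I, h0, hI⟩ := h
    exact ⟨I, h0, fun k τ hτ => ⟨(hI k τ hτ).1, (hI k τ hτ).2.1,
      fun hb => hQ _ ((hI k τ hτ).2.2 hb)⟩⟩

/-- Correctness of the compiler: the machine code realizes what `wp` promises, within the time
computed by `cost`. -/
theorem compile_exec {w : ℕ} {β : Kind → ℕ} (c : Cmd) {Q : Mem → Prop} {σ : Mem} {s : State}
    (h : c.wp (2 ^ w) β Q σ) (hs : Sim σ s) :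
    ∃ t s' σ', Exec w c.compile s t s' ∧ t ≤ c.cost β ∧ Sim σ' s' ∧ Q σ' := by
  induction c generalizing Q σ s with
  | skip => exact ⟨1, s, σ, .skip s, le_rfl, hs, h⟩
  | asg y e =>
    obtain ⟨s₁, h₁, hs₁, he, -⟩ := e.code_exec 0 hs h.1
    refine ⟨_, _, _, .seq h₁ (.instr _ _), le_rfl, ?_, h.2⟩
    rw [← he]
    exact hs₁.set _ _
  | put A e f =>
    obtain ⟨s₁, h₁, hs₁, he, -⟩ := e.code_exec 0 hs h.1
    obtain ⟨s₂, h₂, hs₂, hf, hj⟩ := f.code_exec 1 hs₁ h.2.1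
    refine ⟨_, _, σ.put A (e.eval σ) (f.eval σ), .seq h₁ (.seq h₂ (.instr _ _)), le_rfl,
      ⟨hs₂.1, ?_, hs₂.2.2⟩, h.2.2⟩
    simp [Instr.apply, Mem.put, hf, hj 0, he, hs₂.2.1]
  | rcopy A e B f =>
    obtain ⟨s₁, h₁, hs₁, he, -⟩ := e.code_exec 0 hs h.1
    obtain ⟨s₂, h₂, hs₂, hf, hj⟩ := f.code_exec 1 hs₁ h.2.1
    refine ⟨_, _, σ.rput A (e.eval σ) (σ.x B (f.eval σ)),
      .seq h₁ (.seq h₂ (.seq (.instr _ _) (.instr _ _))), le_rfl,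
      ⟨hs₂.1, hs₂.2.1, ?_⟩, h.2.2⟩
    simp [Instr.apply, Mem.rput, hf, hj 0, he, hs₂.2.2]
  | rneg A e B f =>
    obtain ⟨s₁, h₁, hs₁, he, -⟩ := e.code_exec 0 hs h.1
    obtain ⟨s₂, h₂, hs₂, hf, hj⟩ := f.code_exec 1 hs₁ h.2.1
    refine ⟨_, _, σ.rput A (e.eval σ) (-σ.x B (f.eval σ)),
      .seq h₁ (.seq h₂ (.seq (.instr _ _) (.seq (.instr _ _)
      (.seq (.instr _ _) (.instr _ _))))), le_rfl, ⟨hs₂.1, hs₂.2.1, ?_⟩, h.2.2⟩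
    simp [Instr.apply, Mem.rput, RealOp.eval, hf, hj 0, he, hs₂.2.2]
  | seq c d ihc ihd =>
    obtain ⟨t₁, s₁, σ₁, h₁, ht₁, hs₁, hQ₁⟩ := ihc h hs
    obtain ⟨t₂, s₂, σ₂, h₂, ht₂, hs₂, hQ₂⟩ := ihd hQ₁ hs₁
    exact ⟨_, s₂, σ₂, .seq h₁ h₂, Nat.add_le_add ht₁ ht₂, hs₂, hQ₂⟩
  | ite b c d ihc ihd =>
    obtain ⟨s₁, h₁, hs₁, hb⟩ := b.code_exec hs h.1
    by_cases hσ : b.Holds σ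
    · obtain ⟨t₂, s₂, σ₂, h₂, ht₂, hs₂, hQ₂⟩ := ihc (h.2.1 hσ) hs₁
      refine ⟨_, s₂, σ₂, .seq h₁ (.ite_true (hb.2 hσ) h₂), ?_, hs₂, hQ₂⟩
      simp only [cost]
      omega
    · obtain ⟨t₂, s₂, σ₂, h₂, ht₂, hs₂, hQ₂⟩ := ihd (h.2.2 hσ) hs₁
      refine ⟨_, s₂, σ₂, .seq h₁ (.ite_false (mt hb.1 hσ) h₂), ?_, hs₂, hQ₂⟩
      simp only [cost]
      omega
  | loop κ b c ih =>
    obtain ⟨I, h0, hI⟩ := h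
    have key : ∀ k τ, I k τ → ∀ s, Sim τ s → (b.test.Holds s ↔ b.Holds τ) →
        ∃ t s' σ', Exec w (.loop b.test (.seq c.compile b.code)) s t s' ∧
          t ≤ k * (1 + (c.cost β + b.cost)) + 1 ∧ Sim σ' s' ∧ Q σ' := by
      intro k
      induction k with
      | zero =>
        intro τ hτ s hs hb
        by_cases hσ : b.Holds τ
        · obtain ⟨k', hk', -⟩ := (hI 0 τ hτ).2.1 hσ
          omega
        · exact ⟨1, s, τ, .loop_false (mt hb.1 hσ), by omega, hs, (hI 0 τ hτ).2.2 hσ⟩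
      | succ k ihk =>
        intro τ hτ s hs hb
        by_cases hσ : b.Holds τ
        · obtain ⟨k', hk', hc⟩ := (hI _ τ hτ).2.1 hσ
          obtain rfl : k = k' := by omega
          obtain ⟨t₁, s₁, σ₁, h₁, ht₁, hs₁, hI₁⟩ := ih hc hs
          obtain ⟨s₂, h₂, hs₂, hb₂⟩ := b.code_exec hs₁ (hI _ _ hI₁).1
          obtain ⟨t₃, s₃, σ₃, h₃, ht₃, hs₃, hQ₃⟩ := ihk σ₁ hI₁ s₂ hs₂ hb₂
          refine ⟨_, s₃, σ₃, .loop_true (hb.2 hσ) (.seq h₁ h₂) h₃, ?_, hs₃, hQ₃⟩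
          have : (k + 1) * (1 + (c.cost β + b.cost)) =
            k * (1 + (c.cost β + b.cost)) + (1 + (c.cost β + b.cost)) := by ring
          omega
        · exact ⟨1, s, τ, .loop_false (mt hb.1 hσ), by omega, hs, (hI _ τ hτ).2.2 hσ⟩
    obtain ⟨s₁, h₁, hs₁, hb⟩ := b.code_exec hs (hI _ _ h0).1
    obtain ⟨t₂, s₂, σ₂, h₂, ht₂, hs₂, hQ₂⟩ := key _ σ h0 s₁ hs₁ hb
    refine ⟨_, s₂, σ₂, .seq h₁ h₂, ?_, hs₂, hQ₂⟩
    simp only [cost]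
    omega

section
variable (Z : ℕ) (β : Kind → ℕ) (Q : Mem → Prop) (σ : Mem)
@[simp] theorem wp_skip : skip.wp Z β Q σ ↔ Q σ := Iff.rfl
@[simp] theorem wp_asg (y : Var) (e : Exp) :
    (y ≔ e).wp Z β Q σ ↔ e.Ok Z σ ∧ Q (σ.set y (e.eval σ)) := Iff.rfl
@[simp] theorem wp_put (A : ℕ) (e f : Exp) : (put A e f).wp Z β Q σ ↔
    e.Ok Z σ ∧ f.Ok Z σ ∧ Q (σ.put A (e.eval σ) (f.eval σ)) := Iff.rfl
@[simp] theorem wp_seq (c d : Cmd) : (c ;; d).wp Z β Q σ ↔ c.wp Z β (d.wp Z β Q) σ := Iff.rfl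
@[simp] theorem wp_ite (b : Cond) (c d : Cmd) : (ite b c d).wp Z β Q σ ↔
    b.Ok Z σ ∧ (b.Holds σ → c.wp Z β Q σ) ∧ (¬ b.Holds σ → d.wp Z β Q σ) := Iff.rfl
@[simp] theorem _root_.BoxCover.Cond.holds_lt (e f : Exp) :
    (Cond.lt e f).Holds σ ↔ e.eval σ < f.eval σ := Iff.rfl
@[simp] theorem _root_.BoxCover.Cond.holds_eq (e f : Exp) :
    (Cond.eq e f).Holds σ ↔ e.eval σ = f.eval σ := Iff.rfl
@[simp] theorem _root_.BoxCover.Cond.ok_lt (e f : Exp) :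
    (Cond.lt e f).Ok Z σ ↔ e.Ok Z σ ∧ f.Ok Z σ := Iff.rfl
@[simp] theorem _root_.BoxCover.Cond.ok_eq (e f : Exp) :
    (Cond.eq e f).Ok Z σ ↔ e.Ok Z σ ∧ f.Ok Z σ := Iff.rfl
end

/-- `for y = lo, …, hi - 1`; the body must not change `y` and `hi`. -/
def forLoop (κ : Kind) (y : Var) (lo : Exp) (hi : Var) (c : Cmd) : Cmd :=
  y ≔ lo ;; loop κ (.lt y hi) (c ;; y ≔ y + 1)

theorem wp_forLoop {Z : ℕ} {β : Kind → ℕ} {κ : Kind} {y : Var} {lo : Exp} {hi : Var} {c : Cmd}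
    {Q : Mem → Prop} {σ : Mem} (I : ℕ → Mem → Prop) {l h : ℕ} (hlo : lo.Ok Z σ)
    (hl : lo.eval σ = l) (hh : (σ.set y l).v hi = h) (hZ : h < Z) (hβ : h ≤ l + β κ)
    (hlh : l ≤ h) (h0 : I l (σ.set y l))
    (hstep : ∀ i τ, l ≤ i → i < h → τ.v y = i → τ.v hi = h → I i τ →
      c.wp Z β (fun τ' => τ'.v y = i ∧ τ'.v hi = h ∧
        (τ'.set y (i + 1)).v hi = h ∧ I (i + 1) (τ'.set y (i + 1))) τ)
    (hend : ∀ τ, τ.v y = h → τ.v hi = h → I h τ → Q τ) :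
    (forLoop κ y lo hi c).wp Z β Q σ := by
  show lo.Ok Z σ ∧ _
  refine ⟨hlo, ?_⟩
  rw [hl]
  refine ⟨fun k τ => τ.v hi = h ∧ l ≤ τ.v y ∧ τ.v y ≤ h ∧ h ≤ τ.v y + k ∧ I (τ.v y) τ,
    ⟨hh, by simpa using ⟨hlh, hβ, h0⟩⟩, ?_⟩
  rintro k τ ⟨h1, h2, h3, h4, h5⟩
  refine ⟨⟨trivial, trivial⟩, fun hb => ?_, fun hb => ?_⟩
  · have hlt : τ.v y < h := by simpa [h1] using hb
    refine ⟨k - 1, by omega, ?_⟩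
    refine (wp_seq ..).2 (wp_mono (hstep _ τ h2 hlt rfl h1 h5) ?_)
    rintro τ' ⟨e1, e2, e3, e4⟩
    refine ⟨⟨trivial, by simp; omega, by show τ'.v y + 1 < Z; omega⟩, ?_⟩
    simp only [Exp.eval_add, Exp.eval_var, Exp.eval_ofNat, e1]
    exact ⟨e3, by simp; omega, by simp; omega, by simp; omega, by simpa using e4⟩
  · have hge : τ.v y = h := by
      have : ¬ τ.v y < h := by simpa [h1] using hb
      omega
    exact hend τ hge h1 (hge ▸ h5)

end Cmd

end BoxCover

/-! ### Dominance tables -/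

namespace BoxCover

open RealRAM

/-- The ancestors of the node `y` of the infinite heap-ordered binary tree that are entered from a
left child (`e = 0`), respectively from a right child (`e = 1`), on the way from `y` to the root. -/
def path (e : ℕ) (y : ℕ) : List ℕ :=
  if y ≤ 1 then [] else (if y % 2 = e then [y / 2] else []) ++ path e (y / 2)
termination_by y
decreasing_by omega

theorem path_of_le {e y : ℕ} (h : y ≤ 1) : path e y = [] := by
  rw [path, if_pos h]

theorem path_of_lt {e y : ℕ} (h : 1 < y) :
    path e y = (if y % 2 = e then [y / 2] else []) ++ path e (y / 2) := by
  rw [path, if_neg (by omega)]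

theorem le_of_mem_path {e y i : ℕ} (h : i ∈ path e y) : 1 ≤ i ∧ i ≤ y / 2 := by
  induction y using Nat.strong_induction_on with
  | _ y ih =>
    by_cases hy : y ≤ 1
    · simp [path_of_le hy] at h
    · rw [path_of_lt (by omega), List.mem_append] at h
      rcases h with h | h
      · split_ifs at h
        · simp only [List.mem_singleton] at h
          omega
        · simp at h
      · have := ih (y / 2) (by omega) h
        omega

/-- Two leaves on the same level are ordered as they leave their lowest common ancestor. -/
theorem exists_mem_path_iff {L x y : ℕ} (hx : 2 ^ L ≤ x) (hx' : x < 2 ^ (L + 1))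
    (hy : 2 ^ L ≤ y) (hy' : y < 2 ^ (L + 1)) :
    (∃ i, i ∈ path 0 x ∧ i ∈ path 1 y) ↔ x < y := by
  induction L generalizing x y with
  | zero =>
    simp only [zero_add, pow_one, pow_zero] at *
    rw [path_of_le (by omega)]
    simp
    omega
  | succ L ih =>
    have e1 : 2 ^ (L + 1) = 2 * 2 ^ L := by ring
    have e2 : 2 ^ (L + 1 + 1) = 2 * 2 ^ (L + 1) := by ring
    have e0 : 0 < 2 ^ L := by positivity
    have := @ih (x / 2) (y / 2) (by omega) (by omega) (by omega) (by omega)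
    rw [@path_of_lt 0 x (by omega), @path_of_lt 1 y (by omega)]
    simp only [List.mem_append]
    constructor
    · rintro ⟨i, h1 | h1, h2 | h2⟩
      · split_ifs at h1 h2 <;> simp at h1 h2
        omega
      · have h3 := le_of_mem_path h2
        split_ifs at h1 <;> simp at h1
        omega
      · have h3 := le_of_mem_path h1
        split_ifs at h2 <;> simp at h2
        omega
      · have := this.1 ⟨i, h1, h2⟩
        omega
    · intro hxy
      by_cases h : x / 2 < y / 2
      · obtain ⟨i, h1, h2⟩ := this.2 h
        exact ⟨i, .inr h1, .inr h2⟩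
      · refine ⟨x / 2, .inl ?_, .inl ?_⟩
        · rw [if_pos (by omega)]
          simp
        · rw [if_pos (by omega)]
          simp
          omega

/-- The addresses obtained from the address `k` by appending one node of `path e (f i + M)`, as a
digit to the base `2 * M`, for each of the `d` coordinates `i = j, …, j + d - 1`. -/
def keys (e M : ℕ) (f : ℕ → ℕ) : ℕ → ℕ → ℕ → List ℕ
  | 0, _, k => [k]
  | d + 1, j, k => (path e (f j + M)).flatMap fun i => keys e M f d (j + 1) (k * (2 * M) + i)

/-- The addresses under which a point `f` is stored and those at which `g` is looked up have an
element in common if and only if `f` is smaller than `g` in every coordinate. -/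
theorem exists_mem_keys_iff {L : ℕ} {f g : ℕ → ℕ} (d j k k' : ℕ)
    (hf : ∀ i, j ≤ i → i < j + d → f i < 2 ^ L) (hg : ∀ i, j ≤ i → i < j + d → g i < 2 ^ L) :
    (∃ i, i ∈ keys 0 (2 ^ L) f d j k ∧ i ∈ keys 1 (2 ^ L) g d j k') ↔
      k = k' ∧ ∀ i, j ≤ i → i < j + d → f i < g i := by
  induction d generalizing j k k' with
  | zero =>
    simp only [keys, List.mem_singleton]
    constructor
    · rintro ⟨i, rfl, h⟩
      exact ⟨h, fun i h1 h2 => by omega⟩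
    · rintro ⟨rfl, -⟩
      exact ⟨k, rfl, rfl⟩
  | succ d ih =>
    simp only [keys, List.mem_flatMap]
    have hfj := hf j le_rfl (by omega)
    have hgj := hg j le_rfl (by omega)
    have e1 : 2 ^ (L + 1) = 2 * 2 ^ L := by ring
    have hp := @exists_mem_path_iff L (f j + 2 ^ L) (g j + 2 ^ L) (by omega) (by omega) (by omega)
      (by omega)
    have ih' := fun k k' => ih (j + 1) k k' (fun i h1 h2 => hf i (by omega) (by omega))
      (fun i h1 h2 => hg i (by omega) (by omega))
    constructor
    · rintro ⟨i, ⟨a, ha, hia⟩, ⟨a', ha', hia'⟩⟩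
      obtain ⟨hk, hlt⟩ := (ih' _ _).1 ⟨i, hia, hia'⟩
      have h1 := le_of_mem_path ha
      have h2 := le_of_mem_path ha'
      have hlt1 : a < 2 * 2 ^ L := by omega
      have hlt2 : a' < 2 * 2 ^ L := by omega
      have hkk : k = k' := by
        have := congrArg (· / (2 * 2 ^ L)) hk
        simpa [Nat.mul_comm _ (2 * 2 ^ L), Nat.mul_add_div, Nat.div_eq_of_lt hlt1,
          Nat.div_eq_of_lt hlt2] using this
      subst hkk
      have haa : a = a' := by omega
      subst haa
      refine ⟨rfl, fun i h1 h2 => ?_⟩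
      by_cases hij : i = j
      · subst hij
        have := hp.1 ⟨a, ha, ha'⟩
        omega
      · exact hlt i (by omega) (by omega)
    · rintro ⟨rfl, h⟩
      obtain ⟨a, ha, ha'⟩ := hp.2 (by have := h j le_rfl (by omega); omega)
      obtain ⟨i, hi, hi'⟩ := (ih' (k * (2 * 2 ^ L) + a) _).2
        ⟨rfl, fun i h1 h2 => h i (by omega) (by omega)⟩
      exact ⟨i, ⟨a, ha, hi⟩, ⟨a, ha', hi'⟩⟩

/-- `m` is the maximum of `S`, or `0` if `S` is empty. -/
def IsMax (S : Set ℕ) (m : ℕ) : Prop := (∀ i ∈ S, i ≤ m) ∧ (m = 0 ∨ m ∈ S)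

/-- An entry of a dominance table: the number of the table (several tables share an array), a
point, and a value. -/
structure Entry where
  id : ℕ
  pt : ℕ → ℕ
  val : ℕ

/-- The word array `T` stores the set `E` of entries with points in `{0, …, M - 1} ^ d`: every cell
contains the maximal value of the points that are stored under its address. -/
def Rep (M d : ℕ) (T : ℕ → ℕ) (E : Set Entry) : Prop :=
  (∀ e ∈ E, ∀ j < d, e.pt j < M) ∧
    ∀ i, IsMax {v | ∃ e ∈ E, i ∈ keys 0 M e.pt d 0 e.id ∧ e.val = v} (T i)

theorem Rep.empty (M d : ℕ) : Rep M d (fun _ => 0) ∅ :=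
  ⟨by simp, fun i => ⟨by simp, .inl rfl⟩⟩

theorem Rep.insert {M d : ℕ} {T T' : ℕ → ℕ} {E : Set Entry} (h : Rep M d T E) (e : Entry)
    (he : ∀ j < d, e.pt j < M)
    (hT : ∀ i, T' i = if i ∈ keys 0 M e.pt d 0 e.id then max (T i) e.val else T i) :
    Rep M d T' (insert e E) := by
  refine ⟨by simpa using ⟨he, h.1⟩, fun i => ?_⟩
  obtain ⟨h1, h2⟩ := h.2 i
  rw [hT]
  split_ifs with hi
  · refine ⟨?_, ?_⟩
    · rintro v ⟨e', rfl | he', hi', rfl⟩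
      · exact le_max_right _ _
      · exact (h1 _ ⟨e', he', hi', rfl⟩).trans (le_max_left _ _)
    · rcases le_total (T i) e.val with hle | hle
      · rw [max_eq_right hle]
        exact .inr ⟨e, .inl rfl, hi, rfl⟩
      · rw [max_eq_left hle]
        refine h2.imp_right ?_
        rintro ⟨e', he', hi', hv⟩
        exact ⟨e', .inr he', hi', hv⟩
  · refine ⟨?_, ?_⟩
    · rintro v ⟨e', rfl | he', hi', rfl⟩
      · exact absurd hi' hi
      · exact h1 _ ⟨e', he', hi', rfl⟩
    · refine h2.imp_right ?_
      rintro ⟨e', he', hi', hv⟩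
      exact ⟨e', .inr he', hi', hv⟩

/-- The maximum over all addresses at which `g` is looked up is the maximal value of the entries of
the table whose point is dominated by `g`. -/
theorem Rep.isMax {L d : ℕ} {T : ℕ → ℕ} {E : Set Entry} (h : Rep (2 ^ L) d T E) {g : ℕ → ℕ}
    (hg : ∀ j < d, g j < 2 ^ L) {id m : ℕ} (h1 : ∀ i ∈ keys 1 (2 ^ L) g d 0 id, T i ≤ m)
    (h2 : m = 0 ∨ ∃ i ∈ keys 1 (2 ^ L) g d 0 id, T i = m) :
    IsMax {v | ∃ e ∈ E, e.id = id ∧ (∀ j < d, e.pt j < g j) ∧ e.val = v} m := by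
  have key : ∀ e ∈ E, (∃ i, i ∈ keys 0 (2 ^ L) e.pt d 0 e.id ∧ i ∈ keys 1 (2 ^ L) g d 0 id) ↔
      e.id = id ∧ ∀ j < d, e.pt j < g j := fun e he => by
    rw [exists_mem_keys_iff d 0 _ _ (fun i _ hi => h.1 e he i (by omega))
      (fun i _ hi => hg i (by omega))]
    simp
  constructor
  · rintro v ⟨e, he, hid, hlt, rfl⟩
    obtain ⟨i, hi, hi'⟩ := (key e he).2 ⟨hid, hlt⟩
    exact ((h.2 i).1 _ ⟨e, he, hi, rfl⟩).trans (h1 i hi')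
  · rcases h2 with h2 | ⟨i, hi, rfl⟩
    · exact .inl h2
    · refine (h.2 i).2.imp_right ?_
      rintro ⟨e, he, hi', hv⟩
      obtain ⟨hid, hlt⟩ := (key e he).1 ⟨i, hi', hi⟩
      exact ⟨e, he, hid, hlt, hv⟩

namespace Cmd

/-- Runs `body` with the address in `k (j + d)`, for every address in
`keys e m (c ·) d j (k j)`. -/
def walk (e : ℕ) (body : Cmd) : ℕ → ℕ → Cmd
  | 0, _ => body
  | d + 1, j =>
    .a j ≔ .var (.c j) + .var .m ;;
    loop .level (.lt 1 (.var (.a j)))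
      (ite (.eq (.var (.a j) - .var (.a j) / 2 * 2) (.lit e))
        (.k (j + 1) ≔ .var (.k j) * .var .b + .var (.a j) / 2 ;; walk e body d (j + 1)) skip ;;
      .a j ≔ .var (.a j) / 2)

theorem wp_walk {Z : ℕ} {β : Kind → ℕ} {L e D : ℕ} {body : Cmd} {f : ℕ → ℕ}
    {J : List ℕ → Mem → Prop} (hβ : L ≤ β .level) (hZ : 2 * 2 ^ L ≤ Z) (he : e ≤ 1) (hZ2 : 2 < Z)
    (hJ : ∀ l τ τ', τ'.a = τ.a → τ'.x = τ.x → τ'.v .res = τ.v .res → τ'.v .val = τ.v .val →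
      J l τ → J l τ')
    (hbody : ∀ l τ, J l τ → body.wp Z β (fun τ' => J (l ++ [τ.v (.k D)]) τ' ∧
      (∀ y, y ≠ .old → y ≠ .res → τ'.v y = τ.v y) ∧ τ'.x = τ.x) τ)
    (d : ℕ) : ∀ (j k : ℕ) (σ : Mem) (l : List ℕ), j + d = D → J l σ → σ.v .m = 2 ^ L →
      σ.v .b = 2 * 2 ^ L → (∀ i < D, σ.v (.c i) = f i ∧ f i < 2 ^ L) → σ.v (.k j) = k →
      (k + 1) * (2 * 2 ^ L) ^ d ≤ Z →
      (walk e body d j).wp Z β (fun τ => J (l ++ keys e (2 ^ L) f d j k) τ ∧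
        (∀ y, (∀ i, j ≤ i → y ≠ .a i ∧ y ≠ .k (i + 1)) → y ≠ .old → y ≠ .res → τ.v y = σ.v y) ∧
        τ.x = σ.x) σ := by
  induction d with
  | zero =>
    rintro j k σ l rfl h0 - - - hk -
    refine wp_mono (hbody l σ h0) ?_
    rintro τ ⟨h1, h2, h3⟩
    simp only [add_zero, hk] at h1
    exact ⟨h1, fun y _ => h2 y, h3⟩
  | succ d ih =>
    intro j k σ l hj h0 hm hb hc hk hkZ
    have e0 : 0 < 2 ^ L := by positivity
    obtain ⟨hcj, hfj⟩ := hc j (by omega)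
    have hpw : 1 ≤ (2 * 2 ^ L) ^ d := Nat.one_le_pow _ _ (by omega)
    have hkZ' : (k + 1) * (2 * 2 ^ L) ≤ Z := by
      refine le_trans ?_ hkZ
      rw [pow_succ, mul_comm (_ ^ d)]
      exact Nat.mul_le_mul_left _ (Nat.le_mul_of_pos_right _ hpw)
    refine (wp_seq ..).2 ((wp_asg ..).2 ⟨by simp; omega, ?_⟩)
    simp only [Exp.eval_add, Exp.eval_var, hcj, hm]
    refine ⟨fun i τ => ∃ l' y, τ.v (.a j) = y ∧ y < 2 ^ (i + 1) ∧ y < 2 * 2 ^ L ∧ J l' τ ∧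
      l' ++ ((path e y).flatMap fun i => keys e (2 ^ L) f d (j + 1) (k * (2 * 2 ^ L) + i)) =
        l ++ keys e (2 ^ L) f (d + 1) j k ∧
      (∀ y, (∀ i, j ≤ i → y ≠ .a i ∧ y ≠ .k (i + 1)) → y ≠ .old → y ≠ .res → τ.v y = σ.v y) ∧
      τ.x = σ.x, ?_, ?_⟩
    · refine ⟨l, f j + 2 ^ L, by simp, ?_, by omega, hJ l σ _ rfl rfl (by simp) (by simp) h0, rfl,
        ?_, rfl⟩
      · calc f j + 2 ^ L < 2 * 2 ^ L := by omega
          _ = 2 ^ (L + 1) := by ring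
          _ ≤ _ := Nat.pow_le_pow_right (by omega) (by omega)
      · intro y hy _ _
        simp [(hy j le_rfl).1]
    · rintro i τ ⟨l', y, hy, hyi, hyM, hJτ, hl, hfr, hx⟩
      have fr : ∀ z, (∀ i, z ≠ .a i ∧ z ≠ .k (i + 1)) → z ≠ .old → z ≠ .res →
        τ.v z = σ.v z := fun z hz => hfr z fun i _ => hz i
      have hb' : τ.v .b = 2 * 2 ^ L := (fr _ (by simp) (by simp) (by simp)).trans hb
      have hm' : τ.v .m = 2 ^ L := (fr _ (by simp) (by simp) (by simp)).trans hm
      have hc' : ∀ i < D, τ.v (.c i) = f i ∧ f i < 2 ^ L := fun i hi => by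
        rw [fr _ (by simp) (by simp) (by simp)]
        exact hc i hi
      have hk' : τ.v (.k j) = k := by
        rw [← hk]
        exact hfr _ (fun i hi => by simp; omega) (by simp) (by simp)
      refine ⟨⟨by simp; omega, trivial⟩, fun hlt => ?_, fun hlt => ?_⟩
      · simp only [Cond.holds_lt, Exp.eval_ofNat, Exp.eval_var, hy] at hlt
        have hi : i ≠ 0 := by
          rintro rfl
          simp at hyi
          omega
        obtain ⟨i, rfl⟩ := Nat.exists_eq_succ_of_ne_zero hi
        refine ⟨i, rfl, ?_⟩
        have hyi' : y / 2 < 2 ^ (i + 1) := by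
          have : 2 ^ (i.succ + 1) = 2 * 2 ^ (i + 1) := by
            rw [Nat.succ_eq_add_one]
            ring
          omega
        have hky : k * (2 * 2 ^ L) + y / 2 + 1 ≤ (k + 1) * (2 * 2 ^ L) := by
          rw [add_mul, one_mul]
          omega
        rw [path_of_lt hlt, List.flatMap_append] at hl
        refine (wp_seq ..).2 ((wp_ite ..).2 ⟨?_, fun hpar => ?_, fun hpar => ?_⟩)
        · simp [hy]
          omega
        · have hpar' : y % 2 = e := by
            simp [hy] at hpar
            omega
          have hk1 : k * (2 * 2 ^ L) < Z := by omega
          refine (wp_seq ..).2 ((wp_asg ..).2 ⟨by simp [hk', hb', hy]; omega, ?_⟩)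
          simp only [Exp.eval_add, Exp.eval_var, Exp.eval_mul, Exp.eval_div, Exp.eval_ofNat, hk',
            hb', hy]
          refine wp_mono (ih (j + 1) (k * (2 * 2 ^ L) + y / 2) _ l' (by omega)
            (hJ l' τ _ rfl rfl (by simp) (by simp) hJτ) (by simpa using hm') (by simpa using hb')
            (by simpa using hc') (by simp) ?_) ?_
          · calc _ ≤ ((k + 1) * (2 * 2 ^ L)) * (2 * 2 ^ L) ^ d := Nat.mul_le_mul_right _ hky
              _ = (k + 1) * (2 * 2 ^ L) ^ (d + 1) := by ring
              _ ≤ Z := hkZ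
          · rintro τ' ⟨h1, h2, h3⟩
            have hya : τ'.v (.a j) = y := by
              rw [h2 _ (fun i hi => by simp; omega) (by simp) (by simp)]
              simpa using hy
            refine (wp_asg ..).2 ⟨by simp [hya]; omega, ?_⟩
            simp only [Exp.eval_div, Exp.eval_var, hya, Exp.eval_ofNat]
            refine ⟨_, y / 2, by simp, hyi', by omega, hJ _ τ' _ rfl rfl (by simp) (by simp) h1,
              ?_, ?_, h3.trans hx⟩
            · rw [← hl, if_pos hpar']
              simp
            · intro z hz hz1 hz2
              have := h2 z (fun i hi => hz i (by omega)) hz1 hz2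
              simp only [Mem.set_v, (hz j le_rfl).1, (hz j le_rfl).2, if_false] at this ⊢
              exact this.trans (hfr z hz hz1 hz2)
        · have hpar' : ¬ y % 2 = e := by
            simp [hy] at hpar
            omega
          refine (wp_skip ..).2 ((wp_asg ..).2 ⟨?_, ?_⟩)
          · simp only [Exp.ok_div, Exp.ok_var, Exp.ok_ofNat, Exp.eval_var, hy,
              Exp.eval_ofNat, true_and]
            omega
          simp only [Exp.eval_div, Exp.eval_var, hy, Exp.eval_ofNat]
          refine ⟨l', y / 2, by simp, hyi', by omega, hJ _ τ _ rfl rfl (by simp) (by simp) hJτ,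
              ?_, ?_, hx⟩
          · rw [← hl, if_neg hpar']
            simp
          · intro z hz hz1 hz2
            simp only [Mem.set_v, (hz j le_rfl).1, if_false]
            exact hfr z hz hz1 hz2
      · simp only [Cond.holds_lt, Exp.eval_ofNat, Exp.eval_var, hy] at hlt
        rw [path_of_le (by omega)] at hl
        simp only [List.flatMap_nil, List.append_nil] at hl
        exact ⟨hl ▸ hJτ, hfr, hx⟩

/-- The variables used internally by table operations. -/
def _root_.BoxCover.Var.Aux (y : Var) : Prop :=
  (∃ i, y = .a i ∨ y = .k (i + 1)) ∨ y = .old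

/-- Inserts the point `(c 0, …, c (d - 1))` with the value `val` into the table number `k 0` of the
array `A`. -/
def insertTable (A d : ℕ) : Cmd :=
  walk 0 (.old ≔ .get A (.var (.k d)) ;;
    ite (.lt (.var .old) (.var .val)) (put A (.var (.k d)) (.var .val)) skip) d 0

/-- Assigns to `res` the maximal value of the points smaller than `(c 0, …, c (d - 1))` in every
coordinate that belong to the table number `k 0` of the array `A`, or `0` if there are none. -/
def queryTable (A d : ℕ) : Cmd :=
  .res ≔ 0 ;;
  walk 1 (.old ≔ .get A (.var (.k d)) ;;
    ite (.lt (.var .res) (.var .old)) (.res ≔ .var .old) skip) d 0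

theorem wp_insertTable {Z : ℕ} {β : Kind → ℕ} {L A d : ℕ} {σ : Mem} {Q : Mem → Prop}
    {E : Set Entry} (e : Entry) (hβ : L ≤ β .level) (hm : σ.v .m = 2 ^ L)
    (hb : σ.v .b = 2 * 2 ^ L)
    (hZ2 : 2 < Z) (hZ : (e.id + 1) * (2 * 2 ^ L) ^ d ≤ Z) (hZ' : 2 * 2 ^ L ≤ Z)
    (hc : ∀ i < d, σ.v (.c i) = e.pt i ∧ e.pt i < 2 ^ L) (hid : σ.v (.k 0) = e.id)
    (hv : σ.v .val = e.val) (hR : Rep (2 ^ L) d (σ.a A) E)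
    (hQ : ∀ τ : Mem, (∀ y, ¬ y.Aux → τ.v y = σ.v y) → (∀ A' ≠ A, τ.a A' = σ.a A') → τ.x = σ.x →
      Rep (2 ^ L) d (τ.a A) (insert e E) → Q τ) :
    (insertTable A d).wp Z β Q σ := by
  refine wp_mono (wp_walk (L := L) (e := 0) (D := d) (f := e.pt)
    (J := fun l τ => τ.v .val = e.val ∧ τ.v .res = σ.v .res ∧ (∀ A' ≠ A, τ.a A' = σ.a A') ∧
      ∀ i, τ.a A i = if i ∈ l then max (σ.a A i) e.val else σ.a A i) hβ hZ' (by omega) hZ2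
    ?_ ?_ d 0 e.id σ [] (by omega) ⟨hv, rfl, fun _ _ => rfl, by simp⟩ hm hb hc hid hZ) ?_
  · rintro l τ τ' h1 - h2 h3 ⟨h4, h5, h6, h7⟩
    exact ⟨h3.trans h4, h2.trans h5, by rwa [h1], by rwa [h1]⟩
  · rintro l τ ⟨h4, h5, h6, h7⟩
    simp only [wp_seq, wp_asg, Exp.ok_get, Exp.ok_var, wp_ite, Cond.ok_lt, Cond.holds_lt, wp_put,
      wp_skip, true_and, Exp.eval_get, Exp.eval_var, Mem.set_v, reduceCtorEq, if_true, if_false,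
      h4, and_self]
    have key : τ.a A (τ.v (.k d)) = if τ.v (.k d) ∈ l then max (σ.a A (τ.v (.k d))) e.val else
      σ.a A (τ.v (.k d)) := h7 _
    constructor
    · intro hlt
      refine ⟨⟨by simpa using h4, by simpa using h5, fun A' hA' => ?_, fun i => ?_⟩,
        fun y hy1 hy2 => by simp [hy1], rfl⟩
      · rw [Mem.put_a_of_ne _ _ _ hA']
        exact h6 A' hA'
      · simp only [Mem.put_a_self, Mem.set_a, Function.update_apply, List.mem_append,
          List.mem_singleton]
        by_cases hi : i = τ.v (.k d)
        · subst hi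
          simp only [if_true, or_true]
          split_ifs at key
          · rw [key] at hlt
            exact absurd (le_max_right _ _) (not_le.2 hlt)
          · rw [key] at hlt
            exact (max_eq_right hlt.le).symm
        · simp only [hi, if_false, or_false]
          exact h7 i
    · intro hlt
      refine ⟨⟨h5, h6, fun i => ?_⟩, fun y hy1 hy2 => by simp [hy1], rfl⟩
      simp only [Mem.set_a, List.mem_append, List.mem_singleton]
      by_cases hi : i = τ.v (.k d)
      · subst hi
        simp only [or_true, if_true]
        split_ifs at key
        · exact key
        · rw [key] at hlt ⊢
          exact (max_eq_left (not_lt.1 hlt)).symm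
      · simp only [hi, or_false]
        exact h7 i
  · rintro τ ⟨⟨h4, h5, h6, h7⟩, h8, h9⟩
    refine hQ τ (fun y hy => ?_) h6 h9 (hR.insert e (fun j hj => (hc j hj).2) (by simpa using h7))
    by_cases hr : y = .res
    · rw [hr, h5]
    · exact h8 y (fun i _ => ⟨fun h => hy (.inl ⟨i, .inl h⟩), fun h => hy (.inl ⟨i, .inr h⟩)⟩)
        (fun h => hy (.inr h)) hr

theorem wp_queryTable {Z : ℕ} {β : Kind → ℕ} {L A d id : ℕ} {σ : Mem} {Q : Mem → Prop}
    {E : Set Entry} (g : ℕ → ℕ) (hβ : L ≤ β .level) (hm : σ.v .m = 2 ^ L) (hb : σ.v .b = 2 * 2 ^ L)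
    (hZ2 : 2 < Z) (hZ : (id + 1) * (2 * 2 ^ L) ^ d ≤ Z) (hZ' : 2 * 2 ^ L ≤ Z)
    (hc : ∀ i < d, σ.v (.c i) = g i ∧ g i < 2 ^ L) (hid : σ.v (.k 0) = id)
    (hR : Rep (2 ^ L) d (σ.a A) E)
    (hQ : ∀ τ : Mem, (∀ y, ¬ y.Aux → y ≠ .res → τ.v y = σ.v y) → τ.a = σ.a → τ.x = σ.x →
      IsMax {v | ∃ e ∈ E, e.id = id ∧ (∀ j < d, e.pt j < g j) ∧ e.val = v} (τ.v .res) → Q τ) :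
    (queryTable A d).wp Z β Q σ := by
  refine (wp_seq ..).2 ((wp_asg ..).2 ⟨by simp; omega, ?_⟩)
  refine wp_mono (wp_walk (L := L) (e := 1) (D := d) (f := g)
    (J := fun l τ => τ.a = σ.a ∧ (∀ i ∈ l, σ.a A i ≤ τ.v .res) ∧
      (τ.v .res = 0 ∨ ∃ i ∈ l, σ.a A i = τ.v .res)) hβ hZ' (by omega) hZ2
    ?_ ?_ d 0 id _ [] (by omega) ⟨rfl, by simp, by simp⟩ (by simpa using hm) (by simpa using hb)
    (by simpa using hc) (by simpa using hid) hZ) ?_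
  · rintro l τ τ' h1 - h2 h3 ⟨h4, h5, h6⟩
    exact ⟨h1.trans h4, by rwa [h2], by rwa [h2]⟩
  · rintro l τ ⟨h4, h5, h6⟩
    simp only [wp_seq, wp_asg, Exp.ok_get, Exp.ok_var, wp_ite, Cond.ok_lt, Cond.holds_lt,
      wp_skip, true_and, Exp.eval_get, Exp.eval_var, Mem.set_v, reduceCtorEq, if_true, if_false,
      h4, and_self]
    constructor
    · intro hlt
      refine ⟨⟨h4, fun i hi => ?_, .inr ⟨τ.v (.k d), by simp, by simp⟩⟩,
        fun y hy1 hy2 => by simp [hy1, hy2], rfl⟩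
      rw [List.mem_append, List.mem_singleton] at hi
      rcases hi with hi | rfl
      · simpa using (h5 i hi).trans hlt.le
      · simp
    · intro hlt
      refine ⟨⟨h4, fun i hi => ?_, ?_⟩, fun y hy1 hy2 => by simp [hy1], rfl⟩
      · rw [List.mem_append, List.mem_singleton] at hi
        rcases hi with hi | rfl
        · simpa using h5 i hi
        · simpa using hlt
      · refine h6.imp (by simp) ?_
        rintro ⟨i, hi, h⟩
        exact ⟨i, by simp [hi], by simpa using h⟩
  · rintro τ ⟨⟨h4, h5, h6⟩, h8, h9⟩
    refine hQ τ (fun y hy hr => ?_) h4 h9 (hR.isMax (fun j hj => (hc j hj).2) (by simpa using h5)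
      (by simpa using h6))
    have := h8 y (fun i _ => ⟨fun h => hy (.inl ⟨i, .inl h⟩), fun h => hy (.inl ⟨i, .inr h⟩)⟩)
        (fun h => hy (.inr h)) hr
    simpa [hr] using this

end Cmd

end BoxCover

/-! ### The corners of the complement of a union of octants -/

namespace BoxCover

/-- `m` is the minimum of `S`, or `n` if `S` is empty. -/
def IsMin (n : ℕ) (S : Set ℕ) (m : ℕ) : Prop := (∀ i ∈ S, m ≤ i) ∧ (m = n ∨ m ∈ S)

theorem IsMax.isMin {n m : ℕ} {α : Type*} {D : Set α} {f : α → ℕ} (hf : ∀ i ∈ D, f i < n)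
    (h : IsMax {v | ∃ i ∈ D, n - f i = v} m) : IsMin n {v | ∃ i ∈ D, f i = v} (n - m) := by
  constructor
  · rintro v ⟨i, hi, rfl⟩
    have := h.1 _ ⟨i, hi, rfl⟩
    omega
  · rcases h.2 with h | ⟨i, hi, h⟩
    · exact .inl (by omega)
    · exact .inr ⟨i, hi, by have := hf i hi; omega⟩

/-- The complement of the union of the open octants with apices `(fx q, fy q, fz q)` is covered by
the closed octants below linearly many of its corners.  Each corner `(b, y, z)` has the maximal
possible `z`-coordinate `mz b y`, and `(b, y)` is a corner of the union of quadrants spanned by the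
apices up to some height: it is the whole plane, or it appears there when the apex `q` is added,
which then bounds it in the `x`-direction or in the `y`-direction. -/
theorem exists_corner {α : Type*} {D : Set α} {fx fy fz mx my : α → ℕ} {mz : ℕ → ℕ → ℕ}
    {n rx ry rz : ℕ} (hrx : rx ≤ n) (hry : ry ≤ n) (hrz : rz ≤ n)
    (hfx : ∀ q ∈ D, fx q ≤ n) (hfy : ∀ q ∈ D, fy q ≤ n)
    (h : ∀ q ∈ D, ¬ (fx q < rx ∧ fy q < ry ∧ fz q < rz))
    (hy : ∀ q ∈ D, IsMin n {v | ∃ i ∈ {i ∈ D | fx i < fx q ∧ fz i < fz q + 1}, fy i = v} (my q))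
    (hx : ∀ q ∈ D, IsMin n {v | ∃ i ∈ {i ∈ D | fy i < fy q ∧ fz i < fz q + 1}, fx i = v} (mx q))
    (hz : ∀ b y, IsMin n {v | ∃ i ∈ {i ∈ D | fx i < b ∧ fy i < y}, fz i = v} (mz b y)) :
    rz ≤ mz n n ∨ ∃ q ∈ D, (rx ≤ fx q ∧ ry ≤ my q ∧ rz ≤ mz (fx q) (my q)) ∨
      (rx ≤ mx q ∧ ry ≤ fy q ∧ rz ≤ mz (mx q) (fy q)) := by
  obtain ⟨ys, hys, hry', hq₂⟩ : ∃ ys, (∀ q ∈ D, fz q < rz → fx q < rx → ys ≤ fy q) ∧ ry ≤ ys ∧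
      (ys = n ∨ ∃ q ∈ D, fz q < rz ∧ fx q < rx ∧ fy q = ys) := by
    by_cases hA : ∃ v, ∃ q ∈ D, fz q < rz ∧ fx q < rx ∧ fy q = v
    · classical
      obtain ⟨q, hq, h1, h2, h3⟩ := Nat.find_spec hA
      refine ⟨Nat.find hA, fun q hq h1 h2 => Nat.find_min' hA ⟨q, hq, h1, h2, rfl⟩, ?_,
        .inr ⟨q, hq, h1, h2, h3⟩⟩
      by_contra hlt
      exact h q hq ⟨h2, by omega, h1⟩
    · exact ⟨n, fun q hq h1 h2 => absurd ⟨_, q, hq, h1, h2, rfl⟩ hA, hry, .inl rfl⟩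
  have hysn : ys ≤ n := by
    rcases hq₂ with rfl | ⟨q, hq, -, -, rfl⟩
    · exact le_rfl
    · exact hfy q hq
  obtain ⟨bs, hbs, hrx', hq₁⟩ : ∃ bs, (∀ q ∈ D, fz q < rz → fy q < ys → bs ≤ fx q) ∧ rx ≤ bs ∧
      (bs = n ∨ ∃ q ∈ D, fz q < rz ∧ fy q < ys ∧ fx q = bs) := by
    by_cases hA : ∃ v, ∃ q ∈ D, fz q < rz ∧ fy q < ys ∧ fx q = v
    · classical
      obtain ⟨q, hq, h1, h2, h3⟩ := Nat.find_spec hA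
      refine ⟨Nat.find hA, fun q hq h1 h2 => Nat.find_min' hA ⟨q, hq, h1, h2, rfl⟩, ?_,
        .inr ⟨q, hq, h1, h2, h3⟩⟩
      by_contra hlt
      have := hys q hq h1 (by omega)
      omega
    · exact ⟨n, fun q hq h1 h2 => absurd ⟨_, q, hq, h1, h2, rfl⟩ hA, hrx, .inl rfl⟩
  have hbsn : bs ≤ n := by
    rcases hq₁ with rfl | ⟨q, hq, -, -, rfl⟩
    · exact le_rfl
    · exact hfx q hq
  have height : ∀ b y, b ≤ bs → y ≤ ys → rz ≤ mz b y := fun b y hb hy' => by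
    rcases (hz b y).2 with h' | ⟨q, ⟨hq, h1, h2⟩, h3⟩
    · omega
    · by_contra hlt
      have := hbs q hq (by omega) (by omega)
      omega
  -- the corner appears with the higher one of the apices that bound it
  have first : ∀ q ∈ D, fz q < rz → fx q = bs →
      (ys = n ∨ ∃ i ∈ D, fz i ≤ fz q ∧ fx i < rx ∧ fy i = ys) →
      rx ≤ fx q ∧ ry ≤ my q ∧ rz ≤ mz (fx q) (my q) := by
    intro q hq h1 h2 h3
    have hle : my q ≤ ys := by
      rcases h3 with rfl | ⟨i, hi, h4, h5, h6⟩
      · rcases (hy q hq).2 with h' | ⟨i, ⟨hi, -⟩, h'⟩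
        · exact h'.le
        · exact h' ▸ hfy i hi
      · exact (hy q hq).1 ys ⟨i, ⟨hi, by omega, by omega⟩, h6⟩
    refine ⟨by omega, ?_, height _ _ (by omega) hle⟩
    rcases (hy q hq).2 with h' | ⟨i, ⟨hi, h4, h5⟩, h'⟩
    · omega
    · by_contra hlt
      have := hbs i hi (by omega) (by omega)
      omega
  have second : ∀ q ∈ D, fz q < rz → fy q = ys →
      (bs = n ∨ ∃ i ∈ D, fz i ≤ fz q ∧ fy i < ys ∧ fx i = bs) →
      rx ≤ mx q ∧ ry ≤ fy q ∧ rz ≤ mz (mx q) (fy q) := by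
    intro q hq h1 h2 h3
    have hle : mx q ≤ bs := by
      rcases h3 with rfl | ⟨i, hi, h4, h5, h6⟩
      · rcases (hx q hq).2 with h' | ⟨i, ⟨hi, -⟩, h'⟩
        · exact h'.le
        · exact h' ▸ hfx i hi
      · exact (hx q hq).1 bs ⟨i, ⟨hi, by omega, by omega⟩, h6⟩
    refine ⟨?_, by omega, height _ _ hle (by omega)⟩
    rcases (hx q hq).2 with h' | ⟨i, ⟨hi, h4, h5⟩, h'⟩
    · omega
    · have := hbs i hi (by omega) (by omega)
      omega
  rcases hq₁ with hn₁ | ⟨q₁, h₁, z₁, y₁, x₁⟩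
  · rcases hq₂ with hn₂ | ⟨q₂, h₂, z₂, x₂, y₂⟩
    · exact .inl (height n n hn₁.ge hn₂.ge)
    · exact .inr ⟨q₂, h₂, .inr (second q₂ h₂ z₂ y₂ (.inl hn₁))⟩
  · rcases hq₂ with hn₂ | ⟨q₂, h₂, z₂, x₂, y₂⟩
    · exact .inr ⟨q₁, h₁, .inl (first q₁ h₁ z₁ x₁ (.inl hn₂))⟩
    · rcases le_total (fz q₂) (fz q₁) with hle | hle
      · exact .inr ⟨q₁, h₁, .inl (first q₁ h₁ z₁ x₁ (.inr ⟨q₂, h₂, hle, x₂, y₂⟩))⟩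
      · exact .inr ⟨q₂, h₂, .inr (second q₂ h₂ z₂ y₂ (.inr ⟨q₁, h₁, hle, y₁, x₁⟩))⟩

end BoxCover

/-! ### Storing and looking up points -/

namespace BoxCover

open RealRAM

/-- The minimum of two expressions, by truncated subtraction. -/
def Exp.min (e f : Exp) : Exp := e - (e - f)

@[simp] theorem Exp.eval_min (σ : Mem) (e f : Exp) :
    (Exp.min e f).eval σ = Min.min (e.eval σ) (f.eval σ) := by
  simp only [Exp.min, Exp.eval_sub]
  omega

theorem Exp.Ok.min {Z : ℕ} {σ : Mem} {e f : Exp} (he : e.Ok Z σ) (hf : f.Ok Z σ)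
    (h : e.eval σ < Z) : (Exp.min e f).Ok Z σ := by
  have h1 : e.eval σ - f.eval σ < Z := by omega
  have h2 : e.eval σ - (e.eval σ - f.eval σ) < Z := by omega
  exact ⟨he, ⟨he, hf, h1⟩, h2⟩

/-- The variables that table operations may change. -/
def Var.Scratch : Var → Prop
  | c _ | a _ | k _ | old | res | val => True
  | _ => False

/-- `τ` differs from `σ` in scratch variables and word arrays only. -/
def Mem.Near (σ τ : Mem) : Prop := (∀ y, ¬ y.Scratch → τ.v y = σ.v y) ∧ τ.x = σ.x

theorem Mem.Near.rfl {σ : Mem} : σ.Near σ := ⟨fun _ _ => by rfl, by rfl⟩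

theorem Mem.Near.trans {σ τ υ : Mem} (h : σ.Near τ) (h' : τ.Near υ) : σ.Near υ :=
  ⟨fun y hy => (h'.1 y hy).trans (h.1 y hy), h'.2.trans h.2⟩

theorem Mem.Near.set {σ τ : Mem} (h : σ.Near τ) {y : Var} (hy : y.Scratch) (i : ℕ) :
    σ.Near (τ.set y i) :=
  ⟨fun z hz => by
    rw [Mem.set_v, if_neg (by rintro rfl; exact hz hy), h.1 z hz], h.2⟩

namespace Cmd

/-- Runs the commands `c i` for the elements `i` of a list. -/
def each {α : Type*} (l : List α) (c : α → Cmd) : Cmd := l.foldr (fun i d => c i ;; d) skip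

theorem wp_each {α : Type*} {Z : ℕ} {β : Kind → ℕ} {l : List α} {c : α → Cmd} {σ : Mem}
    {Q : Mem → Prop} (I : List α → Mem → Prop) (h0 : I [] σ)
    (hstep : ∀ l₁ i l₂ τ, l = l₁ ++ i :: l₂ → I l₁ τ → (c i).wp Z β (I (l₁ ++ [i])) τ)
    (hend : ∀ τ, I l τ → Q τ) : (each l c).wp Z β Q σ := by
  have : ∀ (l₂ l₁ : List α) (τ : Mem), l = l₁ ++ l₂ → I l₁ τ → (each l₂ c).wp Z β Q τ := by
    intro l₂
    induction l₂ with
    | nil =>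
      intro l₁ τ hl h
      rw [List.append_nil] at hl
      exact hend τ (hl ▸ h)
    | cons i l₂ ih =>
      intro l₁ τ hl h
      refine (wp_seq ..).2 (wp_mono (hstep l₁ i l₂ τ hl h) fun τ' h' => ?_)
      exact ih (l₁ ++ [i]) τ' (by simpa using hl) h'
  exact this l [] σ rfl h0

/-- Assigns the values of the expressions `e 0, …, e (d - 1)` to the coordinate variables. -/
def coords (d : ℕ) (e : ℕ → Exp) : Cmd := each (List.range d) fun j => .c j ≔ e j

theorem wp_coords {Z : ℕ} {β : Kind → ℕ} {d : ℕ} {e : ℕ → Exp} {f : ℕ → ℕ} {σ : Mem}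
    {Q : Mem → Prop}
    (he : ∀ j < d, ∀ τ : Mem, σ.Near τ → τ.a = σ.a → (e j).Ok Z τ ∧ (e j).eval τ = f j)
    (hQ : ∀ τ : Mem, σ.Near τ → τ.a = σ.a → (∀ y, (∀ i, y ≠ .c i) → τ.v y = σ.v y) →
      (∀ j < d, τ.v (.c j) = f j) → Q τ) :
    (coords d e).wp Z β Q σ := by
  refine wp_each (fun l τ => σ.Near τ ∧ τ.a = σ.a ∧ (∀ y, (∀ i, y ≠ .c i) → τ.v y = σ.v y) ∧
    ∀ j ∈ l, τ.v (.c j) = f j) ⟨.rfl, rfl, fun _ _ => rfl, by simp⟩ ?_ ?_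
  · rintro l₁ i l₂ τ hl ⟨h1, h2, h3, h4⟩
    have hi : i < d := by
      rw [← List.mem_range, hl]
      simp
    refine ⟨(he i hi τ h1 h2).1, h1.set (y := .c i) trivial _, h2, fun y hy => ?_, fun j hj => ?_⟩
    · rw [Mem.set_v, if_neg (hy i), h3 y hy]
    · rw [(he i hi τ h1 h2).2]
      by_cases hji : j = i
      · simp [hji]
      · simp only [List.mem_append, List.mem_singleton, hji, or_false] at hj
        simpa [hji] using h4 j hj
  · rintro τ ⟨h1, h2, h3, h4⟩
    exact hQ τ h1 h2 h3 fun j hj => h4 j (List.mem_range.2 hj)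

/-- Stores the point `e` with the value `v` in the table number `i` of the array `A`. -/
def store (A d : ℕ) (e : ℕ → Exp) (i v : Exp) : Cmd :=
  coords d e ;; .k 0 ≔ i ;; .val ≔ v ;; insertTable A d

/-- Looks up the point `e` in the table number `i` of the array `A`. -/
def look (A d : ℕ) (e : ℕ → Exp) (i : Exp) : Cmd :=
  coords d e ;; .k 0 ≔ i ;; queryTable A d

/-- The variables `m` and `b` have the values required by the table operations, and the words of
the machine are long enough: an address consists of the number of a table, which is below
`(2 * 2 ^ L) ^ 6`, and of at most six digits to the base `2 * 2 ^ L`. -/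
structure Base (Z : ℕ) (β : Kind → ℕ) (L : ℕ) (σ : Mem) : Prop where
  level : L ≤ β .level
  one_le : 1 ≤ L
  m_eq : σ.v .m = 2 ^ L
  b_eq : σ.v .b = 2 * 2 ^ L
  pow_le : (2 * 2 ^ L) ^ 12 ≤ Z

theorem Base.near {Z : ℕ} {β : Kind → ℕ} {L : ℕ} {σ τ : Mem} (h : Base Z β L σ) (hn : σ.Near τ) :
    Base Z β L τ :=
  ⟨h.1, h.2, (hn.1 _ (by simp [Var.Scratch])).trans h.3,
    (hn.1 _ (by simp [Var.Scratch])).trans h.4, h.5⟩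

theorem Base.le {Z : ℕ} {β : Kind → ℕ} {L : ℕ} {σ : Mem} (h : Base Z β L σ) :
    16 * (2 * 2 ^ L) ≤ Z := by
  refine le_trans ?_ h.5
  have h1 : 2 ^ 1 ≤ 2 ^ L := Nat.pow_le_pow_right (by omega) h.2
  have h2 : 4 ^ 2 ≤ (2 * 2 ^ L) ^ 2 := Nat.pow_le_pow_left (by omega) 2
  calc 16 * (2 * 2 ^ L) ≤ (2 * 2 ^ L) ^ 2 * (2 * 2 ^ L) := Nat.mul_le_mul_right _ h2
    _ = (2 * 2 ^ L) ^ 3 := by ring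
    _ ≤ _ := Nat.pow_le_pow_right (by omega) (by omega)

theorem Base.id_le {Z : ℕ} {β : Kind → ℕ} {L : ℕ} {σ : Mem} (h : Base Z β L σ) {i d : ℕ}
    (hd : d ≤ 6) (hi : i < (2 * 2 ^ L) ^ 6) : (i + 1) * (2 * 2 ^ L) ^ d ≤ Z := by
  refine le_trans ?_ h.5
  have : 0 < 2 ^ L := by positivity
  calc _ ≤ (2 * 2 ^ L) ^ 6 * (2 * 2 ^ L) ^ 6 :=
        Nat.mul_le_mul hi (Nat.pow_le_pow_right (by omega) hd)
    _ = _ := by rw [← pow_add]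

theorem Base.id_lt {Z : ℕ} {β : Kind → ℕ} {L : ℕ} {σ : Mem} (h : Base Z β L σ) {i : ℕ}
    (hi : i < (2 * 2 ^ L) ^ 6) : i < Z := by
  have := h.id_le (d := 0) (by omega) hi
  rw [pow_zero] at this
  omega

theorem wp_store {Z : ℕ} {β : Kind → ℕ} {L A d : ℕ} {e : ℕ → Exp} {i v : Exp} {σ : Mem}
    {Q : Mem → Prop} {E : Set Entry} (en : Entry) (hB : Base Z β L σ) (hd : d ≤ 6)
    (he : ∀ j < d, ∀ τ : Mem, σ.Near τ → τ.a = σ.a →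
      (e j).Ok Z τ ∧ (e j).eval τ = en.pt j ∧ en.pt j < 2 ^ L)
    (hi : ∀ τ : Mem, σ.Near τ → τ.a = σ.a → i.Ok Z τ ∧ i.eval τ = en.id)
    (hv : ∀ τ : Mem, σ.Near τ → τ.a = σ.a → v.Ok Z τ ∧ v.eval τ = en.val)
    (hid : en.id < (2 * 2 ^ L) ^ 6) (hR : Rep (2 ^ L) d (σ.a A) E)
    (hQ : ∀ τ : Mem, σ.Near τ → (∀ A' ≠ A, τ.a A' = σ.a A') →
      Rep (2 ^ L) d (τ.a A) (insert en E) → Q τ) :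
    (store A d e i v).wp Z β Q σ := by
  refine (wp_seq ..).2 (wp_coords (f := en.pt)
    (fun j hj τ h1 h2 => ⟨(he j hj τ h1 h2).1, (he j hj τ h1 h2).2.1⟩) fun τ h1 h2 h3 h4 => ?_)
  refine (wp_seq ..).2 ((wp_asg ..).2 ⟨(hi τ h1 h2).1, ?_⟩)
  rw [(hi τ h1 h2).2]
  have h5 : σ.Near (τ.set (.k 0) en.id) := h1.set (y := .k 0) trivial _
  refine (wp_seq ..).2 ((wp_asg ..).2 ⟨(hv _ h5 h2).1, ?_⟩)
  rw [(hv _ h5 h2).2]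
  have h6 := h5.set (y := .val) trivial en.val
  have hB' := hB.near h6
  have := hB.le
  have hpos : 0 < 2 ^ L := by positivity
  refine wp_insertTable en hB.level hB'.m_eq hB'.b_eq (by omega) (hB.id_le hd hid) (by omega)
    (fun j hj => ⟨by simpa using h4 j hj, (he j hj σ .rfl rfl).2.2⟩) (by simp) (by simp)
    (by simpa [h2] using hR) fun υ g1 g2 g3 g4 => ?_
  refine hQ υ (h6.trans ⟨fun y hy => g1 y ?_, g3⟩) (by simpa [h2] using g2) g4
  rintro (⟨i, rfl | rfl⟩ | rfl) <;> simp [Var.Scratch] at hy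

theorem wp_look {Z : ℕ} {β : Kind → ℕ} {L A d : ℕ} {e : ℕ → Exp} {i : Exp} {σ : Mem}
    {Q : Mem → Prop} {E : Set Entry} (g : ℕ → ℕ) (id : ℕ) (hB : Base Z β L σ) (hd : d ≤ 6)
    (he : ∀ j < d, ∀ τ : Mem, σ.Near τ → τ.a = σ.a →
      (e j).Ok Z τ ∧ (e j).eval τ = g j ∧ g j < 2 ^ L)
    (hi : ∀ τ : Mem, σ.Near τ → τ.a = σ.a → i.Ok Z τ ∧ i.eval τ = id)
    (hid : id < (2 * 2 ^ L) ^ 6) (hR : Rep (2 ^ L) d (σ.a A) E)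
    (hQ : ∀ τ : Mem, σ.Near τ → τ.a = σ.a →
      IsMax {v | ∃ e ∈ E, e.id = id ∧ (∀ j < d, e.pt j < g j) ∧ e.val = v} (τ.v .res) → Q τ) :
    (look A d e i).wp Z β Q σ := by
  refine (wp_seq ..).2 (wp_coords (f := g)
    (fun j hj τ h1 h2 => ⟨(he j hj τ h1 h2).1, (he j hj τ h1 h2).2.1⟩) fun τ h1 h2 h3 h4 => ?_)
  refine (wp_seq ..).2 ((wp_asg ..).2 ⟨(hi τ h1 h2).1, ?_⟩)
  rw [(hi τ h1 h2).2]
  have h5 : σ.Near (τ.set (.k 0) id) := h1.set (y := .k 0) trivial _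
  have hB' := hB.near h5
  have := hB.le
  have hpos : 0 < 2 ^ L := by positivity
  refine wp_queryTable g hB.level hB'.m_eq hB'.b_eq (by omega) (hB.id_le hd hid) (by omega)
    (fun j hj => ⟨by simpa using h4 j hj, (he j hj σ .rfl rfl).2.2⟩) (by simp)
    (by simpa [h2] using hR) fun υ g1 g2 g3 g4 => ?_
  refine hQ υ (h5.trans ⟨fun y hy => g1 y ?_ ?_, g3⟩) (g2.trans h2) g4
  · rintro (⟨i, rfl | rfl⟩ | rfl) <;> simp [Var.Scratch] at hy
  · rintro rfl
    simp [Var.Scratch] at hy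

end Cmd

end BoxCover

/-! ### Ranked instances -/

namespace BoxCover

open RealRAM

/-- The data of an instance in which every coordinate has been replaced by its rank.  The items
`1, …, n` are the boxes `q` (below `qe`), then the boxes `p` (below `pe`), then the boxes `r` (below
`re`); `pos i j < n` is the rank of the item `j` in direction `i < 6`, and `inv i` is inverse to
`pos i`.  The tables have the side length `2 ^ L`; every range of ranks is cut into `t` slabs of
width `w`. -/
structure Params where
  n : ℕ
  qe : ℕ
  pe : ℕ
  re : ℕ
  L : ℕ
  t : ℕ
  w : ℕ
  pos : ℕ → ℕ → ℕ
  inv : ℕ → ℕ → ℕ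

namespace Params

variable (I : Params)

/-- The first item of one of the two sides: the boxes `p` for `true`, the boxes `r` for `false`. -/
def lo (s : Bool) : ℕ := if s then I.qe else I.pe

/-- The item after the last one of a side. -/
def hi (s : Bool) : ℕ := if s then I.pe else I.re

/-- No box `q` intersects both `p` and `r`. -/
def Bad (p r : ℕ) : Prop :=
  ¬ ∃ q, 1 ≤ q ∧ q < I.qe ∧ ∀ i < 6, I.pos i q < I.pos i p ∧ I.pos i q < I.pos i r

theorem Bad.symm {I : Params} {p r : ℕ} (h : I.Bad p r) : I.Bad r p := by
  rintro ⟨q, h1, h2, h3⟩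
  exact h ⟨q, h1, h2, fun i hi => (h3 i hi).symm⟩

/-- The ranks of an item, reversed in the directions that belong to `K`. -/
def mix (K : List ℕ) (r j : ℕ) : ℕ := if j ∈ K then I.n + 1 - I.pos j r else I.pos j r

/-- The entries of the table of all boxes `q`. -/
def entriesQ : Set Entry := {e | ∃ q, 1 ≤ q ∧ q < I.qe ∧ e = ⟨0, fun j => I.pos j q, 1⟩}

/-- The properties of a ranked instance, and the bounds for word length and iterations. -/
structure Good (Z : ℕ) (β : Kind → ℕ) : Prop where
  one_le_qe : 1 ≤ I.qe
  qe_le : I.qe ≤ I.pe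
  pe_le : I.pe ≤ I.re
  re_eq : I.re = I.n + 1
  lt_pow : I.n + 2 ≤ 2 ^ I.L
  one_le_t : 1 ≤ I.t
  t_le : I.t ≤ 2 * 2 ^ I.L
  one_le_w : 1 ≤ I.w
  w_le : I.w ≤ I.n + 1
  n_le : I.n ≤ I.t * I.w
  pos_lt : ∀ i < 6, ∀ j, 1 ≤ j → j ≤ I.n → I.pos i j < I.n
  inv_pos : ∀ i < 6, ∀ j, 1 ≤ j → j ≤ I.n → I.inv i (I.pos i j) = j
  item_le : I.n ≤ β .item
  slab_le : I.w ≤ β .slab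
  block_le : I.t ^ 5 ≤ β .block

end Params

variable {I : Params} {Z : ℕ} {β : Kind → ℕ}

theorem Params.Good.side (h : I.Good Z β) (s : Bool) :
    1 ≤ I.lo s ∧ I.lo s ≤ I.hi s ∧ I.hi s ≤ I.n + 1 ∧ I.hi s ≤ I.lo s + β .item := by
  have h1 := h.one_le_qe
  have h2 := h.qe_le
  have h3 := h.pe_le
  have h4 := h.re_eq
  have h5 := h.item_le
  cases s <;> simp [Params.lo, Params.hi] <;> omega

theorem Params.Good.le_n (h : I.Good Z β) {q : ℕ} (hq : q < I.qe) : q ≤ I.n := by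
  have h2 := h.qe_le
  have h3 := h.pe_le
  have h4 := h.re_eq
  omega

theorem Params.Good.mix_lt (h : I.Good Z β) (K : List ℕ) {r j : ℕ} (hr : 1 ≤ r) (hrn : r ≤ I.n)
    (hj : j < 6) : I.mix K r j < 2 ^ I.L := by
  have h1 := h.pos_lt j hj r hr hrn
  have h2 := h.lt_pow
  unfold Params.mix
  split_ifs <;> omega

/-- The first item of a side, as a variable. -/
def Var.lo (s : Bool) : Var := if s then qe else pe

/-- The item after the last one of a side, as a variable. -/
def Var.hi (s : Bool) : Var := if s then pe else re

/-- The variables that describe the instance. -/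
def Var.Global : Var → Prop
  | n | m | b | t | w | qe | pe | re => True
  | _ => False

theorem Var.hi_global (s : Bool) : (Var.hi s).Global := by cases s <;> trivial

theorem Var.Global.ne {y z : Var} (hy : y.Global) (hz : ¬ z.Global) : y ≠ z := by
  rintro rfl
  exact hz hy

theorem Var.Global.not_scratch {y : Var} (hy : y.Global) : ¬ y.Scratch := by
  cases y <;> simp_all [Var.Global, Var.Scratch]

/-- The memory contains the ranked instance `I`: the arrays `i` and `10 + i`, for `i < 6`, contain
the ranks in direction `i` and the inverse ranking, the array `30` the table of all `q`. -/
structure Glob (Z : ℕ) (β : Kind → ℕ) (I : Params) (σ : Mem) : Prop where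
  base : Cmd.Base Z β I.L σ
  good : I.Good Z β
  n_eq : σ.v .n = I.n
  t_eq : σ.v .t = I.t
  w_eq : σ.v .w = I.w
  qe_eq : σ.v .qe = I.qe
  pe_eq : σ.v .pe = I.pe
  re_eq : σ.v .re = I.re
  pos_eq : ∀ i < 6, ∀ j, 1 ≤ j → j ≤ I.n → σ.a i j = I.pos i j
  inv_eq : ∀ i < 6, ∀ j, σ.a (10 + i) j = I.inv i j
  rep : Rep (2 ^ I.L) 6 (σ.a 30) I.entriesQ

theorem Glob.congr {σ τ : Mem} (h : Glob Z β I σ) (hv : ∀ y : Var, y.Global → τ.v y = σ.v y)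
    (ha : ∀ A < 31, τ.a A = σ.a A) : Glob Z β I τ where
  base := ⟨h.base.level, h.base.one_le, (hv .m trivial).trans h.base.m_eq,
    (hv .b trivial).trans h.base.b_eq, h.base.pow_le⟩
  good := h.good
  n_eq := (hv .n trivial).trans h.n_eq
  t_eq := (hv .t trivial).trans h.t_eq
  w_eq := (hv .w trivial).trans h.w_eq
  qe_eq := (hv .qe trivial).trans h.qe_eq
  pe_eq := (hv .pe trivial).trans h.pe_eq
  re_eq := (hv .re trivial).trans h.re_eq
  pos_eq i hi := by rw [ha i (by omega)]; exact h.pos_eq i hi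
  inv_eq i hi := by rw [ha _ (by omega)]; exact h.inv_eq i hi
  rep := by rw [ha _ (by omega)]; exact h.rep

theorem Glob.set {σ : Mem} (h : Glob Z β I σ) {y : Var} (hy : ¬ y.Global) (i : ℕ) :
    Glob Z β I (σ.set y i) :=
  h.congr (fun z hz => by simp [hz.ne hy]) fun _ _ => rfl

theorem Glob.near {σ τ : Mem} (h : Glob Z β I σ) (hn : σ.Near τ) (ha : ∀ A < 31, τ.a A = σ.a A) :
    Glob Z β I τ :=
  h.congr (fun y hy => hn.1 y hy.not_scratch) ha

theorem Glob.lo_eq {σ : Mem} (h : Glob Z β I σ) (s : Bool) : σ.v (.lo s) = I.lo s := by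
  cases s
  exacts [h.pe_eq, h.qe_eq]

theorem Glob.hi_eq {σ : Mem} (h : Glob Z β I σ) (s : Bool) : σ.v (.hi s) = I.hi s := by
  cases s
  exacts [h.re_eq, h.pe_eq]

theorem Glob.n_lt {σ : Mem} (h : Glob Z β I σ) : 10 * I.n + 20 < Z := by
  have h1 := h.base.le
  have h2 := h.good.lt_pow
  omega

/-- The expression for `Params.mix`, for the item in the variable `y`. -/
def mixExp (K : List ℕ) (y : Var) (j : ℕ) : Exp :=
  if j ∈ K then .var .n + 1 - .get j (.var y) else .get j (.var y)

theorem Glob.mixExp {σ : Mem} (h : Glob Z β I σ) (K : List ℕ) {y : Var} {r j : ℕ}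
    (hy : σ.v y = r) (hr : 1 ≤ r) (hrn : r ≤ I.n) (hj : j < 6) :
    (mixExp K y j).Ok Z σ ∧ (BoxCover.mixExp K y j).eval σ = I.mix K r j := by
  have h1 := h.n_lt
  have h2 := h.good.pos_lt j hj r hr hrn
  have h3 := h.pos_eq j hj r hr hrn
  unfold BoxCover.mixExp Params.mix
  split_ifs
  · simp [hy, h3, h.n_eq]
    omega
  · simp [hy, h3]

/-- For values `1`, the result of a query tells whether a dominated point exists. -/
theorem IsMax.eq_zero_iff {E : Set Entry} {P : Entry → Prop} {m : ℕ} (hE : ∀ e ∈ E, e.val = 1)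
    (h : IsMax {v | ∃ e ∈ E, P e ∧ e.val = v} m) : m = 0 ↔ ¬ ∃ e ∈ E, P e := by
  constructor
  · rintro rfl ⟨e, he, hP⟩
    have := h.1 _ ⟨e, he, hP, rfl⟩
    rw [hE e he] at this
    omega
  · intro hn
    rcases h.2 with h | ⟨e, he, hP, -⟩
    · exact h
    · exact absurd ⟨e, he, hP⟩ hn

/-- Looking up a point in the table of all `q`. -/
theorem Glob.wp_look {σ : Mem} (h : Glob Z β I σ) {e : ℕ → Exp} (g : ℕ → ℕ) {Q : Mem → Prop}
    (he : ∀ j < 6, ∀ τ : Mem, σ.Near τ → τ.a = σ.a →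
      (e j).Ok Z τ ∧ (e j).eval τ = g j ∧ g j < 2 ^ I.L)
    (hQ : ∀ τ : Mem, σ.Near τ → τ.a = σ.a →
      (τ.v .res = 0 ↔ ¬ ∃ q, 1 ≤ q ∧ q < I.qe ∧ ∀ j < 6, I.pos j q < g j) → Q τ) :
    (Cmd.look 30 6 e 0).wp Z β Q σ := by
  have h1 := h.n_lt
  refine Cmd.wp_look g 0 h.base le_rfl he (fun τ _ _ => ⟨by simp; omega, by simp⟩) (by positivity)
    h.rep fun τ h1 h2 h3 => hQ τ h1 h2 ?_
  have := IsMax.eq_zero_iff (P := fun e => e.id = 0 ∧ ∀ j < 6, e.pt j < g j)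
    (E := I.entriesQ) (m := τ.v .res) (by rintro e ⟨q, -, -, rfl⟩; rfl)
    (by simpa [and_assoc] using h3)
  rw [this, not_iff_not]
  constructor
  · rintro ⟨e, ⟨q, h1, h2, rfl⟩, -, h⟩
    exact ⟨q, h1, h2, h⟩
  · rintro ⟨q, h1, h2, h⟩
    exact ⟨_, ⟨q, h1, h2, rfl⟩, rfl, h⟩

/-- The answer is `0` only if a bad pair exists (`V`), and as long as it is `1`, what has been
checked so far (`X`) is true. -/
def Ans (V X : Prop) (σ : Mem) : Prop := (σ.v .ans = 0 ∧ V) ∨ (σ.v .ans = 1 ∧ X)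

theorem Ans.mono {V X X' : Prop} {σ τ : Mem} (h : Ans V X σ) (hv : τ.v .ans = σ.v .ans)
    (hX : X → X') : Ans V X' τ := by
  unfold Ans at *
  rw [hv]
  exact h.imp_right fun h => ⟨h.1, hX h.2⟩

/-! ### Pairs of boxes that are comparable in all directions -/

namespace Cmd

/-- Puts the boxes of the side `s` into the table `id 0` of `A`, with the ranks reversed in the
directions of `K`. -/
def fillAll (s : Bool) (A : ℕ) (K : List ℕ) : Cmd :=
  forLoop .item .r (.var (.lo s)) (.hi s) (store A 6 (mixExp K .r) 0 1)

theorem wp_fillAll {σ : Mem} {Q : Mem → Prop} (h : Glob Z β I σ) (s : Bool) {A : ℕ} (hA : 31 ≤ A)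
    (K : List ℕ) (hA0 : σ.a A = fun _ => 0)
    (hQ : ∀ τ : Mem, (∀ y : Var, ¬ y.Scratch → y ≠ .r → τ.v y = σ.v y) →
      (∀ A' ≠ A, τ.a A' = σ.a A') →
      Rep (2 ^ I.L) 6 (τ.a A) {e | ∃ r, I.lo s ≤ r ∧ r < I.hi s ∧ e = ⟨0, I.mix K r, 1⟩} → Q τ) :
    (fillAll s A K).wp Z β Q σ := by
  obtain ⟨s1, s2, s3, s4⟩ := h.good.side s
  have hn := h.n_lt
  refine wp_forLoop (l := I.lo s) (h := I.hi s) (fun i τ =>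
    (∀ y : Var, ¬ y.Scratch → y ≠ .r → τ.v y = σ.v y) ∧ (∀ A' ≠ A, τ.a A' = σ.a A') ∧
    Rep (2 ^ I.L) 6 (τ.a A) {e | ∃ r, I.lo s ≤ r ∧ r < i ∧ e = ⟨0, I.mix K r, 1⟩})
    (by simp) (h.lo_eq s) (by simp [(Var.hi_global s).ne (z := .r) id, h.hi_eq s]) (by omega)
    s4 s2 ?_ ?_ ?_
  · refine ⟨fun y _ hy => by simp [hy], fun _ _ => rfl, ?_⟩
    have : {e : Entry | ∃ r, I.lo s ≤ r ∧ r < I.lo s ∧ e = ⟨0, I.mix K r, 1⟩} = ∅ := by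
      ext e
      simp
      omega
    rw [this, Mem.set_a, hA0]
    exact Rep.empty _ _
  · rintro i τ hi1 hi2 hτr - ⟨hv, ha, hR⟩
    have hG : Glob Z β I τ := h.congr (fun y hy => hv y hy.not_scratch (hy.ne id))
      fun A' hA' => ha A' (by omega)
    refine wp_store ⟨0, I.mix K i, 1⟩ hG.base le_rfl (fun j hj υ h1 h2 => ?_)
      (fun υ _ _ => ⟨by simp; omega, by simp⟩) (fun υ _ _ => ⟨by simp; omega, by simp⟩)
      (by positivity) hR fun υ h1 h2 h3 => ?_
    · have := (hG.near h1 (by simp [h2])).mixExp K (y := .r)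
        ((h1.1 _ (by simp [Var.Scratch])).trans hτr) (by omega) (by omega) hj
      exact ⟨this.1, this.2, hG.good.mix_lt K (by omega) (by omega) hj⟩
    · have hr : υ.v .r = i := (h1.1 _ (by simp [Var.Scratch])).trans hτr
      have hhi : υ.v (.hi s) = I.hi s := (hG.near h1 fun A' hA' => h2 A' (by omega)).hi_eq s
      refine ⟨hr, hhi, by simp [(Var.hi_global s).ne (z := .r) id, hhi],
        fun y hy hyr => ?_, fun A' hA' => (h2 A' hA').trans (ha A' hA'), ?_⟩
      · rw [Mem.set_v, if_neg hyr, h1.1 y hy, hv y hy hyr]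
      · refine (congrArg (Rep _ _ _) ?_).mp h3
        ext e
        simp only [Set.mem_insert_iff, Set.mem_ofPred_eq]
        constructor
        · rintro (rfl | ⟨r, h1, h2, rfl⟩)
          · exact ⟨i, hi1, by omega, rfl⟩
          · exact ⟨r, h1, by omega, rfl⟩
        · rintro ⟨r, h1, h2, rfl⟩
          rcases (show r < i ∨ r = i by omega) with h | rfl
          · exact .inr ⟨r, h1, h, rfl⟩
          · exact .inl rfl
  · rintro τ - - ⟨hv, ha, hR⟩
    exact hQ τ hv ha hR

/-- Checks all pairs of a box `p` of the side `s` and a box `r` of the other side such that `r` has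
the larger rank in every direction: such a pair is bad if and only if no `q` intersects `p`. -/
def stageZero (s : Bool) (A : ℕ) : Cmd :=
  fillAll (!s) A (List.range 6) ;;
  forLoop .item .p (.var (.lo s)) (.hi s)
    (look A 6 (mixExp (List.range 6) .p) 0 ;;
      ite (.lt 0 (.var .res))
        (look 30 6 (mixExp [] .p) 0 ;; ite (.eq (.var .res) 0) (.ans ≔ 0) skip)
        skip)

theorem wp_stageZero {σ : Mem} {Q : Mem → Prop} {V X : Prop} (h : Glob Z β I σ) (s : Bool) {A : ℕ}
    (hA : 31 ≤ A) (hA0 : σ.a A = fun _ => 0) (hAns : Ans V X σ)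
    (hV : ∀ p r, I.lo s ≤ p → p < I.hi s → I.lo (!s) ≤ r → r < I.hi (!s) → I.Bad p r → V)
    (hQ : ∀ τ : Mem, Glob Z β I τ → (∀ A' ≠ A, τ.a A' = σ.a A') →
      Ans V (X ∧ ∀ p r, I.lo s ≤ p → p < I.hi s → I.lo (!s) ≤ r → r < I.hi (!s) →
        (∀ i < 6, I.pos i p < I.pos i r) → ¬ I.Bad p r) τ → Q τ) :
    (stageZero s A).wp Z β Q σ := by
  obtain ⟨s1, s2, s3, s4⟩ := h.good.side s
  obtain ⟨s1', s2', s3', s4'⟩ := h.good.side (!s)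
  have hn := h.n_lt
  refine (wp_seq ..).2 (wp_fillAll h (!s) hA _ hA0 fun σ' hv' ha' hR => ?_)
  have hG' : Glob Z β I σ' := h.congr (fun y hy => hv' y hy.not_scratch (hy.ne id))
      fun A' hA' => ha' A' (by omega)
  refine wp_forLoop (l := I.lo s) (h := I.hi s) (fun i τ =>
    (∀ y : Var, y.Global → τ.v y = σ'.v y) ∧ τ.a = σ'.a ∧
    Ans V (X ∧ ∀ p r, I.lo s ≤ p → p < i → I.lo (!s) ≤ r → r < I.hi (!s) →
        (∀ i < 6, I.pos i p < I.pos i r) → ¬ I.Bad p r) τ)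
    (by simp) (hG'.lo_eq s) (by simp [(Var.hi_global s).ne (z := .p) id, hG'.hi_eq s]) (by omega)
    s4 s2 ?_ ?_ ?_
  · refine ⟨fun y hy => by simp [hy.ne (z := .p) id], rfl, ?_⟩
    refine hAns.mono ?_ fun hX => ⟨hX, fun p r h1 h2 => by omega⟩
    rw [Mem.set_v, if_neg (by simp), hv' _ (by simp [Var.Scratch]) (by simp)]
  · rintro i τ hi1 hi2 hτp - ⟨hv, ha, hans⟩
    have hG : Glob Z β I τ := hG'.congr hv (by simp [ha])
    -- after the body: only the answer matters
    have fin : ∀ υ : Mem, (∀ y : Var, y.Global → υ.v y = τ.v y) → υ.v .p = τ.v .p → υ.a = τ.a →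
        Ans V (X ∧ ∀ p r, I.lo s ≤ p → p < i + 1 → I.lo (!s) ≤ r → r < I.hi (!s) →
        (∀ i < 6, I.pos i p < I.pos i r) → ¬ I.Bad p r) υ →
        (υ.v .p = i ∧ υ.v (.hi s) = I.hi s ∧ (υ.set .p (i + 1)).v (.hi s) = I.hi s ∧
          (∀ y : Var, y.Global → (υ.set .p (i + 1)).v y = σ'.v y) ∧
          (υ.set .p (i + 1)).a = σ'.a ∧
          Ans V (X ∧ ∀ p r, I.lo s ≤ p → p < i + 1 → I.lo (!s) ≤ r → r < I.hi (!s) →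
          (∀ i < 6, I.pos i p < I.pos i r) → ¬ I.Bad p r) (υ.set .p (i + 1))) := by
      intro υ h1 h2 h3 h4
      have hhi : υ.v (.hi s) = I.hi s := (hG.congr h1 (by simp [h3])).hi_eq s
      refine ⟨h2.trans hτp, hhi, by simp [(Var.hi_global s).ne (z := .p) id, hhi], fun y hy => ?_,
        h3.trans ha, h4.mono (by simp) id⟩
      rw [Mem.set_v, if_neg (hy.ne id), h1 y hy, hv y hy]
    refine (wp_seq ..).2 (wp_look (I.mix (List.range 6) i) 0 hG.base le_rfl (fun j hj υ h1 h2 => ?_)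
      (fun υ _ _ => ⟨by simp; omega, by simp⟩) (by positivity) (by rw [ha]; exact hR)
      fun υ h1 h2 h3 => ?_)
    · have := (hG.near h1 (by simp [h2])).mixExp (List.range 6) (y := .p)
        ((h1.1 _ (by simp [Var.Scratch])).trans hτp) (by omega) (by omega) hj
      exact ⟨this.1, this.2, hG.good.mix_lt _ (by omega) (by omega) hj⟩
    have hGυ : Glob Z β I υ := hG.near h1 (by simp [h2])
    have hres := IsMax.eq_zero_iff (P := fun e => e.id = 0 ∧ ∀ j < 6, e.pt j <
      I.mix (List.range 6) i j)
      (E := {e | ∃ r, I.lo (!s) ≤ r ∧ r < I.hi (!s) ∧ e = ⟨0, I.mix (List.range 6) r, 1⟩})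
      (m := υ.v .res) (by rintro e ⟨q, -, -, rfl⟩; rfl) (by simpa [and_assoc] using h3)
    have hmix : ∀ r, I.lo (!s) ≤ r → r < I.hi (!s) → ((∀ j < 6, I.mix (List.range 6) r j <
      I.mix (List.range 6) i j) ↔ ∀ j < 6, I.pos j i < I.pos j r) := by
      intro r hr1 hr2
      refine forall₂_congr fun j hj => ?_
      have g1 := h.good.pos_lt j hj i (by omega) (by omega)
      have g2 := h.good.pos_lt j hj r (by omega) (by omega)
      simp only [Params.mix, List.mem_range, hj, if_true]
      omega
    refine (wp_ite ..).2 ⟨⟨by simp; omega, trivial⟩, fun hb => ?_, fun hb => ?_⟩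
    · have hne : υ.v .res ≠ 0 := by simpa [Nat.pos_iff_ne_zero] using hb
      rw [Ne, hres, not_not] at hne
      obtain ⟨-, ⟨r, hr1, hr2, rfl⟩, -, hlt⟩ := hne
      have hlt' := (hmix r hr1 hr2).1 hlt
      refine (wp_seq ..).2 (hGυ.wp_look (I.pos · i) (fun j hj ξ g1 g2 => ?_) fun ξ g1 g2 g3 => ?_)
      · have := (hGυ.near g1 (by simp [g2])).mixExp [] (y := .p) (r := i)
          (by rw [g1.1 _ (by simp [Var.Scratch]), h1.1 _ (by simp [Var.Scratch]), hτp])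
          (by omega) (by omega) hj
        have hmx : I.mix [] i j = I.pos j i := by simp [Params.mix]
        exact ⟨this.1, this.2.trans hmx, hmx ▸ hG.good.mix_lt [] (by omega) (by omega) hj⟩
      · have hnear := h1.trans g1
        refine (wp_ite ..).2 ⟨by simp; omega, fun hb => ?_, fun hb => ?_⟩
        · refine (wp_asg ..).2 ⟨by simp; omega, ?_⟩
          refine fin _ (fun y hy => ?_) ?_ ?_ ?_
          · rw [Mem.set_v, if_neg (hy.ne id), hnear.1 y hy.not_scratch]
          · rw [Mem.set_v, if_neg (by simp), hnear.1 _ (by simp [Var.Scratch])]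
          · exact g2.trans h2
          · refine .inl ⟨by simp, hV i r hi1 hi2 hr1 hr2 ?_⟩
            rintro ⟨q, hq1, hq2, hq3⟩
            exact g3.1 (by simpa using hb) ⟨q, hq1, hq2, fun j hj => (hq3 j hj).1⟩
        · refine fin _ (fun y hy => hnear.1 y hy.not_scratch) (hnear.1 _ (by simp [Var.Scratch]))
            (g2.trans h2) (hans.mono (hnear.1 _ (by simp [Var.Scratch])) ?_)
          rintro ⟨hX, hall⟩
          refine ⟨hX, fun p r hp1 hp2 hr1 hr2 hpr => ?_⟩
          rcases (show p < i ∨ p = i by omega) with hp | rfl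
          · exact hall p r hp1 hp hr1 hr2 hpr
          · have : ¬ ξ.v .res = 0 := by simpa using hb
            rw [g3, not_not] at this
            obtain ⟨q, hq1, hq2, hq3⟩ := this
            exact fun hbad => hbad ⟨q, hq1, hq2, fun j hj =>
              ⟨hq3 j hj, (hq3 j hj).trans (hpr j hj)⟩⟩
    · have he : υ.v .res = 0 := by simpa using hb
      rw [hres] at he
      refine fin _ (fun y hy => h1.1 y hy.not_scratch) (h1.1 _ (by simp [Var.Scratch]))
        h2 (hans.mono (h1.1 _ (by simp [Var.Scratch])) ?_)
      rintro ⟨hX, hall⟩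
      refine ⟨hX, fun p r hp1 hp2 hr1 hr2 hpr => ?_⟩
      rcases (show p < i ∨ p = i by omega) with hp | rfl
      · exact hall p r hp1 hp hr1 hr2 hpr
      · exact absurd ⟨_, ⟨r, hr1, hr2, rfl⟩, rfl, (hmix r hr1 hr2).2 hpr⟩ he
  · rintro τ - - ⟨hv, ha, hans⟩
    exact hQ τ (hG'.congr hv (by simp [ha])) (fun A' hA' => by rw [ha, ha' A' hA']) hans

end Cmd

end BoxCover

/-! ### Grid cells and the boxes left open by them -/

namespace BoxCover

open RealRAM

variable {I : Params} {Z : ℕ} {β : Kind → ℕ}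

namespace Params

variable (I : Params)

/-- The lower bound in direction `i` of the grid cell number `b`, whose slabs in the directions of
`K` are the digits of `b` to the base `t`. -/
def low (K : List ℕ) (b i : ℕ) : ℕ := min (b / I.t ^ K.idxOf i % I.t * I.w) I.n

/-- The number of the grid cell that contains the item `p`. -/
def cell (K : List ℕ) (p : ℕ) : ℕ := K.foldr (fun i b => b * I.t + I.pos i p / I.w) 0

/-- No `q` is below the grid cell number `b` in the directions of `K` and below `r` in the other
directions. -/
def Open (K : List ℕ) (b r : ℕ) : Prop :=
  ¬ ∃ q, 1 ≤ q ∧ q < I.qe ∧ ∀ i < 6, I.pos i q < if i ∈ K then I.low K b i else I.pos i r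

/-- The table entries for the boxes `r` of the side `s` that are open for a cell `b`, restricted to
the pairs `(b, r)` in `D`. -/
def openEntries (K : List ℕ) (s : Bool) (D : ℕ → ℕ → Prop) : Set Entry :=
  {e | ∃ b r, D b r ∧ I.lo s ≤ r ∧ r < I.hi s ∧ I.Open K b r ∧ e = ⟨b, I.mix K r, 1⟩}

end Params

theorem Params.Good.slab_lt (h : I.Good Z β) {i p : ℕ} (hi : i < 6) (hp : 1 ≤ p) (hpn : p ≤ I.n) :
    I.pos i p / I.w < I.t := by
  have h1 := h.pos_lt i hi p hp hpn
  have h2 := h.n_le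
  exact Nat.div_lt_of_lt_mul (by rw [mul_comm]; omega)

theorem Params.Good.cell_lt (h : I.Good Z β) {K : List ℕ} {p : ℕ} (hK : ∀ i ∈ K, i < 6)
    (hp : 1 ≤ p) (hpn : p ≤ I.n) : I.cell K p < I.t ^ K.length := by
  induction K with
  | nil => simp [Params.cell]
  | cons i K ih =>
    have h1 := ih fun j hj => hK j (by simp [hj])
    have h2 := h.slab_lt (hK i (by simp)) hp hpn
    simp only [Params.cell, List.foldr_cons, List.length_cons] at h1 ⊢
    calc _ < (List.foldr (fun i b => b * I.t + I.pos i p / I.w) 0 K + 1) * I.t := by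
          rw [add_mul, one_mul]
          omega
      _ ≤ I.t ^ K.length * I.t := Nat.mul_le_mul_right _ h1
      _ = _ := by rw [pow_succ]

theorem Params.Good.low_cell (h : I.Good Z β) {K : List ℕ} {p i : ℕ} (hK : ∀ i ∈ K, i < 6)
    (hi : i ∈ K) (hp : 1 ≤ p) (hpn : p ≤ I.n) :
    I.low K (I.cell K p) i = I.pos i p / I.w * I.w := by
  have hdig : I.cell K p / I.t ^ K.idxOf i % I.t = I.pos i p / I.w := by
    induction K with
    | nil => simp at hi
    | cons k K ih =>
      have h2 := h.slab_lt (hK k (by simp)) hp hpn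
      have h1 := h.one_le_t
      simp only [Params.cell, List.foldr_cons]
      by_cases hki : k = i
      · subst hki
        simp [Nat.mod_eq_of_lt h2]
      · rw [List.idxOf_cons_ne _ hki, pow_succ', ← Nat.div_div_eq_div_mul]
        rw [mul_comm, Nat.mul_add_div (by omega), Nat.div_eq_of_lt h2, add_zero]
        exact ih (fun j hj => hK j (by simp [hj]))
          ((List.mem_cons.1 hi).resolve_left (Ne.symm hki))
  rw [Params.low, hdig, min_eq_left]
  have := h.pos_lt i (hK i hi) p hp hpn
  exact (Nat.div_mul_le_self _ _).trans this.le

theorem Params.Good.pow_t_le (h : I.Good Z β) {d : ℕ} (hd : d ≤ 5) :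
    I.t ^ d ≤ I.t ^ 5 ∧ I.t ^ d < (2 * 2 ^ I.L) ^ 6 := by
  have h1 : I.t ^ d ≤ I.t ^ 5 := Nat.pow_le_pow_right h.one_le_t hd
  have h2 : I.t ^ 5 ≤ (2 * 2 ^ I.L) ^ 5 := Nat.pow_le_pow_left h.t_le 5
  have h3 : 0 < 2 ^ I.L := by positivity
  have h4 : (2 * 2 ^ I.L) ^ 5 < (2 * 2 ^ I.L) ^ 6 := Nat.pow_lt_pow_right (by omega) (by omega)
  exact ⟨h1, by omega⟩

theorem Glob.mul_lt {σ : Mem} (h : Glob Z β I σ) : I.t * I.w < Z := by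
  have h1 := h.good.w_le
  have h2 := h.good.lt_pow
  have h3 := h.good.t_le
  refine h.base.id_lt ?_
  have h4 : (2 * 2 ^ I.L) ^ 2 < (2 * 2 ^ I.L) ^ 6 := Nat.pow_lt_pow_right (by omega) (by omega)
  calc I.t * I.w ≤ (2 * 2 ^ I.L) * (2 * 2 ^ I.L) := Nat.mul_le_mul h3 (by omega)
    _ = (2 * 2 ^ I.L) ^ 2 := by ring
    _ < _ := h4

namespace Cmd

/-- Computes the lower bounds of the cell `block`. -/
def lows (K : List ℕ) : Cmd :=
  .rem ≔ .var .block ;;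
  each K fun i =>
    .low i ≔ Exp.min ((.var .rem - .var .rem / .var .t * .var .t) * .var .w) (.var .n) ;;
    .rem ≔ .var .rem / .var .t

theorem wp_lows {σ : Mem} {Q : Mem → Prop} (h : Glob Z β I σ) {K : List ℕ} (hK : K.Nodup) {b : ℕ}
    (hb : σ.v .block = b) (hbZ : b < Z)
    (hQ : ∀ τ : Mem, (∀ y, y ≠ .rem → (∀ i, y ≠ .low i) → τ.v y = σ.v y) → τ.a = σ.a →
      (∀ i ∈ K, τ.v (.low i) = I.low K b i) → Q τ) :
    (lows K).wp Z β Q σ := by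
  refine (wp_seq ..).2 ((wp_asg ..).2 ⟨trivial, ?_⟩)
  refine wp_each (fun l τ => (∀ y, y ≠ .rem → (∀ i, y ≠ .low i) → τ.v y = σ.v y) ∧ τ.a = σ.a ∧
    τ.v .rem = b / I.t ^ l.length ∧ ∀ i ∈ l, τ.v (.low i) = I.low K b i) ?_ ?_ ?_
  · exact ⟨fun y hy _ => by simp [hy], rfl, by simp [hb], by simp⟩
  · rintro l₁ i l₂ τ rfl ⟨h1, h2, h3, h4⟩
    have hG : Glob Z β I τ := h.congr (fun y hy => h1 y (hy.ne id) fun i => hy.ne id) (by simp [h2])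
    have h0 := h.good.one_le_t
    have hn := h.n_lt
    have htw := h.mul_lt
    set c := b / I.t ^ l₁.length with hc
    have hcb : c < Z := lt_of_le_of_lt (Nat.div_le_self _ _) hbZ
    have hd : c / I.t * I.t ≤ c := Nat.div_mul_le_self _ _
    have hd' : c / I.t ≤ c := Nat.div_le_self _ _
    have hmod : c - c / I.t * I.t = c % I.t := by
      have := Nat.div_add_mod c I.t
      rw [mul_comm] at this
      omega
    have hlt : c % I.t * I.w < Z :=
      lt_of_le_of_lt (Nat.mul_le_mul_right _ (Nat.mod_lt _ h0).le) htw
    have hw := h.good.w_le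
    refine (wp_seq ..).2 ((wp_asg ..).2 ⟨?_, (wp_asg ..).2 ⟨?_, ?_⟩⟩)
    · refine Exp.Ok.min ?_ ?_ ?_
      · simp only [Exp.ok_mul, Exp.ok_sub, Exp.ok_var, Exp.ok_div, Exp.eval_div, Exp.eval_var,
          Exp.eval_sub, Exp.eval_mul, h3, hG.t_eq, hG.w_eq, hmod, true_and]
        exact ⟨⟨⟨by omega, by omega⟩, by omega⟩, hlt⟩
      · trivial
      · simpa [h3, hG.t_eq, hG.w_eq, hmod] using hlt
    · simp [h3, hG.t_eq]
      omega
    · refine ⟨fun y hy hy' => ?_, h2, ?_, fun j hj => ?_⟩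
      · simp [hy, hy', h1 y hy hy']
      · simp [h3, hG.t_eq, hc, pow_succ, Nat.div_div_eq_div_mul]
      · have hni : i ∉ l₁ := fun hi => by
          have := List.nodup_append.1 hK
          exact this.2.2 i hi i (by simp) rfl
        by_cases hji : j = i
        · subst hji
          simp [h3, hG.t_eq, hG.w_eq, hG.n_eq, hmod, Params.low, List.idxOf_append, hni, ← hc]
        · simp only [List.mem_append, List.mem_singleton, hji, or_false] at hj
          simpa [hji] using h4 j hj
  · rintro τ ⟨h1, h2, -, h4⟩
    exact hQ τ h1 h2 h4

/-- Puts the boxes of the side `s` that are open for the cell `block` into the table number `block`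
of `A`. -/
def fillCell (K : List ℕ) (s : Bool) (A : ℕ) : Cmd :=
  forLoop .item .r (.var (.lo s)) (.hi s)
    (look 30 6 (fun j => if j ∈ K then .var (.low j) else .get j (.var .r)) 0 ;;
      ite (.eq (.var .res) 0) (store A 6 (mixExp K .r) (.var .block) 1) skip)

theorem wp_fillCell {σ : Mem} {Q : Mem → Prop} (h : Glob Z β I σ) {K : List ℕ} (s : Bool) {A : ℕ}
    (hA : 31 ≤ A) {b : ℕ} (hb : σ.v .block = b) (hbZ : b < (2 * 2 ^ I.L) ^ 6)
    (hlow : ∀ i ∈ K, σ.v (.low i) = I.low K b i)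
    (hR : Rep (2 ^ I.L) 6 (σ.a A) (I.openEntries K s fun b' _ => b' < b))
    (hQ : ∀ τ : Mem, (∀ y : Var, ¬ y.Scratch → y ≠ .r → τ.v y = σ.v y) →
      (∀ A' ≠ A, τ.a A' = σ.a A') →
      Rep (2 ^ I.L) 6 (τ.a A) (I.openEntries K s fun b' _ => b' < b + 1) → Q τ) :
    (fillCell K s A).wp Z β Q σ := by
  obtain ⟨s1, s2, s3, s4⟩ := h.good.side s
  have hn := h.n_lt
  refine wp_forLoop (l := I.lo s) (h := I.hi s) (fun i τ =>
    (∀ y : Var, ¬ y.Scratch → y ≠ .r → τ.v y = σ.v y) ∧ (∀ A' ≠ A, τ.a A' = σ.a A') ∧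
    Rep (2 ^ I.L) 6 (τ.a A) (I.openEntries K s fun b' r => b' < b ∨ (b' = b ∧ r < i)))
    (by simp) (h.lo_eq s) (by simp [(Var.hi_global s).ne (z := .r) id, h.hi_eq s]) (by omega)
    s4 s2 ?_ ?_ ?_
  · refine ⟨fun y _ hy => by simp [hy], fun _ _ => rfl, ?_⟩
    refine (congrArg (Rep _ _ _) ?_).mp hR
    ext e
    constructor
    · rintro ⟨b', r, h1, h2⟩
      exact ⟨b', r, .inl h1, h2⟩
    · rintro ⟨b', r, h1, h2, h3, h4⟩
      exact ⟨b', r, by omega, h2, h3, h4⟩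
  · rintro i τ hi1 hi2 hτr - ⟨hv, ha, hR⟩
    have hG : Glob Z β I τ := h.congr (fun y hy => hv y hy.not_scratch (hy.ne id))
      fun A' hA' => ha A' (by omega)
    refine (wp_seq ..).2 (hG.wp_look (fun j => if j ∈ K then I.low K b j else I.pos j i)
      (fun j hj υ h1 h2 => ?_) fun υ h1 h2 h3 => ?_)
    · have h5 := h.good.lt_pow
      by_cases hjK : j ∈ K
      · have : υ.v (.low j) = I.low K b j := by
          rw [h1.1 _ (by simp [Var.Scratch]), hv _ (by simp [Var.Scratch]) (by simp), hlow j hjK]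
        simp [hjK, this]
        have : I.low K b j ≤ I.n := min_le_right _ _
        omega
      · have hr : υ.v .r = i := (h1.1 _ (by simp [Var.Scratch])).trans hτr
        have := (hG.near h1 (by simp [h2])).pos_eq j hj i (by omega) (by omega)
        have := h.good.pos_lt j hj i (by omega) (by omega)
        simp_all
        omega
    · have hGυ := hG.near h1 (by simp [h2])
      have hr : υ.v .r = i := (h1.1 _ (by simp [Var.Scratch])).trans hτr
      refine (wp_ite ..).2 ⟨⟨trivial, by simp; omega⟩, fun hres => ?_, fun hres => ?_⟩
      · have hopen : I.Open K b i := h3.1 (by simpa using hres)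
        refine wp_store ⟨b, I.mix K i, 1⟩ hGυ.base le_rfl (fun j hj ξ g1 g2 => ?_)
          (fun ξ g1 _ => ⟨trivial, ?_⟩) (fun ξ _ _ => ⟨by simp; omega, by simp⟩)
          hbZ (by rw [h2]; exact hR) fun ξ g1 g2 g3 => ?_
        · have := (hGυ.near g1 (by simp [g2])).mixExp K (y := .r)
            ((g1.1 _ (by simp [Var.Scratch])).trans hr) (by omega) (by omega) hj
          exact ⟨this.1, this.2, hG.good.mix_lt K (by omega) (by omega) hj⟩
        · simp [(h1.trans g1).1 .block (by simp [Var.Scratch]),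
            hv .block (by simp [Var.Scratch]) (by simp), hb]
        · have hr : ξ.v .r = i := (g1.1 _ (by simp [Var.Scratch])).trans hr
          have hhi : ξ.v (.hi s) = I.hi s := (hGυ.near g1 fun A' hA' => g2 A' (by omega)).hi_eq s
          refine ⟨hr, hhi, by simp [(Var.hi_global s).ne (z := .r) id, hhi],
            fun y hy hyr => ?_, fun A' hA' => ?_, ?_⟩
          · rw [Mem.set_v, if_neg hyr, (h1.trans g1).1 y hy, hv y hy hyr]
          · rw [Mem.set_a, g2 A' hA', h2, ha A' hA']
          · refine (congrArg (Rep _ _ _) ?_).mp g3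
            ext e
            constructor
            · rintro (rfl | ⟨b', r, h1, h2⟩)
              · exact ⟨b, i, .inr ⟨rfl, by omega⟩, hi1, hi2, hopen, rfl⟩
              · exact ⟨b', r, by omega, h2⟩
            · rintro ⟨b', r, h1, h2, h3, h4, rfl⟩
              by_cases hbr : b' = b ∧ r = i
              · obtain ⟨rfl, rfl⟩ := hbr
                exact .inl rfl
              · exact .inr ⟨b', r, by omega, h2, h3, h4, rfl⟩
      · have hopen : ¬ I.Open K b i := fun ho => hres (by simpa using h3.2 ho)
        have hhi : υ.v (.hi s) = I.hi s := hGυ.hi_eq s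
        refine ⟨hr, hhi, by simp [(Var.hi_global s).ne (z := .r) id, hhi],
            fun y hy hyr => ?_, fun A' hA' => ?_, ?_⟩
        · rw [Mem.set_v, if_neg hyr, h1.1 y hy, hv y hy hyr]
        · rw [Mem.set_a, h2, ha A' hA']
        · rw [Mem.set_a, h2]
          refine (congrArg (Rep _ _ _) ?_).mp hR
          ext e
          constructor
          · rintro ⟨b', r, h1, h2⟩
            exact ⟨b', r, by omega, h2⟩
          · rintro ⟨b', r, h1, h2, h3, h4, rfl⟩
            by_cases hbr : b' = b ∧ r = i
            · obtain ⟨rfl, rfl⟩ := hbr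
              exact absurd h4 hopen
            · exact ⟨b', r, by omega, h2, h3, h4, rfl⟩
  · rintro τ - - ⟨hv, ha, hR⟩
    refine hQ τ hv ha ((congrArg (Rep _ _ _) ?_).mp hR)
    ext e
    constructor
    · rintro ⟨b', r, h1, h2⟩
      exact ⟨b', r, by omega, h2⟩
    · rintro ⟨b', r, h1, h2, h3, h4⟩
      exact ⟨b', r, by omega, h2, h3, h4⟩

/-- Computes the table of open boxes of the side `s` for every cell. -/
def fillCells (K : List ℕ) (s : Bool) (A : ℕ) : Cmd :=
  .blocks ≔ 1 ;;
  (each K fun _ => .blocks ≔ .var .blocks * .var .t) ;;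
  forLoop .block .block 0 .blocks (lows K ;; fillCell K s A)

theorem wp_fillCells {σ : Mem} {Q : Mem → Prop} (h : Glob Z β I σ) {K : List ℕ} (hK : K.Nodup)
    (hK5 : K.length ≤ 5) (s : Bool) {A : ℕ} (hA : 31 ≤ A) (hA0 : σ.a A = fun _ => 0)
    (hQ : ∀ τ : Mem, (∀ y : Var, y.Global ∨ y = .ans → τ.v y = σ.v y) →
      (∀ A' ≠ A, τ.a A' = σ.a A') →
      Rep (2 ^ I.L) 6 (τ.a A) (I.openEntries K s fun b _ => b < I.t ^ K.length) → Q τ) :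
    (fillCells K s A).wp Z β Q σ := by
  have hn := h.n_lt
  have hps := h.good.pow_t_le hK5
  refine (wp_seq ..).2 ((wp_asg ..).2 ⟨by simp; omega, ?_⟩)
  refine (wp_seq ..).2 (wp_each (fun l τ => (∀ y, y ≠ .blocks → τ.v y = σ.v y) ∧ τ.a = σ.a ∧
    τ.v .blocks = I.t ^ l.length) ⟨fun y hy => by simp [hy], rfl, by simp⟩ ?_ ?_)
  · rintro l₁ i l₂ τ rfl ⟨h1, h2, h3⟩
    have hG : Glob Z β I τ := h.congr (fun y hy => h1 y (hy.ne id)) (by simp [h2])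
    have hlt : I.t ^ (l₁ ++ [i]).length < Z := by
      refine h.base.id_lt (h.good.pow_t_le ?_).2
      simp at hK5 ⊢
      omega
    simp only [List.length_append, List.length_singleton, pow_succ] at hlt
    refine (wp_asg ..).2 ⟨by simp [h3, hG.t_eq, hlt], fun y hy => by simp [hy, h1 y hy], h2, ?_⟩
    simp [h3, hG.t_eq, pow_succ]
  · rintro τ ⟨h1, h2, h3⟩
    have hG : Glob Z β I τ := h.congr (fun y hy => h1 y (hy.ne id)) (by simp [h2])
    refine wp_forLoop (l := 0) (h := I.t ^ K.length) (fun b τ =>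
      (∀ y : Var, y.Global ∨ y = .ans → τ.v y = σ.v y) ∧ (∀ A' ≠ A, τ.a A' = σ.a A') ∧
      Rep (2 ^ I.L) 6 (τ.a A) (I.openEntries K s fun b' _ => b' < b)) (by simp; omega) (by simp)
      (by simpa using h3) (h.base.id_lt hps.2) ?_ (by omega) ?_ ?_ ?_
    · have := h.good.block_le
      omega
    · refine ⟨?_, by simp [h2], ?_⟩
      · rintro y (hy | rfl)
        · simp [hy.ne (z := .block) id, h1 y (hy.ne id)]
        · simp [h1]
      · have : I.openEntries K s (fun b' _ => b' < 0) = ∅ := by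
          ext e
          simp [Params.openEntries]
        rw [this, Mem.set_a, h2, hA0]
        exact Rep.empty _ _
    · rintro b τ - hb2 hτb hτe ⟨hv, ha, hR⟩
      have hG : Glob Z β I τ := h.congr (fun y hy => hv y (.inl hy)) fun A' hA' => ha A' (by omega)
      have hb6 : b < (2 * 2 ^ I.L) ^ 6 := by omega
      refine (wp_seq ..).2 (wp_lows hG hK hτb (h.base.id_lt hb6) fun υ g1 g2 g3 => ?_)
      have hGυ : Glob Z β I υ := hG.congr (fun y hy => g1 y (hy.ne id) fun i => hy.ne id)
        (by simp [g2])
      refine wp_fillCell hGυ s hA (b := b) (by rw [g1 _ (by simp) (by simp), hτb]) hb6 g3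
        (by rw [g2]; exact hR) fun ξ k1 k2 k3 => ?_
      refine ⟨?_, ?_, ?_, fun y hy => ?_, fun A' hA' => ?_, k3⟩
      · rw [k1 _ (by simp [Var.Scratch]) (by simp), g1 _ (by simp) (by simp), hτb]
      · rw [k1 _ (by simp [Var.Scratch]) (by simp), g1 _ (by simp) (by simp), hτe]
      · rw [Mem.set_v, if_neg (by simp), k1 _ (by simp [Var.Scratch]) (by simp),
          g1 _ (by simp) (by simp), hτe]
      · rw [← hv y hy]
        rcases hy with hy | rfl
        · rw [Mem.set_v, if_neg (hy.ne id), k1 y hy.not_scratch (hy.ne id),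
            g1 y (hy.ne id) fun i => hy.ne id]
        · rw [Mem.set_v, if_neg (by simp), k1 _ (by simp [Var.Scratch]) (by simp),
            g1 _ (by simp) (by simp)]
      · rw [Mem.set_a, k2 A' hA', g2, ha A' hA']
    · rintro τ - - ⟨hv, ha, hR⟩
      exact hQ τ hv ha hR

end Cmd

end BoxCover

/-! ### Enumerating the boxes that cross a grid cell -/

namespace BoxCover

open RealRAM

variable {I : Params} {Z : ℕ} {β : Kind → ℕ}

namespace Params

variable (I : Params)

/-- `q` is below `p` in the directions of `K`. -/
def Below (K : List ℕ) (p q : ℕ) : Prop :=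
  1 ≤ q ∧ q < I.qe ∧ ∀ i ∈ K, I.pos i q < I.pos i p

/-- The boxes `q` that are below `p` in the directions of `K`, but in one of these directions in the
same slab as `p`. -/
def near (K : List ℕ) (p : ℕ) : Set ℕ :=
  {q | I.Below K p q ∧ ∃ i ∈ K, ∃ u, I.pos i p / I.w * I.w ≤ u ∧
    u < I.pos i p / I.w * I.w + I.w ∧ I.inv i u = q}

end Params

namespace Cmd

/-- Runs `c` if `q` is below `p` in the directions of `K`. -/
def guard (K : List ℕ) (c : Cmd) : Cmd :=
  K.foldr (fun i c => ite (.lt (.get i (.var .q)) (.get i (.var .p))) c skip) c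

theorem wp_guard {σ : Mem} {Q : Mem → Prop} {K : List ℕ} {c : Cmd} {p q : ℕ} (h : Glob Z β I σ)
    (hK : ∀ i ∈ K, i < 6) (hp : σ.v .p = p) (hq : σ.v .q = q) (hp1 : 1 ≤ p) (hpn : p ≤ I.n)
    (hq1 : 1 ≤ q) (hqn : q ≤ I.n) (h1 : (∀ i ∈ K, I.pos i q < I.pos i p) → c.wp Z β Q σ)
    (h2 : (¬ ∀ i ∈ K, I.pos i q < I.pos i p) → Q σ) : (guard K c).wp Z β Q σ := by
  induction K with
  | nil => exact h1 (by simp)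
  | cons i K ih =>
    have e1 := h.pos_eq i (hK i (by simp)) p hp1 hpn
    have e2 := h.pos_eq i (hK i (by simp)) q hq1 hqn
    refine (wp_ite ..).2 ⟨⟨trivial, trivial⟩, fun hlt => ?_, fun hlt => ?_⟩
    · simp only [Cond.holds_lt, Exp.eval_get, Exp.eval_var, hp, hq, e1, e2] at hlt
      refine ih (fun j hj => hK j (by simp [hj])) (fun hall => h1 ?_) fun hall => h2 ?_
      · simpa [hlt] using hall
      · simpa [hlt] using hall
    · simp only [Cond.holds_lt, Exp.eval_get, Exp.eval_var, hp, hq, e1, e2] at hlt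
      exact h2 fun hall => hlt (hall i (by simp))

/-- Runs `c` for all elements `q` of `Params.near K p`, possibly several times. The last slab may
reach beyond the last rank, where the inverse ranking does not contain an item. -/
def scan (K : List ℕ) (c : Cmd) : Cmd :=
  each K fun i =>
    .u ≔ .get i (.var .p) / .var .w * .var .w ;;
    .lim ≔ .var .u + .var .w ;;
    forLoop .slab .u (.var .u) .lim
      (.q ≔ .get (10 + i) (.var .u) ;;
        ite (.lt 0 (.var .q)) (ite (.lt (.var .q) (.var .qe)) (guard K c) skip) skip)

theorem wp_scan {σ : Mem} {Q : Mem → Prop} {K : List ℕ} {c : Cmd} {p : ℕ}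
    (J : Set ℕ → Mem → Prop) (hK : ∀ i ∈ K, i < 6) (hp1 : 1 ≤ p) (hpn : p ≤ I.n)
    (hG : ∀ V τ, J V τ → Glob Z β I τ ∧ τ.v .p = p)
    (hset : ∀ V τ y i, y = .u ∨ y = .lim ∨ y = .q → J V τ → J V (τ.set y i))
    (hc : ∀ V τ q, I.Below K p q → τ.v .q = q → J V τ →
      c.wp Z β (fun τ' => τ'.v .u = τ.v .u ∧ τ'.v .lim = τ.v .lim ∧ J (insert q V) τ') τ)
    (h0 : J ∅ σ) (hQ : ∀ τ, J (I.near K p) τ → Q τ) : (scan K c).wp Z β Q σ := by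
  refine wp_each (fun l => J {q | I.Below K p q ∧ ∃ i ∈ l, ∃ u, I.pos i p / I.w * I.w ≤ u ∧
    u < I.pos i p / I.w * I.w + I.w ∧ I.inv i u = q}) (by simpa using h0) ?_ fun τ hτ => hQ τ hτ
  rintro l i l₂ τ hl hJ
  set V := {q | I.Below K p q ∧ ∃ i ∈ l, ∃ u, I.pos i p / I.w * I.w ≤ u ∧
    u < I.pos i p / I.w * I.w + I.w ∧ I.inv i u = q} with hV
  obtain ⟨hGτ, hpτ⟩ := hG _ _ hJ
  have hi : i < 6 := hK i (by simp [hl])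
  have hn := hGτ.n_lt
  have hpos := hGτ.good.pos_lt i hi p hp1 hpn
  have hpe := hGτ.pos_eq i hi p hp1 hpn
  have hw := hGτ.good.w_le
  have hle : I.pos i p / I.w * I.w ≤ I.pos i p := Nat.div_mul_le_self _ _
  have hle' : I.pos i p / I.w ≤ I.pos i p := Nat.div_le_self _ _
  refine (wp_seq ..).2 ((wp_asg ..).2 ⟨?_, ?_⟩)
  · simp [hpτ, hpe, hGτ.w_eq]
    omega
  simp only [Exp.eval_mul, Exp.eval_div, Exp.eval_get, Exp.eval_var, hpτ, hpe, hGτ.w_eq]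
  set a := I.pos i p / I.w * I.w with ha
  refine (wp_seq ..).2 ((wp_asg ..).2 ⟨?_, ?_⟩)
  · simp [hGτ.w_eq]
    omega
  have hs := hGτ.good.slab_le
  have hew : (Exp.var Var.u + Exp.var Var.w).eval (τ.set .u a) = a + I.w := by simp [hGτ.w_eq]
  rw [hew]
  refine wp_forLoop (l := a) (h := a + I.w) (fun k => J (V ∪ {q | I.Below K p q ∧
    ∃ u, a ≤ u ∧ u < k ∧ I.inv i u = q})) trivial (by simp) (by simp) (by omega) (by omega)
    (by omega) ?_ ?_ ?_
  · have : {q | I.Below K p q ∧ ∃ u, a ≤ u ∧ u < a ∧ I.inv i u = q} = ∅ := by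
      ext q
      simp only [Set.mem_ofPred_eq, Set.mem_empty_iff_false, iff_false]
      rintro ⟨-, u, h1, h2, -⟩
      omega
    rw [this, Set.union_empty]
    exact hset _ _ _ _ (by simp) (hset _ _ _ _ (by simp) (hset _ _ _ _ (by simp) hJ))
  · rintro k υ hk1 hk2 hυu hυl hJυ
    have hGυ := (hG _ _ hJυ).1
    refine (wp_seq ..).2 ((wp_asg ..).2 ⟨trivial, ?_⟩)
    have hq : (Exp.get (10 + i) (.var .u)).eval υ = I.inv i k := by
      simp [hυu, hGυ.inv_eq i hi]
    rw [hq]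
    set q := I.inv i k with hqd
    have hJq := hset _ _ .q q (by simp) hJυ
    have hins : ∀ W : Set ℕ, (I.Below K p q → W = insert q (V ∪ {q | I.Below K p q ∧
        ∃ u, a ≤ u ∧ u < k ∧ I.inv i u = q})) → (¬ I.Below K p q → W = V ∪ {q | I.Below K p q ∧
        ∃ u, a ≤ u ∧ u < k ∧ I.inv i u = q}) →
        W = V ∪ {q | I.Below K p q ∧ ∃ u, a ≤ u ∧ u < k + 1 ∧ I.inv i u = q} := by
      intro W h1 h2
      have key : ∀ q', (∃ u, a ≤ u ∧ u < k + 1 ∧ I.inv i u = q') ↔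
          q' = q ∨ ∃ u, a ≤ u ∧ u < k ∧ I.inv i u = q' := by
        intro q'
        constructor
        · rintro ⟨u, g1, g2, g3⟩
          rcases (show u = k ∨ u < k by omega) with rfl | g4
          · exact .inl g3.symm
          · exact .inr ⟨u, g1, g4, g3⟩
        · rintro (rfl | ⟨u, g1, g2, g3⟩)
          · exact ⟨k, hk1, by omega, rfl⟩
          · exact ⟨u, g1, by omega, g3⟩
      simp only [key]
      by_cases hB : I.Below K p q
      · rw [h1 hB]
        ext q'
        simp only [Set.mem_insert_iff, Set.mem_union, Set.mem_ofPred_eq]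
        constructor
        · rintro (rfl | h | h)
          · exact .inr ⟨hB, .inl rfl⟩
          · exact .inl h
          · exact .inr ⟨h.1, .inr h.2⟩
        · rintro (h | ⟨h, rfl | h'⟩)
          · exact .inr (.inl h)
          · exact .inl rfl
          · exact .inr (.inr ⟨h, h'⟩)
      · rw [h2 hB]
        ext q'
        simp only [Set.mem_union, Set.mem_ofPred_eq]
        constructor
        · rintro (h | h)
          · exact .inl h
          · exact .inr ⟨h.1, .inr h.2⟩
        · rintro (h | ⟨h, rfl | h'⟩)
          · exact .inl h
          · exact absurd h hB
          · exact .inr ⟨h, h'⟩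
    have hskip : ¬ I.Below K p q → (υ.set .q q).v .u = k ∧ (υ.set .q q).v .lim = a + I.w ∧
        ((υ.set .q q).set .u (k + 1)).v .lim = a + I.w ∧ J (V ∪ {q | I.Below K p q ∧
          ∃ u, a ≤ u ∧ u < k + 1 ∧ I.inv i u = q}) ((υ.set .q q).set .u (k + 1)) := by
      intro hB
      refine ⟨by simpa using hυu, by simpa using hυl, by simpa using hυl, ?_⟩
      rw [← hins _ (fun h => absurd h hB) fun _ => rfl]
      exact hset _ _ _ _ (by simp) hJq
    refine (wp_ite ..).2 ⟨⟨by simp; omega, trivial⟩, fun hq0 => ?_, fun hq0 => ?_⟩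
    · have hq0' : 0 < q := by simpa using hq0
      refine (wp_ite ..).2 ⟨⟨trivial, trivial⟩, fun hqe => ?_, fun hqe => ?_⟩
      · have hqe' : q < I.qe := by simpa [hGυ.qe_eq] using hqe
        have hqn := hGυ.good.le_n hqe'
        refine wp_guard ((hG _ _ hJq).1) hK (hG _ _ hJq).2 (by simp) hp1 hpn hq0' hqn
          (fun hall => ?_) fun hall => hskip fun hB => hall hB.2.2
        have hB : I.Below K p q := ⟨hq0', hqe', hall⟩
        refine wp_mono (hc _ _ q hB (by simp) hJq) ?_
        rintro ξ ⟨g1, g2, g3⟩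
        have g2' : ξ.v .lim = a + I.w := by simpa [hυl] using g2
        refine ⟨by simpa [hυu] using g1, g2', by simpa using g2', ?_⟩
        rw [← hins _ (fun _ => rfl) fun h => absurd hB h]
        exact hset _ _ _ _ (by simp) g3
      · have hqe' : ¬ q < I.qe := by simpa [hGυ.qe_eq] using hqe
        exact hskip fun hB => hqe' hB.2.1
    · have hq0' : ¬ 0 < q := by simpa using hq0
      exact hskip fun hB => hq0' hB.1
  · rintro υ - - hJυ
    convert hJυ using 1
    ext q
    simp only [List.mem_append, List.mem_singleton, Set.mem_union, Set.mem_ofPred_eq, hV]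
    constructor
    · rintro ⟨h1, j, h2 | rfl, h3⟩
      · exact .inl ⟨h1, j, h2, h3⟩
      · exact .inr ⟨h1, h3⟩
    · rintro (⟨h1, j, h2, h3⟩ | ⟨h1, h3⟩)
      · exact ⟨h1, j, .inl h2, h3⟩
      · exact ⟨h1, i, .inr rfl, h3⟩

end Cmd

/-! ### Corners by table look-up -/

/-- The minimum of `S`, or `n` if `S` is empty. -/
noncomputable def minOf (n : ℕ) (S : Set ℕ) : ℕ :=
  open Classical in if S.Nonempty then sInf S else n

theorem isMin_minOf (n : ℕ) (S : Set ℕ) : IsMin n S (minOf n S) := by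
  unfold minOf
  split_ifs with h
  · exact ⟨fun i hi => Nat.sInf_le hi, .inr (Nat.sInf_mem h)⟩
  · exact ⟨fun i hi => absurd ⟨i, hi⟩ h, .inl rfl⟩

theorem IsMin.eq {n m m' : ℕ} {S : Set ℕ} (hn : ∀ i ∈ S, i ≤ n) (h : IsMin n S m)
    (h' : IsMin n S m') : m = m' := by
  rcases h.2 with h1 | h1 <;> rcases h'.2 with h2 | h2
  · omega
  · have := h.1 _ h2
    have := hn _ h2
    omega
  · have := h'.1 _ h1
    have := hn _ h1
    omega
  · exact le_antisymm (h.1 _ h2) (h'.1 _ h1)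

/-- The point of the plane with the coordinates `a` and `b`. -/
def pair (a b j : ℕ) : ℕ := if j = 0 then a else b

namespace Params

variable (I : Params)

/-- The minimal rank in direction `z` of the boxes in `D` with ranks below `b` and `c` in the
directions `x` and `y`. -/
noncomputable def top (D : Set ℕ) (x y z b c : ℕ) : ℕ :=
  minOf I.n {v | ∃ i ∈ {i ∈ D | I.pos x i < b ∧ I.pos y i < c}, I.pos z i = v}

/-- The table entries from which `top` can be looked up; as tables compute maxima, the value of an
entry is `I.n - I.pos z q`. -/
def planeEntries (p x y z : ℕ) (D : Set ℕ) : Set Entry :=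
  {e | ∃ q ∈ D, e = ⟨p, pair (I.pos x q) (I.pos y q), I.n - I.pos z q⟩}

/-- The table number `p` in the array `T` contains exactly `planeEntries p x y z D`, and the later
tables are empty. -/
def Has (T : ℕ → ℕ) (p x y z : ℕ) (D : Set ℕ) : Prop :=
  ∃ E : Set Entry, (∀ e ∈ E, e.id < p) ∧ Rep (2 ^ I.L) 2 T (E ∪ I.planeEntries p x y z D)

end Params

theorem Params.Has.zero (p x y z : ℕ) : I.Has (fun _ => 0) p x y z ∅ :=
  ⟨∅, by simp, by simpa [Params.planeEntries] using Rep.empty _ _⟩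

theorem Params.Has.succ {T : ℕ → ℕ} {p x y z : ℕ} {D : Set ℕ} (h : I.Has T p x y z D) :
    I.Has T (p + 1) x y z ∅ := by
  obtain ⟨E, hE, hR⟩ := h
  refine ⟨E ∪ I.planeEntries p x y z D, ?_, by simpa [Params.planeEntries] using hR⟩
  rintro e (he | ⟨q, hq, rfl⟩)
  · exact (hE e he).trans (Nat.lt_succ_self p)
  · exact Nat.lt_succ_self p

namespace Cmd

/-- Adds the box `q` to the table number `p` of `A`. -/
def insertItem (A x y z : ℕ) : Cmd :=
  store A 2 (fun j => if j = 0 then .get x (.var .q) else .get y (.var .q)) (.var .p)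
    (.var .n - .get z (.var .q))

theorem wp_insertItem {σ : Mem} {Q : Mem → Prop} {A x y z p q : ℕ} {D : Set ℕ}
    (h : Glob Z β I σ) (hx : x < 6) (hy : y < 6) (hz : z < 6) (hp : σ.v .p = p) (hpn : p ≤ I.n)
    (hq : σ.v .q = q) (hq1 : 1 ≤ q) (hqn : q ≤ I.n) (hH : I.Has (σ.a A) p x y z D)
    (hQ : ∀ τ : Mem, σ.Near τ → (∀ A' ≠ A, τ.a A' = σ.a A') →
      I.Has (τ.a A) p x y z (insert q D) → Q τ) :
    (insertItem A x y z).wp Z β Q σ := by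
  obtain ⟨E, hE, hR⟩ := hH
  have hn := h.n_lt
  have hlt := h.good.lt_pow
  have hfr : ∀ τ : Mem, σ.Near τ → τ.a = σ.a → ∀ i < 6, τ.a i (τ.v .q) = I.pos i q := by
    intro τ h1 h2 i hi
    rw [h1.1 _ (by simp [Var.Scratch]), hq, h2, h.pos_eq i hi q hq1 hqn]
  refine wp_store ⟨p, pair (I.pos x q) (I.pos y q), I.n - I.pos z q⟩ h.base (by omega)
    (fun j hj τ h1 h2 => ?_) (fun τ h1 h2 => ⟨trivial, ?_⟩) (fun τ h1 h2 => ?_) ?_ hR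
    fun τ h1 h2 h3 => hQ τ h1 h2 ⟨E, hE, (congrArg (Rep _ _ _) ?_).mp h3⟩
  · have e1 := h.good.pos_lt x hx q hq1 hqn
    have e2 := h.good.pos_lt y hy q hq1 hqn
    rcases (show j = 0 ∨ j = 1 by omega) with rfl | rfl
    · simp [pair, hfr τ h1 h2 x hx]
      omega
    · simp [pair, hfr τ h1 h2 y hy]
      omega
  · simp [h1.1 .p (by simp [Var.Scratch]), hp]
  · have e1 := h.good.pos_lt z hz q hq1 hqn
    have e2 : τ.v .n = I.n := (h1.1 .n (by simp [Var.Scratch])).trans h.n_eq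
    simp [e2, hfr τ h1 h2 z hz]
    omega
  · have h3 : (2 * 2 ^ I.L) ^ 1 ≤ (2 * 2 ^ I.L) ^ 6 := Nat.pow_le_pow_right (by omega) (by omega)
    simp only [pow_one] at h3
    show p < _
    omega
  · ext e
    constructor
    · rintro (rfl | h | ⟨i, hi, rfl⟩)
      · exact .inr ⟨q, .inl rfl, rfl⟩
      · exact .inl h
      · exact .inr ⟨i, .inr hi, rfl⟩
    · rintro (h | ⟨i, rfl | hi, rfl⟩)
      · exact .inr (.inl h)
      · exact .inl rfl
      · exact .inr (.inr ⟨i, hi, rfl⟩)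

/-- Looks up the point `(e, f)` in the table number `p` of `A`. -/
def lookPair (A : ℕ) (e f : Exp) : Cmd := look A 2 (fun j => if j = 0 then e else f) (.var .p)

theorem wp_lookPair {σ : Mem} {Q : Mem → Prop} {A x y z p b c : ℕ} {e f : Exp} {D : Set ℕ}
    (h : Glob Z β I σ) (hz : z < 6) (hp : σ.v .p = p) (hpn : p ≤ I.n)
    (hD : ∀ q ∈ D, 1 ≤ q ∧ q < I.qe) (hH : I.Has (σ.a A) p x y z D)
    (he : ∀ τ : Mem, σ.Near τ → τ.a = σ.a → e.Ok Z τ ∧ e.eval τ = b) (hb : b ≤ I.n + 1)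
    (hf : ∀ τ : Mem, σ.Near τ → τ.a = σ.a → f.Ok Z τ ∧ f.eval τ = c) (hc : c ≤ I.n + 1)
    (hQ : ∀ τ : Mem, σ.Near τ → τ.a = σ.a → I.n - τ.v .res = I.top D x y z b c → Q τ) :
    (lookPair A e f).wp Z β Q σ := by
  obtain ⟨E, hE, hR⟩ := hH
  have hn := h.n_lt
  have hlt := h.good.lt_pow
  refine wp_look (pair b c) p h.base (by omega) (fun j hj τ h1 h2 => ?_)
    (fun τ h1 h2 => ⟨trivial, ?_⟩) ?_ hR fun τ h1 h2 h3 => hQ τ h1 h2 ?_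
  · rcases (show j = 0 ∨ j = 1 by omega) with rfl | rfl
    · exact ⟨(he τ h1 h2).1, (he τ h1 h2).2, by show b < _; omega⟩
    · exact ⟨(hf τ h1 h2).1, (hf τ h1 h2).2, by show c < _; omega⟩
  · simp [h1.1 .p (by simp [Var.Scratch]), hp]
  · have h3 : (2 * 2 ^ I.L) ^ 1 ≤ (2 * 2 ^ I.L) ^ 6 := Nat.pow_le_pow_right (by omega) (by omega)
    simp only [pow_one] at h3
    omega
  · have hDn : ∀ q ∈ D, I.pos z q < I.n := fun q hq =>
      h.good.pos_lt z hz q (hD q hq).1 (h.good.le_n (hD q hq).2)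
    refine IsMin.eq (n := I.n) ?_ (IsMax.isMin (f := I.pos z)
      (D := {i ∈ D | I.pos x i < b ∧ I.pos y i < c}) (fun q hq => hDn q hq.1) ?_) (isMin_minOf _ _)
    · rintro v ⟨q, hq, rfl⟩
      exact (hDn q hq.1).le
    · refine (congrArg (IsMax · _) ?_).mp h3
      ext v
      constructor
      · rintro ⟨e, he | ⟨q, hq, rfl⟩, h1, h2, h3⟩
        · exact absurd (hE e he) (by omega)
        · exact ⟨q, ⟨hq, h2 0 (by omega), h2 1 (by omega)⟩, h3⟩
      · rintro ⟨q, ⟨hq, h1, h2⟩, h3⟩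
        refine ⟨_, .inr ⟨q, hq, rfl⟩, rfl, fun j hj => ?_, h3⟩
        rcases (show j = 0 ∨ j = 1 by omega) with rfl | rfl
        · exact h1
        · exact h2

end Cmd

end BoxCover

/-! ### Pairs of boxes that are incomparable -/

namespace BoxCover

open RealRAM

variable {I : Params} {Z : ℕ} {β : Kind → ℕ}

/-- The six directions consist of those in `K` and of `x`, `y` and `z`, which need not be
distinct. -/
structure Splits (K : List ℕ) (x y z : ℕ) : Prop where
  nodup : K.Nodup
  lt : ∀ i ∈ K, i < 6
  length_le : K.length ≤ 5
  x_lt : x < 6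
  y_lt : y < 6
  z_lt : z < 6
  x_notMem : x ∉ K
  y_notMem : y ∉ K
  z_notMem : z ∉ K
  eq_of_notMem : ∀ j < 6, j ∉ K → j = x ∨ j = y ∨ j = z

namespace Params

variable (I : Params)

/-- `p` is below `r` exactly in the directions of `K`. -/
def Comp (K : List ℕ) (p r : ℕ) : Prop :=
  ∀ j < 6, if j ∈ K then I.pos j p < I.pos j r else I.pos j r < I.pos j p

/-- There is a box `r` of the side `s` that is open for the cell `e`, above `p` exactly in the
directions of `K`, and below the corner `(b, c, d)` in the directions `x`, `y`, `z`. -/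
def Hits (K : List ℕ) (s : Bool) (x y z e p b c d : ℕ) : Prop :=
  ∃ r, I.lo s ≤ r ∧ r < I.hi s ∧ I.Open K e r ∧ I.Comp K p r ∧ I.pos x r ≤ b ∧ I.pos y r ≤ c ∧
    I.pos z r ≤ d

end Params

theorem Params.Good.mem_near (h : I.Good Z β) {K : List ℕ} {p q : ℕ} (hK : ∀ i ∈ K, i < 6)
    (hq : I.Below K p q) (hn : q ∉ I.near K p) :
    ∀ i ∈ K, I.pos i q < I.pos i p / I.w * I.w := by
  intro i hi
  by_contra hlt
  refine hn ⟨hq, i, hi, I.pos i q, not_lt.1 hlt, ?_, h.inv_pos i (hK i hi) q hq.1 (h.le_n hq.2.1)⟩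
  have h1 := hq.2.2 i hi
  have h2 := Nat.lt_div_mul_add (a := I.pos i p) (b := I.w) h.one_le_w
  omega

theorem Params.Good.top_le (h : I.Good Z β) {D : Set ℕ} (hD : ∀ q ∈ D, 1 ≤ q ∧ q < I.qe)
    (x y : ℕ) {z : ℕ} (hz : z < 6) (b c : ℕ) : I.top D x y z b c ≤ I.n := by
  rcases (isMin_minOf I.n {v | ∃ i ∈ {i ∈ D | I.pos x i < b ∧ I.pos y i < c}, I.pos z i = v}).2 with
    h1 | ⟨q, ⟨hq, -⟩, h1⟩
  · exact h1.le
  · rw [Params.top, ← h1]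
    exact (h.pos_lt z hz q (hD q hq).1 (h.le_n (hD q hq).2)).le

/-- A box `r` below a corner is not above any `q` that is close to `p`; being open, it is not above
any other `q` below `p` either. -/
theorem Params.Good.bad_of_hits (h : I.Good Z β) {K : List ℕ} {x y z p b c : ℕ} {s : Bool}
    (hK : Splits K x y z) (hp : 1 ≤ p) (hpn : p ≤ I.n)
    (hH : I.Hits K s x y z (I.cell K p) p b c (I.top (I.near K p) x y z b c)) :
    ∃ r, I.lo s ≤ r ∧ r < I.hi s ∧ I.Bad p r := by
  obtain ⟨r, h1, h2, h3, h4, h5, h6, h7⟩ := hH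
  refine ⟨r, h1, h2, ?_⟩
  rintro ⟨q, hq1, hq2, hq⟩
  have hB : I.Below K p q := ⟨hq1, hq2, fun i hi => (hq i (hK.lt i hi)).1⟩
  by_cases hn : q ∈ I.near K p
  · have h8 := (isMin_minOf I.n {v | ∃ i ∈ {i ∈ I.near K p | I.pos x i < b ∧ I.pos y i < c},
      I.pos z i = v}).1 (I.pos z q) ⟨q, ⟨hn, (hq x hK.x_lt).2.trans_le h5,
        (hq y hK.y_lt).2.trans_le h6⟩, rfl⟩
    have h9 := (hq z hK.z_lt).2
    change I.top _ x y z b c ≤ _ at h8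
    omega
  · refine h3 ⟨q, hq1, hq2, fun i hi => ?_⟩
    split_ifs with hiK
    · rw [h.low_cell hK.lt hiK hp hpn]
      exact h.mem_near hK.lt hB hn i hiK
    · exact (hq i hi).2

/-- If no box is found below any corner, then no pair `(p, r)` of the given type is bad. -/
theorem Params.Good.not_bad (h : I.Good Z β) {K : List ℕ} {x y z p r : ℕ} {s : Bool}
    (hK : Splits K x y z) (hp : 1 ≤ p) (hpn : p ≤ I.n) (hr1 : I.lo s ≤ r) (hr2 : r < I.hi s)
    (hc : I.Comp K p r)
    (h0 : ¬ I.Hits K s x y z (I.cell K p) p I.n I.n (I.top (I.near K p) x y z I.n I.n))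
    (h1 : ∀ q ∈ I.near K p,
      (¬ I.Hits K s x y z (I.cell K p) p (I.pos x q)
        (I.top (I.near K p) x z y (I.pos x q) (I.pos z q + 1))
        (I.top (I.near K p) x y z (I.pos x q)
          (I.top (I.near K p) x z y (I.pos x q) (I.pos z q + 1)))) ∧
      ¬ I.Hits K s x y z (I.cell K p) p
        (I.top (I.near K p) y z x (I.pos y q) (I.pos z q + 1)) (I.pos y q)
        (I.top (I.near K p) x y z (I.top (I.near K p) y z x (I.pos y q) (I.pos z q + 1))
          (I.pos y q))) : ¬ I.Bad p r := by
  intro hbad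
  have hside := h.side s
  have hrn : r ≤ I.n := by omega
  have hopen : I.Open K (I.cell K p) r := by
    rintro ⟨q, hq1, hq2, hq⟩
    refine hbad ⟨q, hq1, hq2, fun i hi => ?_⟩
    have h2 := hq i hi
    have h3 := hc i hi
    split_ifs at h2 h3 with hiK
    · rw [h.low_cell hK.lt hiK hp hpn] at h2
      have := Nat.div_mul_le_self (I.pos i p) I.w
      omega
    · omega
  have hD : ∀ q ∈ I.near K p, 1 ≤ q ∧ q < I.qe := fun q hq => ⟨hq.1.1, hq.1.2.1⟩
  have hle : ∀ i < 6, ∀ q ∈ I.near K p, I.pos i q ≤ I.n := fun i hi q hq =>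
    (h.pos_lt i hi q (hD q hq).1 (h.le_n (hD q hq).2)).le
  have hler : ∀ i < 6, I.pos i r ≤ I.n := fun i hi => (h.pos_lt i hi r (by omega) hrn).le
  have hfree : ∀ q ∈ I.near K p, ¬ (I.pos x q < I.pos x r ∧ I.pos y q < I.pos y r ∧
      I.pos z q < I.pos z r) := by
    rintro q hq ⟨hx, hy, hz⟩
    refine hbad ⟨q, (hD q hq).1, (hD q hq).2, fun i hi => ?_⟩
    have h3 := hc i hi
    split_ifs at h3 with hiK
    · have := hq.1.2.2 i hiK
      omega
    · rcases hK.eq_of_notMem i hi hiK with rfl | rfl | rfl <;> omega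
  have key := exists_corner (mz := fun b c => I.top (I.near K p) x y z b c)
    (hler x hK.x_lt) (hler y hK.y_lt) (hler z hK.z_lt)
    (hle x hK.x_lt) (hle y hK.y_lt) hfree (fun q _ => isMin_minOf _ _) (fun q _ => isMin_minOf _ _)
    (fun b c => isMin_minOf _ _)
  rcases key with hz | ⟨q, hq, ⟨k1, k2, k3⟩ | ⟨k1, k2, k3⟩⟩
  · exact h0 ⟨r, hr1, hr2, hopen, hc, hler x hK.x_lt, hler y hK.y_lt, hz⟩
  · exact (h1 q hq).1 ⟨r, hr1, hr2, hopen, hc, k1, k2, k3⟩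
  · exact (h1 q hq).2 ⟨r, hr1, hr2, hopen, hc, k1, k2, k3⟩

/-- The minimum of `e` and `y + 1` if `c` is true, otherwise `e`. -/
def capExp (c : Bool) (y : Var) (e : Exp) : Exp := if c then Exp.min e (.var y + 1) else e

theorem ok_capExp {σ : Mem} {c : Bool} {y : Var} {e : Exp} {i j : ℕ} (hy : σ.v y = i)
    (hi : i + 1 < Z) (he : e.Ok Z σ ∧ e.eval σ = j) (hj : j < Z) :
    (capExp c y e).Ok Z σ ∧ (capExp c y e).eval σ = if c then min j (i + 1) else j := by
  cases c
  · exact he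
  · refine ⟨Exp.Ok.min he.1 ⟨trivial, ?_, ?_⟩ (by rw [he.2]; exact hj), ?_⟩
    · simp
      omega
    · show σ.v y + 1 < Z
      omega
    · simp [capExp, he.2, hy]

namespace Cmd

/-- The point whose coordinates bound the boxes `r` that are above `p` exactly in the directions of
`K` and below the corner `(x₀, y₀, z₀)`. -/
def cornerExp (K : List ℕ) (x y z j : ℕ) : Exp :=
  if j ∈ K then mixExp K .p j
  else capExp (j = x) .x₀ (capExp (j = y) .y₀ (capExp (j = z) .z₀ (mixExp K .p j)))

/-- Completes the corner `(x₀, y₀)` and sets the answer to `0` if there is an open box below it. -/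
def probe (K : List ℕ) (x y z A : ℕ) : Cmd :=
  lookPair (A + 1) (.var .x₀) (.var .y₀) ;;
  .z₀ ≔ .var .n - .var .res ;;
  look A 6 (cornerExp K x y z) (.var .block) ;;
  ite (.lt 0 (.var .res)) (.ans ≔ 0) skip

theorem wp_probe {σ : Mem} {Q : Mem → Prop} {V X : Prop} {K : List ℕ} {s : Bool}
    {x y z A p e b c : ℕ} {D : Set ℕ} (h : Glob Z β I σ) (hK : Splits K x y z)
    (hp : σ.v .p = p) (hp1 : 1 ≤ p) (hpn : p ≤ I.n) (he : σ.v .block = e)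
    (heK : e < I.t ^ K.length) (hb : σ.v .x₀ = b) (hbn : b ≤ I.n) (hc : σ.v .y₀ = c) (hcn : c ≤ I.n)
    (hR : Rep (2 ^ I.L) 6 (σ.a A) (I.openEntries K s fun b _ => b < I.t ^ K.length))
    (hH : I.Has (σ.a (A + 1)) p x y z D) (hD : ∀ q ∈ D, 1 ≤ q ∧ q < I.qe) (hA : Ans V X σ)
    (hV : I.Hits K s x y z e p b c (I.top D x y z b c) → V)
    (hQ : ∀ τ : Mem, (∀ y : Var, ¬ y.Scratch → y ≠ .z₀ → y ≠ .ans → τ.v y = σ.v y) → τ.a = σ.a →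
      Ans V (X ∧ ¬ I.Hits K s x y z e p b c (I.top D x y z b c)) τ → Q τ) :
    (probe K x y z A).wp Z β Q σ := by
  have hn := h.n_lt
  have hlt := h.good.lt_pow
  refine (wp_seq ..).2 (wp_lookPair (b := b) (c := c) h hK.z_lt hp hpn hD hH
    (fun τ h1 _ => ⟨trivial, ?_⟩) (by omega) (fun τ h1 _ => ⟨trivial, ?_⟩) (by omega)
    fun τ h1 h2 h3 => ?_)
  · simp [h1.1 .x₀ (by simp [Var.Scratch]), hb]
  · simp [h1.1 .y₀ (by simp [Var.Scratch]), hc]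
  have hGτ := h.near h1 (by simp [h2])
  set d := I.top D x y z b c with hd
  have hdn : d ≤ I.n := h.good.top_le hD x y hK.z_lt b c
  refine (wp_seq ..).2 ((wp_asg ..).2 ⟨?_, ?_⟩)
  · simp [hGτ.n_eq]
    omega
  have hdv : (Exp.var .n - Exp.var .res).eval τ = d := by simpa [hGτ.n_eq] using h3
  rw [hdv]
  have hGτ' : Glob Z β I (τ.set .z₀ d) := hGτ.set id d
  set g : ℕ → ℕ := fun j => if j ∈ K then I.mix K p j else
    if j = x then min (if j = y then min (if j = z then min (I.mix K p j) (d + 1) else I.mix K p j)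
      (c + 1) else if j = z then min (I.mix K p j) (d + 1) else I.mix K p j) (b + 1)
    else if j = y then min (if j = z then min (I.mix K p j) (d + 1) else I.mix K p j) (c + 1)
    else if j = z then min (I.mix K p j) (d + 1) else I.mix K p j with hg
  have hgle : ∀ j, g j ≤ I.mix K p j := fun j => by
    simp only [hg]
    split_ifs <;> omega
  refine (wp_seq ..).2 (wp_look g e hGτ'.base le_rfl (fun j hj υ g1 g2 => ?_)
    (fun υ g1 g2 => ⟨trivial, ?_⟩) ?_ (by simpa [h2] using hR) fun υ g1 g2 g3 => ?_)
  · have hGυ := hGτ'.near g1 (by simp [g2])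
    have hpυ : υ.v .p = p := by
      rw [g1.1 .p (by simp [Var.Scratch])]
      simp [h1.1 .p (by simp [Var.Scratch]), hp]
    have hx₀ : υ.v .x₀ = b := by
      rw [g1.1 .x₀ (by simp [Var.Scratch])]
      simp [h1.1 .x₀ (by simp [Var.Scratch]), hb]
    have hy₀ : υ.v .y₀ = c := by
      rw [g1.1 .y₀ (by simp [Var.Scratch])]
      simp [h1.1 .y₀ (by simp [Var.Scratch]), hc]
    have hz₀ : υ.v .z₀ = d := by
      rw [g1.1 .z₀ (by simp [Var.Scratch])]
      simp
    have hm := hGυ.mixExp K hpυ hp1 hpn hj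
    have hmlt := h.good.mix_lt K hp1 hpn hj
    have hZ := h.base.le
    refine and_assoc.1 ⟨?_, (hgle j).trans_lt hmlt⟩
    by_cases hjK : j ∈ K
    · simpa [cornerExp, hg, hjK] using hm
    · have k1 := ok_capExp (c := j = z) hz₀ (by omega) hm (Z := Z) (by omega)
      have k2 := ok_capExp (c := j = y) hy₀ (by omega) k1 (Z := Z) (by split_ifs <;> omega)
      have k3 := ok_capExp (c := j = x) hx₀ (by omega) k2 (Z := Z) (by split_ifs <;> omega)
      simpa [cornerExp, hg, hjK] using k3
  · have : υ.v .block = e := by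
      rw [g1.1 .block (by simp [Var.Scratch])]
      simp [h1.1 .block (by simp [Var.Scratch]), he]
    simpa using this
  · exact heK.trans (h.good.pow_t_le hK.length_le).2
  · have hfr : ∀ y : Var, ¬ y.Scratch → y ≠ .z₀ → υ.v y = σ.v y := fun y hy hy' => by
      rw [g1.1 y hy, Mem.set_v, if_neg hy', h1.1 y hy]
    have hiff := IsMax.eq_zero_iff (P := fun en => en.id = e ∧ ∀ j < 6, en.pt j < g j)
      (E := I.openEntries K s fun b _ => b < I.t ^ K.length)
      (m := υ.v .res) (by rintro en ⟨b, q, -, -, -, -, rfl⟩; rfl) (by simpa [and_assoc] using g3)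
    have hhit : (∃ en ∈ I.openEntries K s fun b _ => b < I.t ^ K.length,
        en.id = e ∧ ∀ j < 6, en.pt j < g j) ↔ I.Hits K s x y z e p b c d := by
      have hpt : ∀ r, 1 ≤ r → r ≤ I.n → ((∀ j < 6, I.mix K r j < g j) ↔ I.Comp K p r ∧
          I.pos x r ≤ b ∧ I.pos y r ≤ c ∧ I.pos z r ≤ d) := by
        intro r hr1 hrn
        constructor
        · intro hall
          refine ⟨fun j hj => ?_, ?_, ?_, ?_⟩
          · have k1 := (hall j hj).trans_le (hgle j)
            have k2 := h.good.pos_lt j hj r hr1 hrn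
            have k3 := h.good.pos_lt j hj p hp1 hpn
            simp only [Params.mix] at k1
            split_ifs at k1 ⊢ <;> omega
          · have k1 := hall x hK.x_lt
            simp only [hg, Params.mix, if_neg hK.x_notMem, if_true] at k1
            omega
          · have k1 := hall y hK.y_lt
            simp only [hg, Params.mix, if_neg hK.y_notMem, if_true] at k1
            split_ifs at k1 <;> omega
          · have k1 := hall z hK.z_lt
            simp only [hg, Params.mix, if_neg hK.z_notMem, if_true] at k1
            split_ifs at k1 <;> omega
        · rintro ⟨hcomp, k1, k2, k3⟩ j hj
          have k4 := h.good.pos_lt j hj r hr1 hrn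
          have k5 := h.good.pos_lt j hj p hp1 hpn
          have k6 := hcomp j hj
          simp only [hg, Params.mix]
          by_cases hjK : j ∈ K
          · simp only [hjK, if_true] at k6 ⊢
            omega
          · simp only [hjK, if_false] at k6 ⊢
            split_ifs <;> subst_vars <;> omega
      constructor
      · rintro ⟨_, ⟨e', r, -, k2, k3, k4, rfl⟩, rfl, k5⟩
        have hs := h.good.side s
        obtain ⟨k6, k7⟩ := (hpt r (by omega) (by omega)).1 k5
        exact ⟨r, k2, k3, k4, k6, k7⟩
      · rintro ⟨r, k2, k3, k4, k6, k7⟩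
        have hs := h.good.side s
        exact ⟨_, ⟨e, r, heK, k2, k3, k4, rfl⟩, rfl, (hpt r (by omega) (by omega)).2 ⟨k6, k7⟩⟩
    rw [hhit] at hiff
    refine (wp_ite ..).2 ⟨⟨by simp; omega, trivial⟩, fun hres => ?_, fun hres => ?_⟩
    · have hne : υ.v .res ≠ 0 := by simpa [Nat.pos_iff_ne_zero] using hres
      rw [Ne, hiff, not_not] at hne
      refine (wp_asg ..).2 ⟨by simp; omega, hQ _ (fun y k1 k2 k3 => ?_) (g2.trans h2) ?_⟩
      · simp [k3, hfr y k1 k2]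
      · exact .inl ⟨by simp, hV hne⟩
    · have he0 : υ.v .res = 0 := by simpa using hres
      exact hQ υ (fun y k1 k2 _ => hfr y k1 k2) (g2.trans h2)
        (hA.mono (hfr _ (by simp [Var.Scratch]) (by simp)) fun hX => ⟨hX, hiff.1 he0⟩)

end Cmd

end BoxCover

/-! ### Probing all corners -/

namespace BoxCover

open RealRAM

variable {I : Params} {Z : ℕ} {β : Kind → ℕ}

theorem Var.Global.notMem {y : Var} {l : List Var} (hy : y.Global) (hl : ∀ z ∈ l, ¬ z.Global) :
    y ∉ l := fun h => hl y h hy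

namespace Cmd

/-- Enters all boxes of `Params.near K p` into the three tables that belong to the pairs of
directions. -/
def fillPlanes (K : List ℕ) (x y z A : ℕ) : Cmd :=
  scan K (insertItem (A + 1) x y z ;; insertItem (A + 2) x z y ;; insertItem (A + 3) y z x)

theorem wp_fillPlanes {σ : Mem} {Q : Mem → Prop} {K : List ℕ} {x y z A p : ℕ} (h : Glob Z β I σ)
    (hK : Splits K x y z) (hA : 31 ≤ A) (hp : σ.v .p = p) (hp1 : 1 ≤ p) (hpn : p ≤ I.n)
    (h1 : I.Has (σ.a (A + 1)) p x y z ∅) (h2 : I.Has (σ.a (A + 2)) p x z y ∅)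
    (h3 : I.Has (σ.a (A + 3)) p y z x ∅)
    (hQ : ∀ τ : Mem, (∀ y : Var, ¬ y.Scratch → y ∉ [Var.u, .lim, .q] → τ.v y = σ.v y) →
      (∀ A' ∉ [A + 1, A + 2, A + 3], τ.a A' = σ.a A') →
      I.Has (τ.a (A + 1)) p x y z (I.near K p) → I.Has (τ.a (A + 2)) p x z y (I.near K p) →
      I.Has (τ.a (A + 3)) p y z x (I.near K p) → Q τ) :
    (fillPlanes K x y z A).wp Z β Q σ := by
  have glob : ∀ τ : Mem, (∀ y : Var, ¬ y.Scratch → y ∉ [Var.u, .lim, .q] → τ.v y = σ.v y) →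
      (∀ A' ∉ [A + 1, A + 2, A + 3], τ.a A' = σ.a A') → Glob Z β I τ := fun τ g1 g2 =>
    h.congr (fun y hy => g1 y hy.not_scratch (hy.notMem (by simp [Var.Global])))
      fun A' hA' => g2 A' (by simp; omega)
  refine wp_scan (fun V τ => (∀ y : Var, ¬ y.Scratch → y ∉ [Var.u, .lim, .q] → τ.v y = σ.v y) ∧
      (∀ A' ∉ [A + 1, A + 2, A + 3], τ.a A' = σ.a A') ∧
      I.Has (τ.a (A + 1)) p x y z V ∧ I.Has (τ.a (A + 2)) p x z y V ∧
      I.Has (τ.a (A + 3)) p y z x V) hK.lt hp1 hpn (fun V τ hJ => ⟨glob τ hJ.1 hJ.2.1, ?_⟩) ?_ ?_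
    ⟨fun _ _ _ => rfl, fun _ _ => rfl, h1, h2, h3⟩
    fun τ hJ => hQ τ hJ.1 hJ.2.1 hJ.2.2.1 hJ.2.2.2.1 hJ.2.2.2.2
  · rw [hJ.1 _ (by simp [Var.Scratch]) (by simp), hp]
  · rintro V τ y i hy ⟨g1, g2⟩
    refine ⟨fun y' hy' hl => ?_, g2⟩
    rw [Mem.set_v, if_neg ?_, g1 y' hy' hl]
    rintro rfl
    simp at hl
    tauto
  · rintro V τ q hq hτq ⟨g1, g2, g3, g4, g5⟩
    have hG := glob τ g1 g2
    have hpτ : τ.v .p = p := by rw [g1 _ (by simp [Var.Scratch]) (by simp), hp]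
    have hqn := hG.good.le_n hq.2.1
    refine (wp_seq ..).2 (wp_insertItem hG hK.x_lt hK.y_lt hK.z_lt hpτ hpn hτq hq.1 hqn g3
      fun τ₁ k1 k2 k3 => ?_)
    have hG₁ := hG.near k1 fun A' hA' => k2 A' (by omega)
    refine (wp_seq ..).2 (wp_insertItem hG₁ hK.x_lt hK.z_lt hK.y_lt
      ((k1.1 _ (by simp [Var.Scratch])).trans hpτ) hpn ((k1.1 _ (by simp [Var.Scratch])).trans hτq)
      hq.1 hqn (by rw [k2 _ (by omega)]; exact g4) fun τ₂ l1 l2 l3 => ?_)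
    have hG₂ := hG₁.near l1 fun A' hA' => l2 A' (by omega)
    have k12 := k1.trans l1
    refine wp_insertItem hG₂ hK.y_lt hK.z_lt hK.x_lt
      ((k12.1 _ (by simp [Var.Scratch])).trans hpτ) hpn
      ((k12.1 _ (by simp [Var.Scratch])).trans hτq) hq.1 hqn
      (by rw [l2 _ (by omega), k2 _ (by omega)]; exact g5) fun τ₃ m1 m2 m3 => ?_
    have k123 := k12.trans m1
    refine ⟨k123.1 _ (by simp [Var.Scratch]), k123.1 _ (by simp [Var.Scratch]),
      fun y hy hl => (k123.1 y hy).trans (g1 y hy hl), fun A' hA' => ?_, ?_, ?_, m3⟩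
    · rw [← g2 A' hA']
      simp at hA'
      rw [m2 A' hA'.2.2, l2 A' hA'.2.1, k2 A' hA'.1]
    · rw [m2 _ (by omega), l2 _ (by omega)]
      exact k3
    · rw [m2 _ (by omega)]
      exact l3

/-- Probes the two corners that belong to the box `q`. The corners are bounded by the boxes whose
rank in direction `z` is at most that of `q`; look-ups compare strictly, hence the `+ 1`. -/
def probeItem (K : List ℕ) (x y z A : ℕ) : Cmd :=
  lookPair (A + 2) (.get x (.var .q)) (.get z (.var .q) + 1) ;;
  .y₀ ≔ .var .n - .var .res ;; .x₀ ≔ .get x (.var .q) ;; probe K x y z A ;;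
  lookPair (A + 3) (.get y (.var .q)) (.get z (.var .q) + 1) ;;
  .x₀ ≔ .var .n - .var .res ;; .y₀ ≔ .get y (.var .q) ;; probe K x y z A

/-- No open box is below one of the two corners that belong to `q`. -/
def _root_.BoxCover.Params.Clear (I : Params) (K : List ℕ) (s : Bool) (x y z p q : ℕ) : Prop :=
  (¬ I.Hits K s x y z (I.cell K p) p (I.pos x q)
    (I.top (I.near K p) x z y (I.pos x q) (I.pos z q + 1))
    (I.top (I.near K p) x y z (I.pos x q)
      (I.top (I.near K p) x z y (I.pos x q) (I.pos z q + 1)))) ∧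
  ¬ I.Hits K s x y z (I.cell K p) p
    (I.top (I.near K p) y z x (I.pos y q) (I.pos z q + 1)) (I.pos y q)
    (I.top (I.near K p) x y z (I.top (I.near K p) y z x (I.pos y q) (I.pos z q + 1))
      (I.pos y q))

theorem wp_probeItem {σ : Mem} {Q : Mem → Prop} {V X : Prop} {K : List ℕ} {s : Bool}
    {x y z A p q : ℕ} (h : Glob Z β I σ) (hK : Splits K x y z)
    (hp : σ.v .p = p) (hp1 : 1 ≤ p) (hpn : p ≤ I.n) (hq : σ.v .q = q) (hqB : I.Below K p q)
    (he : σ.v .block = I.cell K p)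
    (hR : Rep (2 ^ I.L) 6 (σ.a A) (I.openEntries K s fun b _ => b < I.t ^ K.length))
    (h1 : I.Has (σ.a (A + 1)) p x y z (I.near K p)) (h2 : I.Has (σ.a (A + 2)) p x z y (I.near K p))
    (h3 : I.Has (σ.a (A + 3)) p y z x (I.near K p)) (hA : Ans V X σ)
    (hV : ∀ b c, I.Hits K s x y z (I.cell K p) p b c (I.top (I.near K p) x y z b c) → V)
    (hQ : ∀ τ : Mem, (∀ y : Var, ¬ y.Scratch → y ∉ [Var.x₀, .y₀, .z₀, .ans] → τ.v y = σ.v y) →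
      τ.a = σ.a → Ans V (X ∧ I.Clear K s x y z p q) τ → Q τ) :
    (probeItem K x y z A).wp Z β Q σ := by
  have hn := h.n_lt
  have hD : ∀ q ∈ I.near K p, 1 ≤ q ∧ q < I.qe := fun q hq => ⟨hq.1.1, hq.1.2.1⟩
  have hqn := h.good.le_n hqB.2.1
  have hcell := h.good.cell_lt hK.lt hp1 hpn
  have hlt : ∀ i < 6, I.pos i q < I.n := fun i hi => h.good.pos_lt i hi q hqB.1 hqn
  have hget : ∀ i < 6, σ.a i q = I.pos i q := fun i hi => h.pos_eq i hi q hqB.1 hqn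
  have hx := hlt x hK.x_lt
  have hy := hlt y hK.y_lt
  have hz := hlt z hK.z_lt
  have hres : ∀ τ : Mem, Glob Z β I τ → (Exp.var Var.n - Exp.var .res).Ok Z τ := fun τ hτ => by
    simp [hτ.n_eq]
    omega
  refine (wp_seq ..).2 (wp_lookPair (b := I.pos x q) (c := I.pos z q + 1) h hK.y_lt hp hpn hD h2
    (fun τ g1 g2 => ⟨trivial, ?_⟩) (by omega) (fun τ g1 g2 => ?_) (by omega)
    fun τ g1 g2 g3 => ?_)
  · simp [g1.1 .q (by simp [Var.Scratch]), hq, g2, hget x hK.x_lt]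
  · simp [g1.1 .q (by simp [Var.Scratch]), hq, g2, hget z hK.z_lt]
    omega
  have hGτ := h.near g1 (by simp [g2])
  have hτq : τ.v .q = q := (g1.1 .q (by simp [Var.Scratch])).trans hq
  refine (wp_seq ..).2 ((wp_asg ..).2 ⟨hres τ hGτ, (wp_seq ..).2 ((wp_asg ..).2 ⟨trivial, ?_⟩)⟩)
  have e1 : (Exp.var Var.n - Exp.var .res).eval τ =
      I.top (I.near K p) x z y (I.pos x q) (I.pos z q + 1) := by simpa [hGτ.n_eq] using g3
  rw [e1]
  set c₁ := I.top (I.near K p) x z y (I.pos x q) (I.pos z q + 1) with hc₁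
  have hc₁n : c₁ ≤ I.n := h.good.top_le hD x z hK.y_lt _ _
  have e2 : (Exp.get x (.var .q)).eval (τ.set .y₀ c₁) = I.pos x q := by
    simp [hτq, g2, hget x hK.x_lt]
  rw [e2]
  refine (wp_seq ..).2 (wp_probe (b := I.pos x q) (c := c₁) (e := I.cell K p) (s := s) (V := V)
    (X := X) ((hGτ.set (y := .y₀) id c₁).set (y := .x₀) id (I.pos x q)) hK ?_ hp1 hpn ?_ hcell
    (by simp) hx.le (by simp) hc₁n (by simpa [g2] using hR) (by simpa [g2] using h1) hD
    (hA.mono ?_ id) (hV _ _) fun υ k1 k2 k3 => ?_)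
  · simp [g1.1 .p (by simp [Var.Scratch]), hp]
  · simp [g1.1 .block (by simp [Var.Scratch]), he]
  · simp [g1.1 .ans (by simp [Var.Scratch])]
  have k2' : υ.a = σ.a := k2.trans g2
  have frυ : ∀ y : Var, ¬ y.Scratch → y ∉ [Var.x₀, .y₀, .z₀, .ans] → υ.v y = σ.v y := by
    intro y' hy' hl
    simp at hl
    rw [k1 y' hy' hl.2.2.1 hl.2.2.2]
    simp [hl, g1.1 y' hy']
  have hGυ : Glob Z β I υ := h.congr (fun y hy => frυ y hy.not_scratch
    (hy.notMem (by simp [Var.Global]))) (by simp [k2'])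
  have hυq : υ.v .q = q := (frυ .q (by simp [Var.Scratch]) (by simp)).trans hq
  refine (wp_seq ..).2 (wp_lookPair (b := I.pos y q) (c := I.pos z q + 1) hGυ hK.x_lt
    ((frυ .p (by simp [Var.Scratch]) (by simp)).trans hp) hpn hD (by rw [k2']; exact h3)
    (fun ξ l1 l2 => ⟨trivial, ?_⟩) (by omega) (fun ξ l1 l2 => ?_) (by omega)
    fun ξ l1 l2 l3 => ?_)
  · simp [l1.1 .q (by simp [Var.Scratch]), hυq, l2, k2', hget y hK.y_lt]
  · simp [l1.1 .q (by simp [Var.Scratch]), hυq, l2, k2', hget z hK.z_lt]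
    omega
  have l2' : ξ.a = σ.a := l2.trans k2'
  have frξ : ∀ y : Var, ¬ y.Scratch → y ∉ [Var.x₀, .y₀, .z₀, .ans] → ξ.v y = σ.v y :=
    fun y hy hl => (l1.1 y hy).trans (frυ y hy hl)
  have hGξ := hGυ.near l1 (by simp [l2])
  have hξq : ξ.v .q = q := (frξ .q (by simp [Var.Scratch]) (by simp)).trans hq
  refine (wp_seq ..).2 ((wp_asg ..).2 ⟨hres ξ hGξ, (wp_seq ..).2 ((wp_asg ..).2 ⟨trivial, ?_⟩)⟩)
  have e3 : (Exp.var Var.n - Exp.var .res).eval ξ =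
      I.top (I.near K p) y z x (I.pos y q) (I.pos z q + 1) := by simpa [hGξ.n_eq] using l3
  rw [e3]
  set b₁ := I.top (I.near K p) y z x (I.pos y q) (I.pos z q + 1) with hb₁
  have hb₁n : b₁ ≤ I.n := h.good.top_le hD y z hK.x_lt _ _
  have e4 : (Exp.get y (.var .q)).eval (ξ.set .x₀ b₁) = I.pos y q := by
    simp [hξq, l2', hget y hK.y_lt]
  rw [e4]
  refine wp_probe (b := b₁) (c := I.pos y q) (e := I.cell K p) (s := s) (V := V)
    (X := X ∧ ¬ I.Hits K s x y z (I.cell K p) p (I.pos x q) c₁ (I.top (I.near K p) x y z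
      (I.pos x q) c₁)) ((hGξ.set (y := .x₀) id b₁).set (y := .y₀) id (I.pos y q)) hK ?_ hp1 hpn ?_
    hcell (by simp) hb₁n (by simp) hy.le (by simpa [l2'] using hR) (by simpa [l2'] using h1) hD
    (k3.mono ?_ id) (hV _ _) fun ζ m1 m2 m3 => ?_
  · simp [frξ .p (by simp [Var.Scratch]) (by simp), hp]
  · simp [frξ .block (by simp [Var.Scratch]) (by simp), he]
  · simp [l1.1 .ans (by simp [Var.Scratch])]
  refine hQ ζ (fun y' hy' hl => ?_) (m2.trans l2') (m3.mono rfl fun hX =>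
    ⟨hX.1.1, hX.1.2, hX.2⟩)
  rw [← frξ y' hy' hl]
  simp at hl
  rw [m1 y' hy' hl.2.2.1 hl.2.2.2]
  simp [hl]

/-- Probes all corners for the box `p`. -/
def probeAll (K : List ℕ) (x y z A : ℕ) : Cmd :=
  .x₀ ≔ .var .n ;; .y₀ ≔ .var .n ;; probe K x y z A ;; scan K (probeItem K x y z A)

theorem wp_probeAll {σ : Mem} {Q : Mem → Prop} {V X : Prop} {K : List ℕ} {s : Bool}
    {x y z A p : ℕ} (h : Glob Z β I σ) (hK : Splits K x y z)
    (hp : σ.v .p = p) (hp1 : 1 ≤ p) (hpn : p ≤ I.n)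
    (he : σ.v .block = I.cell K p)
    (hR : Rep (2 ^ I.L) 6 (σ.a A) (I.openEntries K s fun b _ => b < I.t ^ K.length))
    (h1 : I.Has (σ.a (A + 1)) p x y z (I.near K p)) (h2 : I.Has (σ.a (A + 2)) p x z y (I.near K p))
    (h3 : I.Has (σ.a (A + 3)) p y z x (I.near K p)) (hA : Ans V X σ)
    (hV : ∀ r, I.lo s ≤ r → r < I.hi s → I.Bad p r → V)
    (hQ : ∀ τ : Mem, (∀ y : Var, ¬ y.Scratch → y ∉ [Var.u, .lim, .q, .x₀, .y₀, .z₀, .ans] →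
      τ.v y = σ.v y) → τ.a = σ.a →
      Ans V (X ∧ ∀ r, I.lo s ≤ r → r < I.hi s → I.Comp K p r → ¬ I.Bad p r) τ → Q τ) :
    (probeAll K x y z A).wp Z β Q σ := by
  have hn := h.n_lt
  have hD : ∀ q ∈ I.near K p, 1 ≤ q ∧ q < I.qe := fun q hq => ⟨hq.1.1, hq.1.2.1⟩
  have hcell := h.good.cell_lt hK.lt hp1 hpn
  have hV' : ∀ b c, I.Hits K s x y z (I.cell K p) p b c (I.top (I.near K p) x y z b c) → V :=
    fun b c hH => by
      obtain ⟨r, g1, g2, g3⟩ := h.good.bad_of_hits hK hp1 hpn hH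
      exact hV r g1 g2 g3
  refine (wp_seq ..).2 ((wp_asg ..).2 ⟨trivial, (wp_seq ..).2 ((wp_asg ..).2 ⟨trivial, ?_⟩)⟩)
  have e1 : (Exp.var Var.n).eval (σ.set .x₀ ((Exp.var Var.n).eval σ)) = I.n := by simp [h.n_eq]
  rw [e1, Exp.eval_var, h.n_eq]
  refine (wp_seq ..).2 (wp_probe (b := I.n) (c := I.n) (e := I.cell K p) (s := s) (V := V)
    (X := X) ((h.set (y := .x₀) id _).set (y := .y₀) id _) hK (by simpa using hp) hp1 hpn
    (by simpa using he) hcell (by simp) le_rfl (by simp) le_rfl hR h1 hD (hA.mono (by simp) id)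
    (hV' _ _) fun τ g1 g2 g3 => ?_)
  replace g2 : τ.a = σ.a := g2
  refine wp_scan (fun W τ => (∀ y : Var, ¬ y.Scratch →
      y ∉ [Var.u, .lim, .q, .x₀, .y₀, .z₀, .ans] → τ.v y = σ.v y) ∧ τ.a = σ.a ∧
      Ans V ((X ∧ ¬ I.Hits K s x y z (I.cell K p) p I.n I.n (I.top (I.near K p) x y z I.n I.n)) ∧
        ∀ q ∈ W, I.Clear K s x y z p q) τ)
    hK.lt hp1 hpn (fun W τ hJ => ⟨?_, ?_⟩) ?_ ?_ ⟨fun y hy hl => ?_, g2, g3.mono rfl ?_⟩ ?_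
  · exact h.congr (fun y hy => hJ.1 y hy.not_scratch (hy.notMem (by simp [Var.Global])))
      (by simp [hJ.2.1])
  · rw [hJ.1 _ (by simp [Var.Scratch]) (by simp), hp]
  · rintro W τ y i hy ⟨k1, k2, k3⟩
    refine ⟨fun y' hy' hl => ?_, k2, k3.mono ?_ id⟩
    · rw [Mem.set_v, if_neg ?_, k1 y' hy' hl]
      rintro rfl
      simp at hl
      tauto
    · rw [Mem.set_v, if_neg]
      rintro rfl
      simp at hy
  · rintro W τ q hq hτq ⟨k1, k2, k3⟩
    refine wp_probeItem (s := s) (h.congr (fun y hy => k1 y hy.not_scratch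
      (hy.notMem (by simp [Var.Global]))) (by simp [k2])) hK
      ((k1 _ (by simp [Var.Scratch]) (by simp)).trans hp) hp1 hpn hτq hq
      ((k1 _ (by simp [Var.Scratch]) (by simp)).trans he) (by rw [k2]; exact hR)
      (by rw [k2]; exact h1) (by rw [k2]; exact h2) (by rw [k2]; exact h3) k3 hV'
      fun υ l1 l2 l3 => ⟨l1 _ (by simp [Var.Scratch]) (by simp),
        l1 _ (by simp [Var.Scratch]) (by simp), fun y hy hl => ?_, l2.trans k2, l3.mono rfl ?_⟩
    · rw [← k1 y hy hl]
      simp at hl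
      exact l1 y hy (by simp [hl])
    · rintro ⟨⟨hX, hW⟩, hC⟩
      refine ⟨hX, ?_⟩
      rintro q' (rfl | hq')
      · exact hC
      · exact hW q' hq'
  · simp at hl
    rw [g1 y hy hl.2.2.2.2.2.1 hl.2.2.2.2.2.2]
    simp [hl]
  · exact fun hX => ⟨hX, by simp⟩
  · rintro υ ⟨k1, k2, k3⟩
    refine hQ υ k1 k2 (k3.mono rfl ?_)
    rintro ⟨⟨hX, h0⟩, hC⟩
    exact ⟨hX, fun r hr1 hr2 hc => h.good.not_bad hK hp1 hpn hr1 hr2 hc h0 hC⟩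

/-- Computes the number of the cell that contains the box `p`. -/
def findCell (K : List ℕ) : Cmd :=
  .block ≔ 0 ;; each K.reverse fun i => .block ≔ .var .block * .var .t + .get i (.var .p) / .var .w

theorem wp_findCell {σ : Mem} {Q : Mem → Prop} {K : List ℕ} {p : ℕ} (h : Glob Z β I σ)
    (hK : ∀ i ∈ K, i < 6) (hK5 : K.length ≤ 5) (hp : σ.v .p = p) (hp1 : 1 ≤ p) (hpn : p ≤ I.n)
    (hQ : Q (σ.set .block (I.cell K p))) : (findCell K).wp Z β Q σ := by
  have hn := h.n_lt
  refine (wp_seq ..).2 ((wp_asg ..).2 ⟨by simp; omega, ?_⟩)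
  refine wp_each (fun l τ => τ = σ.set .block (I.cell l.reverse p)) rfl ?_ fun τ hτ => ?_
  · rintro l₁ i l₂ τ hl rfl
    have hsub : ∀ j ∈ i :: l₁.reverse, j < 6 := fun j hj => hK j <| by
      rw [← List.mem_reverse, hl]
      simp at hj ⊢
      tauto
    have hlen : (i :: l₁.reverse).length ≤ 5 := by
      have := congrArg List.length hl
      simp at this ⊢
      omega
    have hi := hsub i (by simp)
    have e1 := h.pos_eq i hi p hp1 hpn
    have hcell := h.good.cell_lt hsub hp1 hpn
    have hlt := h.base.id_lt (hcell.trans (h.good.pow_t_le hlen).2)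
    have hc : I.cell (i :: l₁.reverse) p = I.cell l₁.reverse p * I.t + I.pos i p / I.w := rfl
    have he : (Exp.var Var.block * .var .t + .get i (.var .p) / .var .w).eval
        (σ.set .block (I.cell l₁.reverse p)) = I.cell (i :: l₁.reverse) p := by
      simp [h.t_eq, h.w_eq, hp, e1, hc]
    refine (wp_asg ..).2 ⟨?_, ?_⟩
    · have hle := Nat.div_le_self (I.pos i p) I.w
      have hlt' := h.good.pos_lt i hi p hp1 hpn
      rw [hc] at hlt
      simp only [Exp.ok_add, Exp.ok_mul, Exp.ok_var, Exp.ok_div, Exp.ok_get, Exp.eval_mul,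
        Exp.eval_var, Exp.eval_div, Exp.eval_get, Mem.set_v, Mem.set_a, if_true, hp, e1,
        h.t_eq, h.w_eq, true_and, reduceCtorEq, if_false]
      clear he hc
      generalize I.pos i p / I.w = d at *
      omega
    · rw [he]
      simp only [Mem.set, Function.update_idem, List.reverse_append, List.reverse_singleton,
        List.singleton_append]
  · rw [hτ, List.reverse_reverse]
    exact hQ

/-- Checks all pairs of a box `p` of the side `s` and a box `r` of the other side such that `r` has
the larger rank exactly in the directions of `K`. -/
def stage (K : List ℕ) (s : Bool) (x y z A : ℕ) : Cmd :=
  fillCells K (!s) A ;;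
  forLoop .item .p (.var (.lo s)) (.hi s)
    (findCell K ;; fillPlanes K x y z A ;; probeAll K x y z A)

theorem wp_stage {σ : Mem} {Q : Mem → Prop} {V X : Prop} {K : List ℕ} {x y z A : ℕ}
    (h : Glob Z β I σ) (s : Bool) (hK : Splits K x y z) (hA : 31 ≤ A)
    (hA0 : ∀ A' ∈ [A, A + 1, A + 2, A + 3], σ.a A' = fun _ => 0) (hAns : Ans V X σ)
    (hV : ∀ p r, I.lo s ≤ p → p < I.hi s → I.lo (!s) ≤ r → r < I.hi (!s) → I.Bad p r → V)
    (hQ : ∀ τ : Mem, Glob Z β I τ → (∀ A' ∉ [A, A + 1, A + 2, A + 3], τ.a A' = σ.a A') →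
      Ans V (X ∧ ∀ p r, I.lo s ≤ p → p < I.hi s → I.lo (!s) ≤ r → r < I.hi (!s) →
        I.Comp K p r → ¬ I.Bad p r) τ → Q τ) :
    (stage K s x y z A).wp Z β Q σ := by
  obtain ⟨s1, s2, s3, s4⟩ := h.good.side s
  have hn := h.n_lt
  refine (wp_seq ..).2 (wp_fillCells h hK.nodup hK.length_le (!s) hA (hA0 A (by simp))
    fun σ' hv' ha' hR => ?_)
  have hG' : Glob Z β I σ' := h.congr (fun y hy => hv' y (.inl hy)) fun A' hA' => ha' A' (by omega)
  refine wp_forLoop (l := I.lo s) (h := I.hi s) (fun i τ =>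
    (∀ y : Var, y.Global → τ.v y = σ'.v y) ∧ (∀ A' ∉ [A + 1, A + 2, A + 3], τ.a A' = σ'.a A') ∧
    I.Has (τ.a (A + 1)) i x y z ∅ ∧ I.Has (τ.a (A + 2)) i x z y ∅ ∧ I.Has (τ.a (A + 3)) i y z x ∅ ∧
    Ans V (X ∧ ∀ p r, I.lo s ≤ p → p < i → I.lo (!s) ≤ r → r < I.hi (!s) →
        I.Comp K p r → ¬ I.Bad p r) τ)
    (by simp) (hG'.lo_eq s) (by simp [(Var.hi_global s).ne (z := .p) id, hG'.hi_eq s]) (by omega)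
    s4 s2 ?_ ?_ ?_
  · refine ⟨fun y hy => by simp [hy.ne (z := .p) id], fun _ _ => rfl, ?_, ?_, ?_,
      hAns.mono (by simp [hv']) fun hX => ⟨hX, fun p r h1 h2 => by omega⟩⟩ <;>
    · rw [Mem.set_a, ha' _ (by omega), hA0 _ (by simp)]
      exact Params.Has.zero ..
  · rintro i τ hi1 hi2 hτp - ⟨hv, ha, h1, h2, h3, hans⟩
    have hG : Glob Z β I τ := hG'.congr hv fun A' hA' => ha A' (by simp; omega)
    have hcell := h.good.cell_lt hK.lt (p := i) (by omega) (by omega)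
    refine (wp_seq ..).2 (wp_findCell hG hK.lt hK.length_le hτp (by omega) (by omega) ?_)
    refine (wp_seq ..).2 (wp_fillPlanes (p := i) (hG.set (y := .block) id _) hK hA
      (by simpa using hτp) (by omega) (by omega) h1 h2 h3 fun υ g1 g2 g3 g4 g5 => ?_)
    have hGυ : Glob Z β I υ := (hG.set (y := .block) id (I.cell K i)).congr
      (fun y hy => g1 y hy.not_scratch (hy.notMem (by simp [Var.Global])))
      fun A' hA' => g2 A' (by simp; omega)
    have hRυ : Rep (2 ^ I.L) 6 (υ.a A) (I.openEntries K (!s) fun b _ => b < I.t ^ K.length) := by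
      rw [g2 A (by simp), Mem.set_a, ha A (by simp)]
      exact hR
    have hυp : υ.v .p = i := by rw [g1 _ (by simp [Var.Scratch]) (by simp)]; simpa using hτp
    refine wp_probeAll (p := i) (s := !s) hGυ hK hυp (by omega) (by omega) ?_ hRυ g3 g4 g5
      (hans.mono ?_ id) (fun r k1 k2 k3 => hV i r hi1 hi2 k1 k2 k3) fun ξ k1 k2 k3 => ?_
    · rw [g1 _ (by simp [Var.Scratch]) (by simp)]
      simp
    · rw [g1 _ (by simp [Var.Scratch]) (by simp)]
      simp
    have hGξ : Glob Z β I ξ := hGυ.congr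
      (fun y hy => k1 y hy.not_scratch (hy.notMem (by simp [Var.Global]))) (by simp [k2])
    have hhi : ξ.v (.hi s) = I.hi s := hGξ.hi_eq s
    refine ⟨(k1 _ (by simp [Var.Scratch]) (by simp)).trans hυp, hhi,
      by simp [(Var.hi_global s).ne (z := .p) id, hhi], fun y hy => ?_, fun A' hA' => ?_,
      ?_, ?_, ?_, k3.mono (by simp) ?_⟩
    · rw [Mem.set_v, if_neg (hy.ne id), k1 y hy.not_scratch (hy.notMem (by simp [Var.Global])),
        g1 y hy.not_scratch (hy.notMem (by simp [Var.Global])), Mem.set_v, if_neg (hy.ne id),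
        hv y hy]
    · rw [Mem.set_a, k2, g2 A' hA', Mem.set_a, ha A' hA']
    · rw [Mem.set_a, k2]
      exact g3.succ
    · rw [Mem.set_a, k2]
      exact g4.succ
    · rw [Mem.set_a, k2]
      exact g5.succ
    · rintro ⟨⟨hX, hall⟩, hnew⟩
      refine ⟨hX, fun p r l1 l2 l3 l4 l5 => ?_⟩
      rcases (show p < i ∨ p = i by omega) with l6 | rfl
      · exact hall p r l1 l6 l3 l4 l5
      · exact hnew r l3 l4 l5
  · rintro τ - - ⟨hv, ha, -, -, -, hans⟩
    refine hQ τ (hG'.congr hv fun A' hA' => ha A' (by simp; omega)) (fun A' hA' => ?_) hans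
    simp only [List.mem_cons, not_or] at hA'
    rw [ha A' (by simp only [List.mem_cons, not_or]; exact hA'.2), ha' A' hA'.1]

end Cmd

/-! ### Checking all pairs -/

/-- The directions other than `x`, `y` and `z`. -/
def others (x y z : ℕ) : List ℕ := (List.range 6).filter fun j => j ≠ x ∧ j ≠ y ∧ j ≠ z

theorem mem_others {x y z j : ℕ} : j ∈ others x y z ↔ j < 6 ∧ j ≠ x ∧ j ≠ y ∧ j ≠ z := by
  simp [others]

theorem splits_others {x y z : ℕ} (hx : x < 6) (hy : y < 6) (hz : z < 6) :
    Splits (others x y z) x y z where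
  nodup := List.nodup_range.filter _
  lt i hi := (mem_others.1 hi).1
  length_le := by
    have : (others x y z).length < (List.range 6).length :=
      List.length_filter_lt_length_iff_exists.2 ⟨x, by simpa using hx, by simp⟩
    simp at this
    omega
  x_lt := hx
  y_lt := hy
  z_lt := hz
  x_notMem h := (mem_others.1 h).2.1 rfl
  y_notMem h := (mem_others.1 h).2.2.1 rfl
  z_notMem h := (mem_others.1 h).2.2.2 rfl
  eq_of_notMem j hj h := by
    by_contra hn
    push Not at hn
    exact h (mem_others.2 ⟨hj, hn⟩)

/-- A set of one, two or three directions consists of three directions that need not be distinct. -/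
theorem exists_triple {S : Finset ℕ} (h0 : S.Nonempty) (h3 : S.card ≤ 3) :
    ∃ x ∈ S, ∃ y ∈ S, ∃ z ∈ S, ∀ j ∈ S, j = x ∨ j = y ∨ j = z := by
  have h1 := h0.card_pos
  rcases (show S.card = 1 ∨ S.card = 2 ∨ S.card = 3 by omega) with h | h | h
  · obtain ⟨x, rfl⟩ := Finset.card_eq_one.1 h
    exact ⟨x, by simp, x, by simp, x, by simp, by simp⟩
  · obtain ⟨x, y, -, rfl⟩ := Finset.card_eq_two.1 h
    exact ⟨x, by simp, y, by simp, y, by simp, by simp⟩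
  · obtain ⟨x, y, z, -, -, -, rfl⟩ := Finset.card_eq_three.1 h
    exact ⟨x, by simp, y, by simp, z, by simp, by simp⟩

theorem Params.Good.pos_ne (h : I.Good Z β) {i p r : ℕ} (hi : i < 6) (hp : 1 ≤ p) (hpn : p ≤ I.n)
    (hr : 1 ≤ r) (hrn : r ≤ I.n) (hpr : p ≠ r) : I.pos i p ≠ I.pos i r := fun he =>
  hpr <| by rw [← h.inv_pos i hi p hp hpn, he, h.inv_pos i hi r hr hrn]

/-- No pair of a box `p` of the side `s` and a box `r` of the other side such that `r` has the
larger rank exactly in the directions of `K` is bad. -/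
def Params.Checked (I : Params) (s : Bool) (K : List ℕ) : Prop :=
  ∀ p r, I.lo s ≤ p → p < I.hi s → I.lo (!s) ≤ r → r < I.hi (!s) → I.Comp K p r → ¬ I.Bad p r

theorem Params.Good.not_bad_of_checked (h : I.Good Z β) {s : Bool}
    (h0 : I.Checked s (List.range 6))
    (h1 : ∀ x < 6, ∀ y < 6, ∀ z < 6, I.Checked s (others x y z)) {p r : ℕ}
    (hp : I.lo s ≤ p) (hp' : p < I.hi s) (hr : I.lo (!s) ≤ r) (hr' : r < I.hi (!s)) (hpr : p ≠ r)
    (hc : {i ∈ Finset.range 6 | I.pos i r < I.pos i p}.card ≤ 3) : ¬ I.Bad p r := by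
  obtain ⟨s1, s2, s3, s4⟩ := h.side s
  obtain ⟨t1, t2, t3, t4⟩ := h.side (!s)
  have hne : ∀ i < 6, I.pos i p ≠ I.pos i r := fun i hi =>
    h.pos_ne hi (by omega) (by omega) (by omega) (by omega) hpr
  rcases Finset.eq_empty_or_nonempty {i ∈ Finset.range 6 | I.pos i r < I.pos i p} with he | he
  · refine h0 p r hp hp' hr hr' fun j hj => ?_
    rw [if_pos (by simpa using hj)]
    have : j ∉ {i ∈ Finset.range 6 | I.pos i r < I.pos i p} := by simp [he]
    simp at this
    have := this hj
    have := hne j hj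
    omega
  · obtain ⟨x, hx, y, hy, z, hz, hall⟩ := exists_triple he hc
    simp only [Finset.mem_filter, Finset.mem_range] at hx hy hz hall
    refine h1 x hx.1 y hy.1 z hz.1 p r hp hp' hr hr' fun j hj => ?_
    split_ifs with hjK
    · have := fun hlt => hall j ⟨hj, hlt⟩
      have h2 := (mem_others.1 hjK).2
      have := hne j hj
      omega
    · have h2 : ¬ (j ≠ x ∧ j ≠ y ∧ j ≠ z) := fun h2 => hjK (mem_others.2 ⟨hj, h2⟩)
      by_cases j = x
      · simp_all
      · by_cases j = y
        · simp_all
        · simp_all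

/-- Exchanging `p` and `r` reduces the case of more than three directions in which `p` has the
larger rank to the case of at most three. -/
theorem Params.Good.forall_not_bad (h : I.Good Z β)
    (h0 : ∀ s, I.Checked s (List.range 6))
    (h1 : ∀ s, ∀ x < 6, ∀ y < 6, ∀ z < 6, I.Checked s (others x y z)) :
    ∀ p r, I.qe ≤ p → p < I.pe → I.pe ≤ r → r < I.re → ¬ I.Bad p r := by
  intro p r hp hp' hr hr'
  have hpr : p ≠ r := by omega
  by_cases hc : {i ∈ Finset.range 6 | I.pos i r < I.pos i p}.card ≤ 3
  · exact h.not_bad_of_checked (s := true) (h0 _) (h1 _) hp hp' hr hr' hpr hc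
  · refine fun hb => h.not_bad_of_checked (s := false) (h0 _) (h1 _) hr hr' hp hp' hpr.symm ?_
      hb.symm
    have h2 : Disjoint {i ∈ Finset.range 6 | I.pos i r < I.pos i p}
        {i ∈ Finset.range 6 | I.pos i p < I.pos i r} :=
      Finset.disjoint_filter.2 fun i _ h3 h4 => by omega
    have h3 := Finset.card_union_of_disjoint h2
    have h4 : ({i ∈ Finset.range 6 | I.pos i r < I.pos i p} ∪
        {i ∈ Finset.range 6 | I.pos i p < I.pos i r}).card ≤ (Finset.range 6).card :=
      Finset.card_le_card (Finset.union_subset (Finset.filter_subset _ _)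
        (Finset.filter_subset _ _))
    rw [Finset.card_range] at h4
    omega

namespace Cmd

/-- The stages for the triple of directions number `k`, for both sides. -/
def stages (k : ℕ) : Cmd :=
  stage (others (k / 36) (k / 6 % 6) (k % 6)) true (k / 36) (k / 6 % 6) (k % 6) (40 + 8 * k) ;;
  stage (others (k / 36) (k / 6 % 6) (k % 6)) false (k / 36) (k / 6 % 6) (k % 6) (44 + 8 * k)

/-- Checks all pairs. -/
def checkAll : Cmd := stageZero true 31 ;; stageZero false 32 ;; each (List.range 216) stages

theorem wp_checkAll {σ : Mem} {Q : Mem → Prop} (h : Glob Z β I σ)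
    (hA0 : ∀ A, 31 ≤ A → σ.a A = fun _ => 0) (hans : σ.v .ans = 1)
    (hQ : ∀ τ : Mem, Ans (∃ p r, I.qe ≤ p ∧ p < I.pe ∧ I.pe ≤ r ∧ r < I.re ∧ I.Bad p r)
      (∀ p r, I.qe ≤ p → p < I.pe → I.pe ≤ r → r < I.re → ¬ I.Bad p r) τ → Q τ) :
    checkAll.wp Z β Q σ := by
  set V := ∃ p r, I.qe ≤ p ∧ p < I.pe ∧ I.pe ≤ r ∧ r < I.re ∧ I.Bad p r with hVdef
  have hV : ∀ s p r, I.lo s ≤ p → p < I.hi s → I.lo (!s) ≤ r → r < I.hi (!s) → I.Bad p r → V := by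
    rintro (_ | _) p r h1 h2 h3 h4 h5
    · exact ⟨r, p, h3, h4, h1, h2, h5.symm⟩
    · exact ⟨p, r, h1, h2, h3, h4, h5⟩
  have hcomp : ∀ s, (∀ p r, I.lo s ≤ p → p < I.hi s → I.lo (!s) ≤ r → r < I.hi (!s) →
      (∀ i < 6, I.pos i p < I.pos i r) → ¬ I.Bad p r) → I.Checked s (List.range 6) := by
    intro s h1 p r h2 h3 h4 h5 h6
    exact h1 p r h2 h3 h4 h5 fun i hi => by simpa [hi] using h6 i hi
  refine (wp_seq ..).2 (wp_stageZero (V := V) (X := True) h true (by omega) (hA0 _ (by omega))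
    (.inr ⟨hans, trivial⟩) (hV true) fun σ₁ g1 g2 g3 => ?_)
  refine (wp_seq ..).2 (wp_stageZero (V := V) g1 false (by omega)
    (by rw [g2 _ (by omega)]; exact hA0 _ (by omega)) g3 (hV false) fun σ₂ k1 k2 k3 => ?_)
  refine wp_each (fun l τ => Glob Z β I τ ∧ (∀ A, 40 + 8 * l.length ≤ A → τ.a A = fun _ => 0) ∧
    Ans V ((∀ s, I.Checked s (List.range 6)) ∧ ∀ k < l.length, ∀ s,
      I.Checked s (others (k / 36) (k / 6 % 6) (k % 6))) τ) ⟨k1, fun A hA => ?_, k3.mono rfl ?_⟩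
      ?_ ?_
  · rw [k2 _ (by simp at hA; omega), g2 _ (by simp at hA; omega)]
    exact hA0 _ (by simp at hA; omega)
  · rintro ⟨⟨-, h1⟩, h2⟩
    exact ⟨fun s => by cases s; exacts [hcomp _ h2, hcomp _ h1], by simp⟩
  · rintro l₁ k l₂ τ hl ⟨l1, l2, l3⟩
    have hk : k = l₁.length ∧ k < 216 := by
      have h1 : (List.range 216)[l₁.length]? = some k := by rw [hl]; simp
      rw [List.getElem?_eq_some_iff] at h1
      obtain ⟨h2, h3⟩ := h1
      simp at h2 h3
      omega
    have hS := splits_others (show k / 36 < 6 by omega) (show k / 6 % 6 < 6 by omega)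
      (show k % 6 < 6 by omega)
    rw [← hk.1] at l2 l3
    simp only [List.length_append, List.length_singleton, ← hk.1]
    refine (wp_seq ..).2 (wp_stage (V := V) l1 true hS (by omega)
      (fun A hA => l2 A (by simp at hA; omega)) l3 (hV true) fun τ₁ m1 m2 m3 => ?_)
    refine wp_stage (V := V) m1 false hS (by omega)
      (fun A hA => ?_) m3 (hV false) fun τ₂ n1 n2 n3 => ⟨n1, fun A hA => ?_, n3.mono rfl ?_⟩
    · rw [m2 A (by simp at hA ⊢; omega)]
      exact l2 A (by simp at hA; omega)
    · rw [n2 A (by simp; omega), m2 A (by simp; omega)]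
      exact l2 A (by omega)
    · rintro ⟨⟨⟨h1, h2⟩, h3⟩, h4⟩
      refine ⟨h1, fun k' hk' s => ?_⟩
      rcases (show k' < k ∨ k' = k by omega) with h5 | rfl
      · exact h2 k' h5 s
      · cases s
        exacts [h4, h3]
  · rintro τ ⟨l1, -, l3⟩
    refine hQ τ (l3.mono rfl fun hX => l1.good.forall_not_bad hX.1 fun s x hx y hy z hz => ?_)
    have h1 := hX.2 (36 * x + 6 * y + z) (by simp; omega) s
    rwa [show (36 * x + 6 * y + z) / 36 = x by omega,
      show (36 * x + 6 * y + z) / 6 % 6 = y by omega, show (36 * x + 6 * y + z) % 6 = z by omega]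
      at h1

end Cmd

end BoxCover

/-! ### Ranking reals with a tournament tree -/

namespace BoxCover

open RealRAM

/-- The order of the items by their keys, ties being broken by the numbers of the items. -/
def KeyLt (X : ℕ → ℝ) (j k : ℕ) : Prop := X j < X k ∨ (X j = X k ∧ j < k)

theorem KeyLt.trans {X : ℕ → ℝ} {i j k : ℕ} (h : KeyLt X i j) (h' : KeyLt X j k) :
    KeyLt X i k := by
  rcases h with h | ⟨h1, h2⟩ <;> rcases h' with h' | ⟨h3, h4⟩
  · exact .inl (h.trans h')
  · exact .inl (h3 ▸ h)
  · exact .inl (h1 ▸ h')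
  · exact .inr ⟨h1.trans h3, h2.trans h4⟩

theorem KeyLt.not_lt {X : ℕ → ℝ} {j k : ℕ} (h : KeyLt X j k) : ¬ KeyLt X k j := by
  rcases h with h | ⟨h1, h2⟩
  · rintro (h' | ⟨h', -⟩)
    exacts [lt_asymm h h', h.ne' h']
  · rintro (h' | ⟨-, h'⟩)
    exacts [h'.ne' h1, lt_asymm h2 h']

theorem keyLt_or {X : ℕ → ℝ} {j k : ℕ} (h : j ≠ k) : KeyLt X j k ∨ KeyLt X k j := by
  unfold KeyLt
  rcases lt_trichotomy (X j) (X k) with h1 | h1 | h1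
  · exact .inl (.inl h1)
  · rcases Nat.lt_or_gt_of_ne h with h2 | h2
    · exact .inl (.inr ⟨h1, h2⟩)
    · exact .inr (.inr ⟨h1.symm, h2⟩)
  · exact .inr (.inl h1)

/-- The winner of a match; `0` stands for no item, and ties are won by the left item. -/
noncomputable def better (X : ℕ → ℝ) (l r : ℕ) : ℕ :=
  open Classical in if l = 0 then r else if 0 < r ∧ X r < X l then r else l

/-- `T` is a tournament tree for the items in `S`: the leaf `2 ^ L + j` belongs to the item `j`, and
every inner node contains the winner of its children. -/
structure Tour (L : ℕ) (X : ℕ → ℝ) (S : Set ℕ) (T : ℕ → ℕ) : Prop where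
  leaf_mem : ∀ j < 2 ^ L, j ∈ S → T (2 ^ L + j) = j
  leaf_notMem : ∀ j < 2 ^ L, j ∉ S → T (2 ^ L + j) = 0
  node : ∀ v, 1 ≤ v → v < 2 ^ L → T v = better X (T (2 * v)) (T (2 * v + 1))

/-- A node contains the first item in `S` among the leaves below it. -/
theorem Tour.first {L : ℕ} {X : ℕ → ℝ} {S : Set ℕ} {T : ℕ → ℕ} (h : Tour L X S T)
    (hS : ∀ j ∈ S, 1 ≤ j) (d e : ℕ) (hd : d + e = L) (v : ℕ) (hv : 2 ^ d ≤ v)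
    (hv' : v < 2 ^ (d + 1)) :
    (T v = 0 → ∀ j < 2 ^ L, (2 ^ L + j) / 2 ^ e = v → j ∉ S) ∧
    (T v ≠ 0 → T v < 2 ^ L ∧ (2 ^ L + T v) / 2 ^ e = v ∧ T v ∈ S ∧
      ∀ j < 2 ^ L, (2 ^ L + j) / 2 ^ e = v → j ∈ S → j ≠ T v → KeyLt X (T v) j) := by
  induction e generalizing d v with
  | zero =>
    obtain rfl : d = L := by omega
    obtain ⟨j, rfl⟩ := Nat.exists_eq_add_of_le hv
    have hj : j < 2 ^ d := by rw [pow_succ] at hv'; omega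
    simp only [pow_zero, Nat.div_one, Nat.add_left_cancel_iff]
    by_cases hjS : j ∈ S
    · rw [h.leaf_mem j hj hjS]
      have := hS j hjS
      exact ⟨by omega, fun _ => ⟨hj, rfl, hjS, fun k _ h1 _ h2 => absurd h1 h2⟩⟩
    · rw [h.leaf_notMem j hj hjS]
      refine ⟨fun _ k _ hk => hk ▸ hjS, fun h => absurd rfl h⟩
  | succ e ih =>
    have e1 : 2 ^ (d + 1 + 1) = 2 * 2 ^ (d + 1) := by ring
    have e2 : 2 ^ (d + 1) = 2 * 2 ^ d := by ring
    obtain ⟨l1, l2⟩ := ih (d + 1) (by omega) (2 * v) (by omega) (by omega)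
    obtain ⟨r1, r2⟩ := ih (d + 1) (by omega) (2 * v + 1) (by omega) (by omega)
    have hvL : v < 2 ^ L := hv'.trans_le (Nat.pow_le_pow_right (by omega) (by omega))
    have hdiv : ∀ j, (2 ^ L + j) / 2 ^ (e + 1) = v ↔
        (2 ^ L + j) / 2 ^ e = 2 * v ∨ (2 ^ L + j) / 2 ^ e = 2 * v + 1 := fun j => by
      rw [pow_succ, ← Nat.div_div_eq_div_mul]
      omega
    have hlt : ∀ j k, (2 ^ L + j) / 2 ^ e = 2 * v → (2 ^ L + k) / 2 ^ e = 2 * v + 1 → j < k := by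
      intro j k h1 h2
      by_contra hn
      have := Nat.div_le_div_right (c := 2 ^ e) (show 2 ^ L + k ≤ 2 ^ L + j by omega)
      omega
    simp only [hdiv, h.node v (Nat.one_le_two_pow.trans hv) hvL, better]
    set l := T (2 * v)
    set r := T (2 * v + 1)
    by_cases hl : l = 0
    · rw [if_pos hl]
      refine ⟨fun hr j hj => ?_, fun hr => ?_⟩
      · rintro (h3 | h3)
        exacts [l1 hl j hj h3, r1 hr j hj h3]
      · obtain ⟨h3, h4, h5, h6⟩ := r2 hr
        refine ⟨h3, .inr h4, h5, fun j hj => ?_⟩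
        rintro (h7 | h7) h8
        · exact absurd h8 (l1 hl j hj h7)
        · exact h6 j hj h7 h8
    · obtain ⟨h3, h4, h5, h6⟩ := l2 hl
      rw [if_neg hl]
      split_ifs with hr
      · obtain ⟨k3, k4, k5, k6⟩ := r2 hr.1.ne'
        refine ⟨fun h => absurd h hr.1.ne', fun _ => ⟨k3, .inr k4, k5, fun j hj => ?_⟩⟩
        rintro (h7 | h7) h8 h9
        · by_cases hjl : j = l
          · exact .inl (hjl ▸ hr.2)
          · exact .trans (.inl hr.2) (h6 j hj h7 h8 hjl)
        · exact k6 j hj h7 h8 h9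
      · refine ⟨fun h => absurd h hl, fun _ => ⟨h3, .inl h4, h5, fun j hj => ?_⟩⟩
        rintro (h7 | h7) h8 h9
        · exact h6 j hj h7 h8 h9
        · have hr0 : r ≠ 0 := fun h => r1 h j hj h7 h8
          obtain ⟨k3, k4, k5, k6⟩ := r2 hr0
          have hlr : KeyLt X l r := by
            rcases (not_lt.1 fun h => hr ⟨by omega, h⟩ : X l ≤ X r).lt_or_eq with h | h
            · exact .inl h
            · exact .inr ⟨h, hlt l r h4 k4⟩
          by_cases hjr : j = r
          · exact hjr ▸ hlr
          · exact hlr.trans (k6 j hj h7 h8 hjr)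

theorem Tour.root {L : ℕ} {X : ℕ → ℝ} {S : Set ℕ} {T : ℕ → ℕ} (h : Tour L X S T)
    (hS : ∀ j ∈ S, 1 ≤ j ∧ j < 2 ^ L) (hne : S.Nonempty) :
    T 1 ∈ S ∧ ∀ j ∈ S, j ≠ T 1 → KeyLt X (T 1) j := by
  obtain ⟨h1, h2⟩ := h.first (fun j hj => (hS j hj).1) 0 L (by omega) 1 (by simp) (by simp)
  have hdiv : ∀ j < 2 ^ L, (2 ^ L + j) / 2 ^ L = 1 := fun j hj => by
    rw [Nat.add_div_left _ (by positivity), Nat.div_eq_of_lt hj]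
  have h0 : T 1 ≠ 0 := fun h0 => by
    obtain ⟨j, hj⟩ := hne
    exact h1 h0 j (hS j hj).2 (hdiv j (hS j hj).2) hj
  obtain ⟨-, -, h3, h4⟩ := h2 h0
  exact ⟨h3, fun j hj => h4 j (hS j hj).2 (hdiv j (hS j hj).2) hj⟩

theorem Tour.empty (L : ℕ) (X : ℕ → ℝ) : Tour L X ∅ fun _ => 0 :=
  ⟨by simp, by simp, by simp [better]⟩

variable {Z : ℕ} {β : Kind → ℕ}

namespace Cmd

/-- Replaces the value of `left` by the winner of `left` and `right`. -/
def play (B : ℕ) : Cmd :=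
  ite (.eq (.var .left) 0) (.left ≔ .var .right)
    (ite (.lt 0 (.var .right))
      (ite (.rlt B (.var .right) (.var .left)) (.left ≔ .var .right) skip) skip)

theorem wp_play {σ : Mem} {Q : Mem → Prop} {B : ℕ} (hZ : 0 < Z)
    (hQ : Q (σ.set .left (better (σ.x B) (σ.v .left) (σ.v .right)))) :
    (play B).wp Z β Q σ := by
  have hself : σ.set .left (σ.v .left) = σ := by simp [Mem.set]
  refine (wp_ite ..).2 ⟨⟨trivial, hZ⟩, fun h1 => ?_, fun h1 => (wp_ite ..).2 ⟨⟨hZ, trivial⟩,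
    fun h2 => (wp_ite ..).2 ⟨⟨trivial, trivial⟩, fun h3 => ?_, fun h3 => ?_⟩, fun h2 => ?_⟩⟩
  · have h1 : σ.v .left = 0 := h1
    rw [better, if_pos h1] at hQ
    exact ⟨trivial, hQ⟩
  all_goals
    have h1 : ¬ σ.v .left = 0 := h1
    rw [better, if_neg h1] at hQ
  · rw [if_pos ⟨h2, h3⟩] at hQ
    exact ⟨trivial, hQ⟩
  · rw [if_neg fun h => h3 h.2, hself] at hQ
    exact hQ
  · rw [if_neg fun h => h2 h.1, hself] at hQ
    exact hQ

/-- Updates the tournament tree in the array `A`, for the keys in the real array `B`, after a change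
of the leaf `node`. -/
def replay (A B : ℕ) : Cmd :=
  loop .level (.lt 1 (.var .node))
    (.node ≔ .var .node / 2 ;; .left ≔ .get A (2 * .var .node) ;;
      .right ≔ .get A (2 * .var .node + 1) ;; play B ;; put A (.var .node) (.var .left))

theorem wp_replay {σ : Mem} {Q : Mem → Prop} {A B L j : ℕ} {S : Set ℕ} (h : Base Z β L σ)
    (hj : j < 2 ^ L) (hnode : σ.v .node = 2 ^ L + j)
    (h1 : ∀ j < 2 ^ L, j ∈ S → σ.a A (2 ^ L + j) = j)
    (h2 : ∀ j < 2 ^ L, j ∉ S → σ.a A (2 ^ L + j) = 0)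
    (h3 : ∀ v, 1 ≤ v → v < 2 ^ L → (∀ i, v ≠ (2 ^ L + j) / 2 ^ (i + 1)) →
      σ.a A v = better (σ.x B) (σ.a A (2 * v)) (σ.a A (2 * v + 1)))
    (hQ : ∀ τ : Mem, (∀ y ∉ [Var.node, .left, .right], τ.v y = σ.v y) →
      (∀ A' ≠ A, τ.a A' = σ.a A') → τ.x = σ.x → Tour L (σ.x B) S (τ.a A) → Q τ) :
    (replay A B).wp Z β Q σ := by
  have hZ := h.le
  have hL := h.level
  have hpos : 0 < 2 ^ L := by positivity
  refine ⟨fun k τ => 1 ≤ τ.v .node ∧ τ.v .node < 2 ^ (k + 1) ∧ τ.v .node < 2 * 2 ^ L ∧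
    (∀ y ∉ [Var.node, .left, .right], τ.v y = σ.v y) ∧ (∀ A' ≠ A, τ.a A' = σ.a A') ∧ τ.x = σ.x ∧
    (∀ j < 2 ^ L, j ∈ S → τ.a A (2 ^ L + j) = j) ∧
    (∀ j < 2 ^ L, j ∉ S → τ.a A (2 ^ L + j) = 0) ∧
    ∀ v, 1 ≤ v → v < 2 ^ L → (∀ i, v ≠ τ.v .node / 2 ^ (i + 1)) →
      τ.a A v = better (σ.x B) (τ.a A (2 * v)) (τ.a A (2 * v + 1)), ?_, ?_⟩
  · refine ⟨by omega, ?_, by omega, fun _ _ => rfl, fun _ _ => rfl, rfl, h1, h2, by rwa [hnode]⟩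
    have h5 : 2 ^ (L + 1) ≤ 2 ^ (β .level + 1) := Nat.pow_le_pow_right (by omega) (by omega)
    rw [pow_succ] at h5
    omega
  · rintro k τ ⟨g1, g2, g2', g3, g4, g5, g6, g7, g8⟩
    refine ⟨⟨by simp; omega, trivial⟩, fun hlt => ?_, fun hlt => ?_⟩
    · have hlt : 1 < τ.v .node := hlt
      cases k with
      | zero => simp at g2; omega
      | succ k =>
        refine ⟨k, rfl, ?_⟩
        set v := τ.v .node / 2 with hv
        have e1 : 2 ^ (k + 1 + 1) = 2 * 2 ^ (k + 1) := by ring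
        refine (wp_seq ..).2 ((wp_asg ..).2 ⟨by simp; omega, ?_⟩)
        rw [Exp.eval_div, Exp.eval_var, Exp.eval_ofNat, ← hv]
        refine (wp_seq ..).2 ((wp_asg ..).2 ⟨by simp; omega, ?_⟩)
        refine (wp_seq ..).2 ((wp_asg ..).2 ⟨by simp; omega, ?_⟩)
        refine (wp_seq ..).2 (wp_play (by omega) ⟨trivial, trivial, ?_⟩)
        simp only [Exp.eval_get, Exp.eval_mul, Exp.eval_add, Exp.eval_ofNat, Exp.eval_var,
          Mem.set_v, Mem.set_a, Mem.set_x, if_true, if_false, reduceCtorEq, g5]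
        have hvL : v < 2 ^ L := by omega
        refine ⟨by simp; omega, by simp; omega, by simp; omega, fun y hy => ?_, fun A' hA' => ?_,
          by simp [g5], fun i hi hiS => ?_, fun i hi hiS => ?_, fun u hu hu' hun => ?_⟩
        · have := g3 y hy
          simp at hy
          simp [hy, this]
        · simp [Mem.put_a_of_ne _ _ _ hA', g4 A' hA']
        · simp [g6 i hi hiS, Function.update_of_ne (show 2 ^ L + i ≠ v by omega)]
        · simp [g7 i hi hiS, Function.update_of_ne (show 2 ^ L + i ≠ v by omega)]
        · have n1 : 2 * u ≠ v := fun h => by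
            have := hun 0
            simp at this
            omega
          have n2 : 2 * u + 1 ≠ v := fun h => by
            have := hun 0
            simp at this
            omega
          simp only [Mem.put_a_self, Mem.set_a, Function.update_of_ne n1, Function.update_of_ne n2]
          by_cases huv : u = v
          · subst huv
            simp
          · rw [Function.update_of_ne huv]
            refine g8 u hu hu' fun i hi => ?_
            cases i with
            | zero => simp at hi; omega
            | succ i =>
              refine hun i ?_
              rw [hi]
              simp [hv, Nat.div_div_eq_div_mul, pow_succ']
    · have hle : ¬ 1 < τ.v .node := hlt
      refine hQ τ g3 g4 g5 ⟨g6, g7, fun v hv hv' => g8 v hv hv' fun i hi => ?_⟩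
      have h6 : 1 < 2 ^ (i + 1) := Nat.one_lt_two_pow (by omega)
      rw [Nat.div_eq_of_lt (by omega)] at hi
      omega

/-- Sets the leaf of the item `j` to `f`. -/
def setLeaf (A B : ℕ) (j f : Exp) : Cmd :=
  .node ≔ .var .m + j ;; put A (.var .node) f ;; replay A B

theorem wp_setLeaf {σ : Mem} {Q : Mem → Prop} {A B L k : ℕ} {S S' : Set ℕ} {y : Var} {f : Exp}
    (h : Base Z β L σ) (hT : Tour L (σ.x B) S (σ.a A)) (hk : k < 2 ^ L) (hy : σ.v y = k)
    (hf : ∀ τ : Mem, (∀ y ≠ Var.node, τ.v y = σ.v y) → f.Ok Z τ ∧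
      (k ∈ S' → f.eval τ = k) ∧ (k ∉ S' → f.eval τ = 0))
    (hS : ∀ j, j ≠ k → (j ∈ S' ↔ j ∈ S))
    (hQ : ∀ τ : Mem, (∀ y ∉ [Var.node, .left, .right], τ.v y = σ.v y) →
      (∀ A' ≠ A, τ.a A' = σ.a A') → τ.x = σ.x → Tour L (σ.x B) S' (τ.a A) → Q τ) :
    (setLeaf A B (.var y) f).wp Z β Q σ := by
  have hZ := h.le
  obtain ⟨f1, f2, f3⟩ := hf (σ.set .node (2 ^ L + k)) fun y hy => by simp [hy]
  refine (wp_seq ..).2 ((wp_asg ..).2 ⟨by simp [h.m_eq, hy]; omega, ?_⟩)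
  rw [Exp.eval_add, Exp.eval_var, Exp.eval_var, h.m_eq, hy]
  refine (wp_seq ..).2 ⟨trivial, f1, ?_⟩
  have hv : (Exp.var Var.node).eval (σ.set .node (2 ^ L + k)) = 2 ^ L + k := by simp
  rw [hv]
  set w := f.eval (σ.set .node (2 ^ L + k))
  have hB : Base Z β L ((σ.set .node (2 ^ L + k)).put A (2 ^ L + k) w) :=
    ⟨h.level, h.one_le, by simp [h.m_eq], by simp [h.b_eq], h.pow_le⟩
  refine wp_replay (S := S') hB hk (by simp) (fun j hj hjS => ?_) (fun j hj hjS => ?_)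
    (fun v hv1 hv2 hv3 => ?_) fun τ g1 g2 g3 g4 => hQ τ (fun y hy => ?_) (fun A' hA' => ?_) g3 g4
  · by_cases hjk : j = k
    · subst hjk
      simpa using f2 hjS
    · simpa [hjk] using hT.leaf_mem j hj ((hS j hjk).1 hjS)
  · by_cases hjk : j = k
    · subst hjk
      simpa using f3 hjS
    · simpa [hjk] using hT.leaf_notMem j hj (mt (hS j hjk).2 hjS)
  · have h0 := hv3 0
    simp only [zero_add, pow_one] at h0
    simp only [Mem.put_a_self, Mem.set_a, Mem.put_x, Mem.set_x]
    rw [Function.update_of_ne (by omega), Function.update_of_ne (by omega),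
      Function.update_of_ne (by omega)]
    exact hT.node v hv1 hv2
  · rw [g1 y hy]
    simp at hy
    simp [hy]
  · rw [g2 A' hA', Mem.put_a_of_ne _ _ _ hA', Mem.set_a]

end Cmd

/-- `pos` ranks the items `1, …, n` by their keys, and `inv` is its inverse. -/
structure Ranked (n : ℕ) (X : ℕ → ℝ) (pos inv : ℕ → ℕ) : Prop where
  pos_lt : ∀ j, 1 ≤ j → j ≤ n → pos j < n
  inv_pos : ∀ j, 1 ≤ j → j ≤ n → inv (pos j) = j
  lt : ∀ j k, 1 ≤ j → j ≤ n → 1 ≤ k → k ≤ n → KeyLt X j k → pos j < pos k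

theorem Ranked.lt_iff {n : ℕ} {X : ℕ → ℝ} {pos inv : ℕ → ℕ} (h : Ranked n X pos inv) {j k : ℕ}
    (hj : 1 ≤ j) (hjn : j ≤ n) (hk : 1 ≤ k) (hkn : k ≤ n) : pos j < pos k ↔ KeyLt X j k := by
  refine ⟨fun hlt => ?_, h.lt j k hj hjn hk hkn⟩
  rcases eq_or_ne j k with rfl | hne
  · exact absurd hlt (lt_irrefl _)
  · exact (keyLt_or hne).resolve_right fun h' => absurd (h.lt k j hk hkn hj hjn h') (by omega)

namespace Cmd

/-- Ranks the items by the keys in the real array `3 + i`, by inserting them into a tournament tree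
and extracting them in the order of their keys. -/
def rank (i : ℕ) : Cmd :=
  forLoop .item .q 1 .re (setLeaf (20 + i) (3 + i) (.var .q) (.var .q)) ;;
  forLoop .item .u 0 .n (.v ≔ .get (20 + i) 1 ;; put i (.var .v) (.var .u) ;;
    put (10 + i) (.var .u) (.var .v) ;; setLeaf (20 + i) (3 + i) (.var .v) 0)

theorem wp_rank {σ : Mem} {Q : Mem → Prop} {L n i : ℕ} (h : Base Z β L σ)
    (hn : σ.v .n = n) (hre : σ.v .re = n + 1) (hnL : n + 2 ≤ 2 ^ L) (hβ : n ≤ β .item)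
    (hT : σ.a (20 + i) = fun _ => 0)
    (hQ : ∀ τ : Mem, (∀ y ∉ [Var.node, .left, .right, .q, .u, .v], τ.v y = σ.v y) →
      (∀ A' ∉ [i, 10 + i, 20 + i], τ.a A' = σ.a A') → τ.x = σ.x →
      Ranked n (σ.x (3 + i)) (τ.a i) (τ.a (10 + i)) → Q τ) :
    (rank i).wp Z β Q σ := by
  have hZ := h.le
  have base : ∀ τ : Mem, (∀ y ∉ [Var.node, .left, .right, .q, .u, .v], τ.v y = σ.v y) →
      Base Z β L τ := fun τ hτ => ⟨h.level, h.one_le, by rw [hτ _ (by simp), h.m_eq],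
        by rw [hτ _ (by simp), h.b_eq], h.pow_le⟩
  set X := σ.x (3 + i)
  refine (wp_seq ..).2 (wp_forLoop (l := 1) (h := n + 1) (fun k τ =>
    (∀ y ∉ [Var.node, .left, .right, .q, .u, .v], τ.v y = σ.v y) ∧
    (∀ A' ≠ 20 + i, τ.a A' = σ.a A') ∧ τ.x = σ.x ∧
    Tour L X {j | 1 ≤ j ∧ j < k} (τ.a (20 + i))) (by simp; omega) (by simp) (by simpa using hre)
    (by omega) (by omega) (by omega) ?_ ?_ ?_)
  · refine ⟨fun y hy => ?_, fun _ _ => rfl, rfl, ?_⟩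
    · simp at hy
      simp [hy]
    · have : {j : ℕ | 1 ≤ j ∧ j < 1} = ∅ := by
        ext
        simp
        omega
      rw [this, Mem.set_a, hT]
      exact Tour.empty _ _
  · rintro k τ hk1 hk2 hτq hτre ⟨g1, g2, g3, g4⟩
    refine wp_setLeaf (k := k) (S' := {j | 1 ≤ j ∧ j < k + 1}) (base τ g1) (by rw [g3]; exact g4)
      (by omega) hτq (fun υ hυ => ⟨trivial, fun _ => ?_, fun hk => ?_⟩)
      (fun j hj => ?_) fun υ k1 k2 k3 k4 => ?_
    · simp [hυ, hτq]
    · exact absurd ⟨hk1, by omega⟩ hk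
    · simp only [Set.mem_ofPred_eq]
      omega
    · refine ⟨by rw [k1 _ (by simp), hτq], by rw [k1 _ (by simp), hτre],
        by simp [k1, hτre], fun y hy => ?_, fun A' hA' => ?_, by simp [k3, g3], ?_⟩
      · rw [← g1 y hy]
        simp at hy
        simp [hy, k1]
      · rw [Mem.set_a, k2 A' hA', g2 A' hA']
      · rw [g3] at k4
        exact k4
  · rintro σ' - - ⟨f1, f2, f3, f4⟩
    refine wp_forLoop (l := 0) (h := n) (fun u τ =>
      (∀ y ∉ [Var.node, .left, .right, .q, .u, .v], τ.v y = σ.v y) ∧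
      (∀ A' ∉ [i, 10 + i, 20 + i], τ.a A' = σ.a A') ∧ τ.x = σ.x ∧
      ∃ S : Finset ℕ, S ⊆ Finset.Icc 1 n ∧ S.card + u = n ∧ Tour L X S (τ.a (20 + i)) ∧
        (∀ j ∈ Finset.Icc 1 n \ S, τ.a i j < u ∧ τ.a (10 + i) (τ.a i j) = j) ∧
        (∀ j ∈ Finset.Icc 1 n \ S, ∀ k ∈ S, KeyLt X j k) ∧
        ∀ j ∈ Finset.Icc 1 n \ S, ∀ k ∈ Finset.Icc 1 n \ S, KeyLt X j k → τ.a i j < τ.a i k)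
      (by simp; omega) (by simp) (by simp [f1, hn]) (by omega) (by omega) (by omega) ?_ ?_ ?_
    · refine ⟨fun y hy => ?_, fun A' hA' => ?_, f3, Finset.Icc 1 n, subset_rfl, by simp, ?_,
        by simp, by simp, by simp⟩
      · rw [← f1 y hy]
        simp at hy
        simp [hy]
      · simp at hA'
        simp [f2 A' hA'.2.2]
      · have : (Finset.Icc 1 n : Set ℕ) = {j | 1 ≤ j ∧ j < n + 1} := by
          ext
          simp
        rw [this]
        exact f4
    · rintro u τ - hu hτu hτn ⟨g1, g2, g3, S, s1, s2, s3, s4, s5, s6⟩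
      have hne : S.Nonempty := Finset.card_pos.1 (by omega)
      have hSr : ∀ j ∈ S, 1 ≤ j ∧ j ≤ n := fun j hj => Finset.mem_Icc.1 (s1 hj)
      obtain ⟨r1, r2⟩ := s3.root (fun j hj => ⟨(hSr j hj).1, by have := hSr j hj; omega⟩) hne
      set v := τ.a (20 + i) 1 with hv
      have hvS : v ∈ S := r1
      have hvn := hSr v hvS
      refine (wp_seq ..).2 ((wp_asg ..).2 ⟨by simp; omega, ?_⟩)
      have e1 : (Exp.get (20 + i) 1).eval τ = v := by simp [hv]
      rw [e1]
      refine (wp_seq ..).2 ⟨trivial, trivial, ?_⟩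
      have e2 : (Exp.var Var.v).eval (τ.set .v v) = v := by simp
      have e3 : (Exp.var Var.u).eval (τ.set .v v) = u := by simp [hτu]
      rw [e2, e3]
      refine (wp_seq ..).2 ⟨trivial, trivial, ?_⟩
      have e4 : (Exp.var Var.v).eval ((τ.set .v v).put i v u) = v := by simp
      have e5 : (Exp.var Var.u).eval ((τ.set .v v).put i v u) = u := by simp [hτu]
      rw [e4, e5]
      set υ := ((τ.set .v v).put i v u).put (10 + i) u v with hυ
      have p1 : ∀ y ∉ [Var.node, .left, .right, .q, .u, .v], υ.v y = σ.v y := fun y hy => by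
        rw [← g1 y hy]
        simp at hy
        simp [hυ, hy]
      have p2 : υ.a i = Function.update (τ.a i) v u := by
        rw [hυ, Mem.put_a_of_ne _ _ _ (by omega), Mem.put_a_self, Mem.set_a]
      have p3 : υ.a (10 + i) = Function.update (τ.a (10 + i)) u v := by
        rw [hυ, Mem.put_a_self, Mem.put_a_of_ne _ _ _ (by omega), Mem.set_a]
      have p4 : ∀ A', A' ≠ i → A' ≠ 10 + i → υ.a A' = τ.a A' := fun A' h1 h2 => by
        rw [hυ, Mem.put_a_of_ne _ _ _ h2, Mem.put_a_of_ne _ _ _ h1, Mem.set_a]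
      refine wp_setLeaf (k := v) (S := S) (S' := (S.erase v : Finset ℕ)) (base υ p1) ?_ (by omega)
        (by simp [hυ]) (fun ξ hξ => ⟨by simp; omega, fun hk => ?_, fun _ => rfl⟩)
        (fun j hj => by simp [hj]) fun ξ k1 k2 k3 k4 => ?_
      · rw [p4 _ (by omega) (by omega)]
        show Tour L (τ.x (3 + i)) _ _
        rw [g3]
        exact s3
      · simp at hk
      have x1 : ξ.a i = Function.update (τ.a i) v u := by rw [k2 _ (by omega), p2]
      have x2 : ξ.a (10 + i) = Function.update (τ.a (10 + i)) u v := by rw [k2 _ (by omega), p3]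
      have hsd : ∀ j, j ∈ Finset.Icc 1 n \ S.erase v ↔
          j = v ∨ (j ≠ v ∧ j ∈ Finset.Icc 1 n \ S) := by
        intro j
        by_cases hjv : j = v
        · simp [hjv]
          omega
        · simp [hjv]
      refine ⟨by rw [k1 _ (by simp)]; simp [hυ, hτu], by rw [k1 _ (by simp)]; simp [hυ, hτn],
        by simp [k1, hυ, hτn], fun y hy => ?_, fun A' hA' => ?_,
        by simp [k3, hυ, g3], S.erase v, (Finset.erase_subset _ _).trans s1, ?_, ?_, ?_, ?_, ?_⟩
      · rw [← p1 y hy]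
        simp at hy
        simp [hy, k1]
      · rw [← g2 A' hA']
        simp at hA'
        rw [Mem.set_a, k2 A' hA'.2.2, p4 A' hA'.1 hA'.2.1]
      · rw [Finset.card_erase_of_mem hvS]
        omega
      · rw [show υ.x = σ.x from g3] at k4
        exact k4
      · intro j hj
        rw [Mem.set_a, x1, x2]
        rcases (hsd j).1 hj with rfl | ⟨hjv, hj⟩
        · simp
        · obtain ⟨h1, h2⟩ := s4 j hj
          rw [Function.update_of_ne hjv, Function.update_of_ne (by omega)]
          exact ⟨by omega, h2⟩
      · intro j hj k hk
        rw [Finset.mem_erase] at hk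
        rcases (hsd j).1 hj with rfl | ⟨hjv, hj⟩
        · exact r2 k hk.2 hk.1
        · exact s5 j hj k hk.2
      · intro j hj k hk hjk
        rw [Mem.set_a, x1]
        rcases (hsd j).1 hj with rfl | ⟨hjv, hj⟩ <;> rcases (hsd k).1 hk with rfl | ⟨hkv, hk⟩
        · exact absurd hjk hjk.not_lt
        · exact absurd hjk (s5 k hk _ hvS).not_lt
        · rw [Function.update_of_ne hjv, Function.update_self]
          exact (s4 j hj).1
        · rw [Function.update_of_ne hjv, Function.update_of_ne hkv]
          exact s6 j hj k hk hjk
    · rintro τ - - ⟨g1, g2, g3, S, s1, s2, s3, s4, s5, s6⟩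
      obtain rfl : S = ∅ := Finset.card_eq_zero.1 (by omega)
      simp only [Finset.sdiff_empty, Finset.mem_Icc] at s4 s6
      exact hQ τ g1 g2 g3 ⟨fun j h1 h2 => (s4 j ⟨h1, h2⟩).1, fun j h1 h2 => (s4 j ⟨h1, h2⟩).2,
        fun j k h1 h2 h3 h4 => s6 j ⟨h1, h2⟩ k ⟨h3, h4⟩⟩

end Cmd

end BoxCover

/-! ### Preparing a ranked instance -/

namespace BoxCover

open RealRAM

theorem exists_root (n : ℕ) : ∃ r, 1 ≤ r ∧ n ≤ r ^ 6 :=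
  ⟨n + 1, by omega, (Nat.le_succ n).trans (Nat.le_self_pow (by omega) _)⟩

/-- The sixth root of `n`, rounded up, but at least `1`. -/
def root6 (n : ℕ) : ℕ := Nat.find (exists_root n)

theorem one_le_root6 (n : ℕ) : 1 ≤ root6 n := (Nat.find_spec (exists_root n)).1

theorem le_root6_pow (n : ℕ) : n ≤ root6 n ^ 6 := (Nat.find_spec (exists_root n)).2

theorem root6_le {n r : ℕ} (hr : 1 ≤ r) (h : n ≤ r ^ 6) : root6 n ≤ r :=
  Nat.find_min' (exists_root n) ⟨hr, h⟩

theorem root6_le_succ (n : ℕ) : root6 n ≤ n + 1 :=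
  root6_le (by omega) ((Nat.le_succ n).trans (Nat.le_self_pow (by omega) _))

/-- The bounds for the numbers of iterations, for instances with `n` boxes. -/
def bounds (n : ℕ) : Kind → ℕ
  | .level => Nat.clog 2 (n + 2)
  | .item => 2 * n
  | .slab => n / root6 n + 1
  | .block => root6 n ^ 5
  | .root => root6 n

variable {Z L np nq nr : ℕ}

/-- The variables that describe the instance have been computed, for `np`, `nq` and `nr` boxes
`p`, `q` and `r`. -/
structure Sized (Z L np nq nr : ℕ) (σ : Mem) : Prop where
  base : Cmd.Base Z (bounds (np + nq + nr)) L σ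
  lt_pow : np + nq + nr + 2 ≤ 2 ^ L
  np_eq : σ.v .np = np
  nq_eq : σ.v .nq = nq
  nr_eq : σ.v .nr = nr
  n_eq : σ.v .n = np + nq + nr
  t_eq : σ.v .t = root6 (np + nq + nr)
  w_eq : σ.v .w = (np + nq + nr) / root6 (np + nq + nr) + 1
  qe_eq : σ.v .qe = nq + 1
  pe_eq : σ.v .pe = nq + 1 + np
  re_eq : σ.v .re = np + nq + nr + 1

theorem Sized.congr {σ τ : Mem} (h : Sized Z L np nq nr σ)
    (hv : ∀ y : Var, y.Global ∨ y ∈ [Var.np, .nq, .nr] → τ.v y = σ.v y) :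
    Sized Z L np nq nr τ where
  base := ⟨h.base.level, h.base.one_le, (hv .m (.inl trivial)).trans h.base.m_eq,
    (hv .b (.inl trivial)).trans h.base.b_eq, h.base.pow_le⟩
  lt_pow := h.lt_pow
  np_eq := (hv _ (by simp)).trans h.np_eq
  nq_eq := (hv _ (by simp)).trans h.nq_eq
  nr_eq := (hv _ (by simp)).trans h.nr_eq
  n_eq := (hv .n (.inl trivial)).trans h.n_eq
  t_eq := (hv .t (.inl trivial)).trans h.t_eq
  w_eq := (hv .w (.inl trivial)).trans h.w_eq
  qe_eq := (hv .qe (.inl trivial)).trans h.qe_eq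
  pe_eq := (hv .pe (.inl trivial)).trans h.pe_eq
  re_eq := (hv .re (.inl trivial)).trans h.re_eq

theorem Sized.lt {σ : Mem} (h : Sized Z L np nq nr σ) : 10 * (np + nq + nr) + 20 < Z := by
  have h1 := h.base.le
  have h2 := h.lt_pow
  omega

namespace Cmd

/-- Computes the variables that describe the instance. -/
def sizes : Cmd :=
  .n ≔ .var .np + .var .nq + .var .nr ;; .qe ≔ .var .nq + 1 ;; .pe ≔ .var .qe + .var .np ;;
  .re ≔ .var .n + 1 ;;
  .m ≔ 2 ;; loop .level (.lt (.var .m) (.var .n + 2)) (.m ≔ .var .m + .var .m) ;;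
  .b ≔ .var .m + .var .m ;;
  .t ≔ 1 ;; loop .root
    (.lt (.var .t * .var .t * .var .t * .var .t * .var .t * .var .t) (.var .n))
    (.t ≔ .var .t + 1) ;;
  .w ≔ .var .n / .var .t + 1

theorem wp_sizes {σ : Mem} {Q : Mem → Prop} (hp : σ.v .np = np) (hq : σ.v .nq = nq)
    (hr : σ.v .nr = nr) (hZ : (4 * (np + nq + nr + 2)) ^ 12 ≤ Z)
    (hQ : ∀ τ : Mem, τ.a = σ.a → τ.x = σ.x → (∃ L, Sized Z L np nq nr τ) → Q τ) :
    sizes.wp Z (bounds (np + nq + nr)) Q σ := by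
  set n := np + nq + nr with hn
  have hZ1 : 4 * (n + 2) * (n + 2) ≤ Z := by
    refine le_trans ?_ hZ
    calc 4 * (n + 2) * (n + 2) ≤ (4 * (n + 2)) * (4 * (n + 2)) := Nat.mul_le_mul_left _ (by omega)
      _ = (4 * (n + 2)) ^ 2 := by ring
      _ ≤ _ := Nat.pow_le_pow_right (by omega) (by omega)
  have hZ2 : 8 * (n + 2) ≤ Z := by
    refine le_trans ?_ hZ1
    calc 8 * (n + 2) = 4 * (n + 2) * 2 := by ring
      _ ≤ _ := Nat.mul_le_mul_left _ (by omega)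
  refine (wp_seq ..).2 ((wp_asg ..).2 ⟨by simp [hp, hq, hr]; omega, ?_⟩)
  refine (wp_seq ..).2 ((wp_asg ..).2 ⟨by simp [hq]; omega, ?_⟩)
  refine (wp_seq ..).2 ((wp_asg ..).2 ⟨by simp [hp, hq]; omega, ?_⟩)
  refine (wp_seq ..).2 ((wp_asg ..).2 ⟨by simp [hp, hq, hr]; omega, ?_⟩)
  refine (wp_seq ..).2 ((wp_asg ..).2 ⟨by simp; omega, ?_⟩)
  simp only [Exp.eval_add, Exp.eval_var, Exp.eval_ofNat, Mem.set_v, reduceCtorEq, if_true, if_false,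
    hp, hq, hr, ← hn]
  set σ₁ := ((((σ.set .n n).set .qe (nq + 1)).set .pe (nq + 1 + np)).set .re (n + 1)) with hσ₁
  have hL : 1 ≤ Nat.clog 2 (n + 2) := Nat.clog_pos (by omega) (by omega)
  have hclog : 2 ^ Nat.clog 2 (n + 2) ≤ 2 * (n + 2) := by
    have h1 := Nat.pow_pred_clog_lt_self (b := 2) (by omega) (x := n + 2) (by omega)
    have h2 : 2 ^ Nat.clog 2 (n + 2) = 2 * 2 ^ (Nat.clog 2 (n + 2)).pred := by
      rw [← pow_succ', Nat.pred_eq_sub_one, Nat.sub_add_cancel hL]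
    omega
  refine (wp_seq ..).2 ⟨fun k τ => ∃ L, τ = σ₁.set .m (2 ^ L) ∧ 1 ≤ L ∧ L ≤ Nat.clog 2 (n + 2) ∧
    Nat.clog 2 (n + 2) ≤ L + k, ⟨1, rfl, le_rfl, hL, by simp [bounds]⟩, ?_⟩
  rintro k τ ⟨L, rfl, hL1, hL2, hL3⟩
  have hLle := (Nat.pow_le_pow_right (n := 2) (by omega) hL2).trans hclog
  have hvn : σ₁.v .n = n := by simp [hσ₁]
  refine ⟨⟨trivial, by simp [hvn]; omega⟩, fun hlt => ?_, fun hge => ?_⟩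
  · have hlt : 2 ^ L < n + 2 := by simpa [hvn] using hlt
    have h1 : L < Nat.clog 2 (n + 2) := (Nat.lt_clog_iff_pow_lt (by omega)).2 hlt
    refine ⟨k - 1, by omega, ⟨by simp; omega, L + 1, ?_, by omega, by omega, by omega⟩⟩
    simp [Mem.set, pow_succ, mul_two]
  have hge : n + 2 ≤ 2 ^ L := by simpa [hvn] using hge
  refine (wp_seq ..).2 ((wp_asg ..).2 ⟨by simp; omega, ?_⟩)
  refine (wp_seq ..).2 ((wp_asg ..).2 ⟨by simp; omega, ?_⟩)
  have e1 : (Exp.var Var.m + .var .m).eval (σ₁.set .m (2 ^ L)) = 2 * 2 ^ L := by simp; omega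
  rw [e1, Exp.eval_ofNat]
  set σ₂ := (σ₁.set .m (2 ^ L)).set .b (2 * 2 ^ L) with hσ₂
  have hpow : (2 * 2 ^ L) ^ 12 ≤ Z := (Nat.pow_le_pow_left (by omega) 12).trans hZ
  have hroot := root6_le_succ n
  refine (wp_seq ..).2 ⟨fun k τ => ∃ t, τ = σ₂.set .t t ∧ 1 ≤ t ∧ t ≤ root6 n ∧ root6 n ≤ t + k,
    ⟨1, rfl, le_rfl, one_le_root6 n, by simp [bounds]⟩, ?_⟩
  rintro k τ ⟨t, rfl, ht1, ht2, ht3⟩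
  have hvn : σ₂.v .n = n := by simp [hσ₂, hσ₁]
  have ht : ∀ i ≤ 6, t ^ i < Z := fun i hi => by
    have h1 : t ^ i ≤ (n + 1) ^ i := Nat.pow_le_pow_left (by omega) i
    have h2 : (n + 1) ^ i ≤ (n + 1) ^ 12 := Nat.pow_le_pow_right (by omega) (by omega)
    have h3 : (n + 1) ^ 12 < (4 * (n + 2)) ^ 12 := Nat.pow_lt_pow_left (by omega) (by omega)
    omega
  have ev : (Exp.var Var.t * .var .t * .var .t * .var .t * .var .t * .var .t).eval (σ₂.set .t t) =
      t ^ 6 := by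
    simp
    ring
  refine ⟨⟨?_, trivial⟩, fun hlt => ?_, fun hge' => ?_⟩
  · simp only [Exp.ok_mul, Exp.ok_var, Exp.eval_mul, Exp.eval_var, Mem.set_v, if_true, true_and]
    have h2 := ht 2 (by omega)
    have h3 := ht 3 (by omega)
    have h4 := ht 4 (by omega)
    have h5 := ht 5 (by omega)
    have h6 := ht 6 (by omega)
    simp only [pow_succ, pow_zero, one_mul] at h2 h3 h4 h5 h6
    exact ⟨⟨⟨⟨h2, h3⟩, h4⟩, h5⟩, h6⟩
  · have hlt : t ^ 6 < n := by
      rw [Cond.holds_lt, ev] at hlt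
      simpa [hvn] using hlt
    have h1 : t < root6 n := by
      by_contra hn
      have := (le_root6_pow n).trans (Nat.pow_le_pow_left (not_lt.1 hn) 6)
      omega
    refine ⟨k - 1, by omega, ⟨by simp; omega, t + 1, ?_, by omega, by omega, by omega⟩⟩
    simp [Mem.set]
  · have hge' : n ≤ t ^ 6 := by
      rw [Cond.holds_lt, ev] at hge'
      simpa [hvn] using hge'
    obtain rfl : t = root6 n := le_antisymm ht2 (root6_le ht1 hge')
    have hdiv := Nat.div_le_self n (root6 n)
    refine (wp_asg ..).2 ⟨by simp [hvn]; omega, hQ _ rfl rfl ⟨L, ⟨hL2, hL1, ?_, ?_, hpow⟩, hge,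
      ?_, ?_, ?_, ?_, ?_, ?_, ?_, ?_, ?_⟩⟩ <;> simp [hσ₂, hσ₁, hp, hq, hr, ← hn]

end Cmd

/-- The key in direction `d` of the box number `u` whose coordinates are stored in `B`, with `s = 0`
for a box `q` and `s = 1` for a box `p` or `r`.  For `d = 2 * a`, it is the lower end of the `a`-th
interval of a box `q` and the upper end for the others; for `d = 2 * a + 1`, the interval is
reflected first. -/
noncomputable def keyOf (s : ℕ) (B : ℕ → ℝ) (u d : ℕ) : ℝ :=
  if d % 2 = 0 then B (6 * u + (d + s)) else -B (6 * u + (d - s))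

/-- The box number `q` in the array `1` and the box number `u` in the array `B` satisfy the six
inequalities between the ends of their intervals that characterize intersecting boxes. -/
def Meets (σ : Mem) (B q u : ℕ) : Prop := ∀ d < 6, keyOf 0 (σ.x 1) q d ≤ keyOf 1 (σ.x B) u d

variable {β : Kind → ℕ}

namespace Cmd

/-- Computes the keys of the boxes in the real array `B`; their items start from `off`. -/
def fillKeys (s B : ℕ) (count : Var) (off : Exp) : Cmd :=
  forLoop .item .u 0 count (each (List.range 6) fun d =>
    if d % 2 = 0 then rcopy (3 + d) (off + .var .u) B (6 * .var .u + .lit (d + s))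
    else rneg (3 + d) (off + .var .u) B (6 * .var .u + .lit (d - s)))

theorem wp_fillKeys {σ : Mem} {Q : Mem → Prop} {s B l o : ℕ} {count : Var} {off : Exp}
    (hs : s ≤ 1) (hB : B < 3) (hl : σ.v count = l) (hcu : count ≠ .u)
    (ho : ∀ τ : Mem, (∀ y ≠ Var.u, τ.v y = σ.v y) → off.Ok Z τ ∧ off.eval τ = o)
    (hZ : o + 6 * l + 12 < Z) (hβ : l ≤ β .item)
    (hQ : ∀ τ : Mem, (∀ y ≠ Var.u, τ.v y = σ.v y) → τ.a = σ.a → (∀ A < 3, τ.x A = σ.x A) →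
      (∀ d < 6, ∀ u < l, τ.x (3 + d) (o + u) = keyOf s (σ.x B) u d) →
      (∀ d < 6, ∀ j, j < o ∨ o + l ≤ j → τ.x (3 + d) j = σ.x (3 + d) j) → Q τ) :
    (fillKeys s B count off).wp Z β Q σ := by
  refine wp_forLoop (l := 0) (h := l) (fun k τ => (∀ y ≠ Var.u, τ.v y = σ.v y) ∧ τ.a = σ.a ∧
      (∀ A < 3, τ.x A = σ.x A) ∧
      (∀ d < 6, ∀ u < k, τ.x (3 + d) (o + u) = keyOf s (σ.x B) u d) ∧
      (∀ d < 6, ∀ j, j < o ∨ o + l ≤ j → τ.x (3 + d) j = σ.x (3 + d) j))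
    (by simp; omega) (by simp) (by simpa [hcu] using hl) (by omega) (by omega) (by omega) ?_ ?_ ?_
  · exact ⟨fun y hy => by simp [hy], rfl, fun _ _ => rfl, by simp, fun _ _ _ _ => rfl⟩
  · rintro u τ - hu hτu hτc ⟨g1, g2, g3, g4, g5⟩
    refine wp_each (fun l' υ => (∀ y, υ.v y = τ.v y) ∧ υ.a = τ.a ∧
      (∀ A < 3, υ.x A = τ.x A) ∧ (∀ d ∈ l', υ.x (3 + d) (o + u) = keyOf s (σ.x B) u d) ∧
      (∀ d < 6, ∀ j ≠ o + u, υ.x (3 + d) j = τ.x (3 + d) j))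
      ⟨fun _ => rfl, rfl, fun _ _ => rfl, by simp, fun _ _ _ _ => rfl⟩ ?_ ?_
    · rintro l₁ d l₂ υ hl' ⟨k1, k2, k3, k4, k5⟩
      have hd : d < 6 := by
        rw [← List.mem_range, hl']
        simp
      obtain ⟨o1, o2⟩ := ho υ fun y hy => by rw [k1, g1 y hy]
      have hυu : υ.v .u = u := by rw [k1, hτu]
      have e1 : (off + .var .u).eval υ = o + u := by simp [o2, hυu]
      have ok1 : (off + .var .u).Ok Z υ := by
        simp [o1, o2, hυu]
        omega
      have e2 : ∀ j, (6 * .var .u + .lit j : Exp).eval υ = 6 * u + j := fun j => by simp [hυu]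
      have ok2 : ∀ j < 7, (6 * .var .u + .lit j : Exp).Ok Z υ := fun j hj => by
        simp [hυu]
        omega
      have key : ∀ x : ℝ, x = keyOf s (σ.x B) u d →
          (∀ y, (υ.rput (3 + d) (o + u) x).v y = τ.v y) ∧
          (υ.rput (3 + d) (o + u) x).a = τ.a ∧
          (∀ A < 3, (υ.rput (3 + d) (o + u) x).x A = τ.x A) ∧
          (∀ d' ∈ l₁ ++ [d], (υ.rput (3 + d) (o + u) x).x (3 + d') (o + u) =
            keyOf s (σ.x B) u d') ∧
          (∀ d' < 6, ∀ j ≠ o + u, (υ.rput (3 + d) (o + u) x).x (3 + d') j = τ.x (3 + d') j) := by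
        rintro x rfl
        refine ⟨k1, k2, fun A hA => ?_, fun d' hd' => ?_, fun d' hd' j hj => ?_⟩
        · rw [Mem.rput_x_of_ne _ _ _ (by omega), k3 A hA]
        · by_cases hdd : d' = d
          · simp [hdd]
          · simp only [List.mem_append, List.mem_singleton, hdd, or_false] at hd'
            rw [Mem.rput_x_of_ne _ _ _ (by omega), k4 d' hd']
        · rw [← k5 d' hd' j hj, Mem.rput_x]
          split_ifs with hdd
          · rw [Function.update_of_ne hj, hdd]
          · rfl
      have hx : υ.x B = σ.x B := by rw [k3 B hB, g3 B hB]
      split_ifs with hpar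
      · refine ⟨ok1, ok2 _ (by omega), ?_⟩
        rw [e1, e2]
        exact key _ (by rw [keyOf, if_pos hpar, hx])
      · refine ⟨ok1, ok2 _ (by omega), ?_⟩
        rw [e1, e2]
        exact key _ (by rw [keyOf, if_neg hpar, hx])
    · rintro υ ⟨k1, k2, k3, k4, k5⟩
      refine ⟨by rw [k1, hτu], by rw [k1, hτc], by simp [hcu, k1, hτc], fun y hy => ?_,
        k2.trans g2, fun A hA => (k3 A hA).trans (g3 A hA), fun d hd i hi => ?_,
        fun d hd j hj => ?_⟩
      · simp [hy, k1, g1 y hy]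
      · rcases (show i < u ∨ i = u by omega) with h | rfl
        · rw [Mem.set_x, k5 d hd _ (by omega), g4 d hd i h]
        · exact k4 d (by simpa using hd)
      · rw [Mem.set_x, k5 d hd j (by omega), g5 d hd j hj]
  · rintro τ - - ⟨g1, g2, g3, g4, g5⟩
    exact hQ τ g1 g2 g3 g4 g5

/-- Puts all boxes `q` into the table in the array `30`. -/
def fillTable : Cmd :=
  forLoop .item .q 1 .qe (store 30 6 (fun j => .get j (.var .q)) 0 1)

theorem wp_fillTable {σ : Mem} {Q : Mem → Prop} {I : Params} (hB : Base Z β I.L σ)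
    (hlt : I.n + 2 ≤ 2 ^ I.L) (hqe : σ.v .qe = I.qe) (h1 : 1 ≤ I.qe) (hn : I.qe ≤ I.n + 1)
    (hβ : I.n ≤ β .item) (hpos : ∀ i < 6, ∀ j, 1 ≤ j → j ≤ I.n → σ.a i j = I.pos i j)
    (hpos' : ∀ i < 6, ∀ j, 1 ≤ j → j ≤ I.n → I.pos i j < I.n) (h30 : σ.a 30 = fun _ => 0)
    (hQ : ∀ τ : Mem, (∀ y : Var, ¬ y.Scratch → y ≠ .q → τ.v y = σ.v y) →
      (∀ A ≠ 30, τ.a A = σ.a A) → Rep (2 ^ I.L) 6 (τ.a 30) I.entriesQ → Q τ) :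
    fillTable.wp Z β Q σ := by
  have hZ := hB.le
  refine wp_forLoop (l := 1) (h := I.qe) (fun k τ =>
    (∀ y : Var, ¬ y.Scratch → y ≠ .q → τ.v y = σ.v y) ∧ (∀ A ≠ 30, τ.a A = σ.a A) ∧
    Rep (2 ^ I.L) 6 (τ.a 30) {e | ∃ q, 1 ≤ q ∧ q < k ∧ e = ⟨0, fun j => I.pos j q, 1⟩})
    (by simp; omega) (by simp) (by simpa using hqe) (by omega) (by omega) h1 ?_ ?_ ?_
  · refine ⟨fun y _ hy => by simp [hy], fun _ _ => rfl, ?_⟩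
    have : {e : Entry | ∃ q, 1 ≤ q ∧ q < 1 ∧ e = ⟨0, fun j => I.pos j q, 1⟩} = ∅ := by
      ext e
      simp
    rw [this, Mem.set_a, h30]
    exact Rep.empty _ _
  · rintro k τ hk1 hk2 hτq hτe ⟨g1, g2, g3⟩
    have hBτ : Base Z β I.L τ := ⟨hB.level, hB.one_le,
      (g1 _ (by simp [Var.Scratch]) (by simp)).trans hB.m_eq,
      (g1 _ (by simp [Var.Scratch]) (by simp)).trans hB.b_eq, hB.pow_le⟩
    refine wp_store ⟨0, fun j => I.pos j k, 1⟩ hBτ le_rfl (fun j hj υ h1 h2 => ⟨trivial, ?_, ?_⟩)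
      (fun υ _ _ => ⟨by simp; omega, by simp⟩) (fun υ _ _ => ⟨by simp; omega, by simp⟩)
      (by positivity) g3 fun υ h1 h2 h3 => ?_
    · rw [Exp.eval_get, Exp.eval_var, h1.1 _ (by simp [Var.Scratch]), hτq, h2, g2 _ (by omega),
        hpos j hj k hk1 (by omega)]
    · have := hpos' j hj k hk1 (by omega)
      show I.pos j k < _
      omega
    · refine ⟨(h1.1 _ (by simp [Var.Scratch])).trans hτq,
        (h1.1 _ (by simp [Var.Scratch])).trans hτe,
        by simp [h1.1 .qe (by simp [Var.Scratch]), hτe], fun y hy hyq => ?_,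
        fun A' hA' => (h2 A' hA').trans (g2 A' hA'), ?_⟩
      · rw [Mem.set_v, if_neg hyq, h1.1 y hy, g1 y hy hyq]
      · refine (congrArg (Rep _ _ _) ?_).mp h3
        ext e
        simp only [Set.mem_insert_iff, Set.mem_ofPred_eq]
        constructor
        · rintro (rfl | ⟨r, h1, h2, rfl⟩)
          · exact ⟨k, hk1, by omega, rfl⟩
          · exact ⟨r, h1, by omega, rfl⟩
        · rintro ⟨r, h1, h2, rfl⟩
          rcases (show r < k ∨ r = k by omega) with h | rfl
          · exact .inr ⟨r, h1, h, rfl⟩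
          · exact .inl rfl
  · rintro τ - - ⟨g1, g2, g3⟩
    exact hQ τ g1 g2 g3

/-- Decides whether for every box `p` and every box `r` there is a box `q` that intersects both. -/
def solve : Cmd :=
  sizes ;; fillKeys 0 1 .nq 1 ;; fillKeys 1 0 .np (.var .qe) ;; fillKeys 1 2 .nr (.var .pe) ;;
  each (List.range 6) rank ;; fillTable ;; .ans ≔ 1 ;; checkAll ;; .np ≔ .var .ans

theorem wp_solve {σ : Mem} {Q : Mem → Prop} (hp : σ.v .np = np) (hq : σ.v .nq = nq)
    (hr : σ.v .nr = nr) (hZ : (4 * (np + nq + nr + 2)) ^ 12 ≤ Z) (ha : ∀ A, σ.a A = fun _ => 0)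
    (hQ : ∀ τ : Mem, (τ.v .np = 1 ∧ ∀ p < np, ∀ r < nr, ∃ q < nq, Meets σ 0 q p ∧ Meets σ 2 q r) ∨
      (τ.v .np = 0 ∧ ¬ ∀ p < np, ∀ r < nr, ∃ q < nq, Meets σ 0 q p ∧ Meets σ 2 q r) → Q τ) :
    solve.wp Z (bounds (np + nq + nr)) Q σ := by
  refine (wp_seq ..).2 (wp_sizes hp hq hr hZ ?_)
  rintro σ₀ a₀ x₀ ⟨L, h₀⟩
  set n := np + nq + nr with hn
  have hlt := h₀.lt
  have item : (bounds n) .item = 2 * n := rfl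
  -- the keys
  refine (wp_seq ..).2 (wp_fillKeys (l := nq) (o := 1) (by omega) (by omega) h₀.nq_eq (by simp)
    (fun τ _ => ⟨by simp; omega, by simp⟩) (by omega) (by omega) fun σ₁ v₁ a₁ x₁ k₁ _ => ?_)
  have h₁ := h₀.congr fun y hy => v₁ y (by rintro rfl; simp [Var.Global] at hy)
  refine (wp_seq ..).2 (wp_fillKeys (l := np) (o := nq + 1) (by omega) (by omega) h₁.np_eq (by simp)
    (fun τ hτ => ⟨trivial, by simp [hτ, h₁.qe_eq]⟩) (by omega) (by omega)
    fun σ₂ v₂ a₂ x₂ k₂ j₂ => ?_)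
  have h₂ := h₁.congr fun y hy => v₂ y (by rintro rfl; simp [Var.Global] at hy)
  refine (wp_seq ..).2 (wp_fillKeys (l := nr) (o := nq + 1 + np) (by omega) (by omega) h₂.nr_eq
    (by simp) (fun τ hτ => ⟨trivial, by simp [hτ, h₂.pe_eq]⟩) (by omega) (by omega)
    fun σ₃ v₃ a₃ x₃ k₃ j₃ => ?_)
  have h₃ := h₂.congr fun y hy => v₃ y (by rintro rfl; simp [Var.Global] at hy)
  have keyQ : ∀ d < 6, ∀ u < nq, σ₃.x (3 + d) (1 + u) = keyOf 0 (σ.x 1) u d := fun d hd u hu => by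
    rw [j₃ d hd _ (by omega), j₂ d hd _ (by omega), k₁ d hd u hu, x₀]
  have keyP : ∀ d < 6, ∀ u < np, σ₃.x (3 + d) (nq + 1 + u) = keyOf 1 (σ.x 0) u d :=
    fun d hd u hu => by rw [j₃ d hd _ (by omega), k₂ d hd u hu, x₁ _ (by omega), x₀]
  have keyR : ∀ d < 6, ∀ u < nr, σ₃.x (3 + d) (nq + 1 + np + u) = keyOf 1 (σ.x 2) u d :=
    fun d hd u hu => by rw [k₃ d hd u hu, x₂ _ (by omega), x₁ _ (by omega), x₀]
  have a₃' : ∀ A, σ₃.a A = fun _ => 0 := fun A => by rw [a₃, a₂, a₁, a₀, ha]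
  -- the ranks
  refine (wp_seq ..).2 (wp_each (fun l τ =>
    (∀ y ∉ [Var.node, .left, .right, .q, .u, .v], τ.v y = σ₃.v y) ∧ τ.x = σ₃.x ∧
    (∀ i ∈ l, Ranked n (σ₃.x (3 + i)) (τ.a i) (τ.a (10 + i))) ∧
    (∀ i < 6, i ∉ l → τ.a (20 + i) = fun _ => 0) ∧ ∀ A, 30 ≤ A → τ.a A = fun _ => 0)
    ⟨fun _ _ => rfl, rfl, by simp, fun i _ _ => a₃' _, fun A _ => a₃' A⟩ ?_ ?_)
  · rintro l₁ i l₂ τ hl ⟨g1, g2, g3, g4, g5⟩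
    have hi : i < 6 := by
      rw [← List.mem_range, hl]
      simp
    have hil : i ∉ l₁ := fun h => by
      have := hl ▸ List.nodup_range (n := 6)
      exact (List.nodup_append.1 this).2.2 i h i (by simp) rfl
    have hl6 : ∀ j ∈ l₁, j < 6 := fun j hj => by
      rw [← List.mem_range, hl]
      simp [hj]
    have hτ : Sized Z L np nq nr τ := h₃.congr fun y hy => g1 y (by
      rintro h
      simp at h
      rcases h with rfl | rfl | rfl | rfl | rfl | rfl <;> simp [Var.Global] at hy)
    refine wp_rank hτ.base hτ.n_eq hτ.re_eq hτ.lt_pow (by omega) (g4 i hi hil)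
      fun υ k1 k2 k3 k4 => ⟨fun y hy => (k1 y hy).trans (g1 y hy), k3.trans g2, fun j hj => ?_,
        fun j hj hjl => ?_, fun A hA => ?_⟩
    · rw [g2] at k4
      simp only [List.mem_append, List.mem_singleton] at hj
      rcases hj with hj | rfl
      · have hji : j ≠ i := by rintro rfl; exact hil hj
        have hj6 := hl6 j hj
        rw [k2 _ (by simp; omega), k2 _ (by simp; omega)]
        exact g3 j hj
      · exact k4
    · simp only [List.mem_append, List.mem_singleton, not_or] at hjl
      rw [k2 _ (by simp; omega)]
      exact g4 j hj hjl.1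
    · rw [k2 _ (by simp; omega)]
      exact g5 A hA
  rintro σ₄ ⟨v₄, x₄, r₄, -, a₄⟩
  have h₄ : Sized Z L np nq nr σ₄ := h₃.congr fun y hy => v₄ y (by
      rintro h
      simp at h
      rcases h with rfl | rfl | rfl | rfl | rfl | rfl <;> simp [Var.Global] at hy)
  have hrank : ∀ i < 6, Ranked n (σ₃.x (3 + i)) (σ₄.a i) (σ₄.a (10 + i)) :=
    fun i hi => r₄ i (List.mem_range.2 hi)
  set I : Params := ⟨n, nq + 1, nq + 1 + np, n + 1, L, root6 n, n / root6 n + 1,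
    fun i => σ₄.a i, fun i => σ₄.a (10 + i)⟩ with hI
  -- the table
  refine (wp_seq ..).2 (wp_fillTable (I := I) h₄.base h₄.lt_pow h₄.qe_eq
    (show 1 ≤ nq + 1 by omega) (show nq + 1 ≤ n + 1 by omega) (show n ≤ (bounds n) .item by omega)
    (fun i _ j _ _ => rfl) (fun i hi => (hrank i hi).pos_lt) (a₄ 30 le_rfl) fun σ₅ v₅ a₅ r₅ => ?_)
  have h₅ : Sized Z L np nq nr σ₅ := h₄.congr fun y hy => by
    refine v₅ y ?_ ?_
    · rcases hy with hy | hy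
      · exact hy.not_scratch
      · simp at hy
        rcases hy with rfl | rfl | rfl <;> simp [Var.Scratch]
    · rintro rfl
      simp [Var.Global] at hy
  have good : I.Good Z (bounds n) :=
    { one_le_qe := show 1 ≤ nq + 1 by omega
      qe_le := show nq + 1 ≤ nq + 1 + np by omega
      pe_le := show nq + 1 + np ≤ n + 1 by omega
      re_eq := rfl
      lt_pow := h₅.lt_pow
      one_le_t := one_le_root6 n
      t_le := show root6 n ≤ 2 * 2 ^ L by
        have := root6_le_succ n
        have := h₅.lt_pow
        omega
      one_le_w := Nat.le_add_left 1 _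
      w_le := show n / root6 n + 1 ≤ n + 1 by
        have := Nat.div_le_self n (root6 n)
        omega
      n_le := (Nat.lt_mul_div_succ n (one_le_root6 n)).le
      pos_lt := fun i hi => (hrank i hi).pos_lt
      inv_pos := fun i hi => (hrank i hi).inv_pos
      item_le := show n ≤ 2 * n by omega
      slab_le := le_rfl
      block_le := le_rfl }
  have glob : Glob Z (bounds n) I σ₅ :=
    { base := h₅.base
      good := good
      n_eq := h₅.n_eq
      t_eq := h₅.t_eq
      w_eq := h₅.w_eq
      qe_eq := h₅.qe_eq
      pe_eq := h₅.pe_eq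
      re_eq := h₅.re_eq
      pos_eq := fun i hi j _ _ => by rw [a₅ i (by omega)]
      inv_eq := fun i hi j => by rw [a₅ _ (by omega)]
      rep := r₅ }
  -- `q` precedes the other items, so that ties are intersections
  have hle : ∀ q < nq, ∀ j, nq + 1 ≤ j → j ≤ n → ∀ i < 6,
      (I.pos i (1 + q) < I.pos i j ↔ σ₃.x (3 + i) (1 + q) ≤ σ₃.x (3 + i) j) := by
    intro q hq j hj hjn i hi
    refine ((hrank i hi).lt_iff (by omega) (by omega) (by omega) hjn).trans ?_
    unfold KeyLt
    rw [le_iff_lt_or_eq]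
    exact or_congr_right (and_iff_left (by omega))
  have hbad : ∀ p < np, ∀ r < nr, (¬ I.Bad (nq + 1 + p) (nq + 1 + np + r) ↔
      ∃ q < nq, Meets σ 0 q p ∧ Meets σ 2 q r) := by
    intro p hp r hr
    have key : ∀ q < nq, ((∀ i < 6, I.pos i (1 + q) < I.pos i (nq + 1 + p) ∧
        I.pos i (1 + q) < I.pos i (nq + 1 + np + r)) ↔ Meets σ 0 q p ∧ Meets σ 2 q r) := by
      intro q hq
      unfold Meets
      rw [← forall₂_and]
      refine forall₂_congr fun i hi => ?_
      rw [hle q hq _ (by omega) (by omega) i hi, hle q hq _ (by omega) (by omega) i hi,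
        keyQ i hi q hq, keyP i hi p hp, keyR i hi r hr]
    rw [Params.Bad, not_not]
    constructor
    · rintro ⟨q, h1, h2, h3⟩
      obtain ⟨q, rfl⟩ := Nat.exists_eq_add_of_le h1
      have hq : q < nq := by
        change 1 + q < nq + 1 at h2
        omega
      exact ⟨q, hq, (key q hq).1 h3⟩
    · rintro ⟨q, hq, h3⟩
      exact ⟨1 + q, by omega, show 1 + q < nq + 1 by omega, (key q hq).2 h3⟩
  refine (wp_seq ..).2 ((wp_asg ..).2 ⟨by simp; omega, (wp_seq ..).2 (wp_checkAll
    (glob.set (y := .ans) id _) (fun A hA => ?_) (by simp) ?_)⟩)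
  · rw [Mem.set_a, a₅ _ (by omega)]
    exact a₄ A (by omega)
  rintro τ (⟨h1, p, r, hp1, hp2, hr1, hr2, hb⟩ | ⟨h1, hall⟩)
  · refine (wp_asg ..).2 ⟨trivial, hQ _ (.inr ⟨by simp [h1], fun hall => ?_⟩)⟩
    change nq + 1 ≤ p at hp1
    change p < nq + 1 + np at hp2
    change nq + 1 + np ≤ r at hr1
    change r < n + 1 at hr2
    obtain ⟨p, rfl⟩ := Nat.exists_eq_add_of_le hp1
    obtain ⟨r, rfl⟩ := Nat.exists_eq_add_of_le hr1
    exact (hbad p (by omega) r (by omega)).2 (hall p (by omega) r (by omega)) hb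
  · refine (wp_asg ..).2 ⟨trivial, hQ _ (.inl ⟨by simp [h1], fun p hp r hr => ?_⟩)⟩
    exact (hbad p hp r hr).1 (hall _ _ (show nq + 1 ≤ nq + 1 + p by omega)
      (show nq + 1 + p < nq + 1 + np by omega) (show nq + 1 + np ≤ nq + 1 + np + r by omega)
      (show nq + 1 + np + r < n + 1 by omega))

end Cmd

end BoxCover

/-! ### Running time -/

namespace BoxCover

open RealRAM

namespace Cmd

/-- The running time of `c` is at most a constant times `X`. -/
def CostLE (c : Cmd) (X : ℕ → ℕ) : Prop := ∃ C, ∀ n, c.cost (bounds n) ≤ C * X n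

theorem CostLE.mono {c : Cmd} {X Y : ℕ → ℕ} (h : CostLE c X) (hXY : ∀ n, X n ≤ Y n) :
    CostLE c Y := by
  obtain ⟨C, hC⟩ := h
  exact ⟨C, fun n => (hC n).trans (Nat.mul_le_mul_left _ (hXY n))⟩

theorem CostLE.skip : CostLE skip fun _ => 1 := ⟨1, fun _ => le_rfl⟩

theorem CostLE.asg (y : Var) (e : Exp) : CostLE (y ≔ e) fun _ => 1 :=
  ⟨e.cost + 1, fun _ => (mul_one _).ge⟩

theorem CostLE.put (A : ℕ) (e f : Exp) : CostLE (put A e f) fun _ => 1 :=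
  ⟨e.cost + (f.cost + 1), fun _ => (mul_one _).ge⟩

theorem CostLE.rcopy (A : ℕ) (e : Exp) (B : ℕ) (f : Exp) : CostLE (rcopy A e B f) fun _ => 1 :=
  ⟨e.cost + (f.cost + (1 + 1)), fun _ => (mul_one _).ge⟩

theorem CostLE.rneg (A : ℕ) (e : Exp) (B : ℕ) (f : Exp) : CostLE (rneg A e B f) fun _ => 1 :=
  ⟨e.cost + (f.cost + (1 + (1 + (1 + 1)))), fun _ => (mul_one _).ge⟩

theorem CostLE.seq {c d : Cmd} {X : ℕ → ℕ} (hc : CostLE c X) (hd : CostLE d X) :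
    CostLE (c ;; d) X := by
  obtain ⟨C, hC⟩ := hc
  obtain ⟨D, hD⟩ := hd
  refine ⟨C + D, fun n => ?_⟩
  rw [add_mul]
  exact Nat.add_le_add (hC n) (hD n)

theorem cost_pos (β : Kind → ℕ) (c : Cmd) : 1 ≤ c.cost β := by
  induction c <;> simp only [cost] <;> omega

theorem CostLE.ite {b : Cond} {c d : Cmd} {X : ℕ → ℕ} (hc : CostLE c X) (hd : CostLE d X) :
    CostLE (ite b c d) X := by
  obtain ⟨C, hC⟩ := hc
  obtain ⟨D, hD⟩ := hd
  refine ⟨(b.cost + 2) * C + D, fun n => ?_⟩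
  have h1 := cost_pos (bounds n) c
  have h2 : b.cost * 1 ≤ b.cost * (C * X n) := Nat.mul_le_mul_left _ (h1.trans (hC n))
  have h3 : ((b.cost + 2) * C + D) * X n = b.cost * (C * X n) + 2 * (C * X n) + D * X n := by ring
  have := hC n
  have := hD n
  simp only [cost]
  omega

theorem CostLE.loop {κ : Kind} {b : Cond} {c : Cmd} {X : ℕ → ℕ} (hc : CostLE c X) :
    CostLE (loop κ b c) fun n => (bounds n κ + 1) * X n := by
  obtain ⟨C, hC⟩ := hc
  refine ⟨(b.cost + 2) * C, fun n => ?_⟩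
  have h1 := cost_pos (bounds n) c
  have h2 : b.cost * 1 ≤ b.cost * (C * X n) := Nat.mul_le_mul_left _ (h1.trans (hC n))
  have h3 : 1 + (c.cost (bounds n) + b.cost) ≤ (b.cost + 2) * C * X n := by
    have h4 : (b.cost + 2) * C * X n = b.cost * (C * X n) + 2 * (C * X n) := by ring
    have := hC n
    omega
  calc (Cmd.loop κ b c).cost (bounds n)
      = b.cost + (bounds n κ * (1 + (c.cost (bounds n) + b.cost)) + 1) := rfl
    _ ≤ bounds n κ * (1 + (c.cost (bounds n) + b.cost)) + (1 + (c.cost (bounds n) + b.cost)) := by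
        omega
    _ = (bounds n κ + 1) * (1 + (c.cost (bounds n) + b.cost)) := by ring
    _ ≤ (bounds n κ + 1) * ((b.cost + 2) * C * X n) := Nat.mul_le_mul_left _ h3
    _ = _ := by ring

theorem CostLE.forLoop {κ : Kind} {y hi : Var} {lo : Exp} {c : Cmd} {X : ℕ → ℕ}
    (hc : CostLE c X) (hX : ∀ n, 1 ≤ X n) :
    CostLE (forLoop κ y lo hi c) fun n => (bounds n κ + 1) * X n :=
  .seq ((CostLE.asg _ _).mono fun n => Nat.mul_pos (Nat.succ_pos _) (hX n))
    (.loop (.seq hc ((CostLE.asg _ _).mono hX)))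

theorem CostLE.each {α : Type*} {l : List α} {c : α → Cmd} {X : ℕ → ℕ}
    (hc : ∀ i ∈ l, CostLE (c i) X) (hX : ∀ n, 1 ≤ X n) : CostLE (each l c) X := by
  induction l with
  | nil => exact CostLE.skip.mono hX
  | cons i l ih => exact .seq (hc i (by simp)) (ih fun j hj => hc j (by simp [hj]))

/-- The time for an operation on a table. -/
def tableTime (n : ℕ) : ℕ := (bounds n .level + 1) ^ 6

/-- The time for scanning the slabs of a box. -/
def scanTime (n : ℕ) : ℕ := (bounds n .slab + 1) * tableTime n

/-- The time for the whole algorithm. -/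
def totalTime (n : ℕ) : ℕ :=
  (bounds n .item + 1) * ((bounds n .slab + 1) + (bounds n .block + 1)) * tableTime n

theorem one_le_tableTime (n : ℕ) : 1 ≤ tableTime n := Nat.one_le_pow _ _ (Nat.succ_pos _)

theorem level_le_tableTime (n : ℕ) : bounds n .level + 1 ≤ tableTime n :=
  Nat.le_self_pow (by omega) _

theorem table_le_scanTime (n : ℕ) : tableTime n ≤ scanTime n :=
  Nat.le_mul_of_pos_left _ (Nat.succ_pos _)

theorem one_le_scanTime (n : ℕ) : 1 ≤ scanTime n := (one_le_tableTime n).trans (table_le_scanTime n)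

theorem item_scan_le (n : ℕ) : (bounds n .item + 1) * scanTime n ≤ totalTime n := by
  rw [totalTime, scanTime, ← mul_assoc]
  exact Nat.mul_le_mul_right _ (Nat.mul_le_mul_left _ (Nat.le_add_right _ _))

theorem item_table_le (n : ℕ) : (bounds n .item + 1) * tableTime n ≤ totalTime n :=
  (Nat.mul_le_mul_left _ (table_le_scanTime n)).trans (item_scan_le n)

theorem block_item_table_le (n : ℕ) :
    (bounds n .block + 1) * ((bounds n .item + 1) * tableTime n) ≤ totalTime n := by
  rw [totalTime, ← mul_assoc, mul_comm (bounds n .block + 1)]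
  exact Nat.mul_le_mul_right _ (Nat.mul_le_mul_left _ (Nat.le_add_left _ _))

theorem block_le_totalTime (n : ℕ) : bounds n .block + 1 ≤ totalTime n :=
  le_trans (Nat.le_mul_of_pos_right _ (Nat.mul_pos (Nat.succ_pos _) (one_le_tableTime n)))
    (block_item_table_le n)

theorem table_le_totalTime (n : ℕ) : tableTime n ≤ totalTime n :=
  (Nat.le_mul_of_pos_left _ (Nat.succ_pos _)).trans (item_table_le n)

theorem one_le_totalTime (n : ℕ) : 1 ≤ totalTime n :=
  (one_le_tableTime n).trans (table_le_totalTime n)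

theorem CostLE.walk {e : ℕ} {body : Cmd} (hb : CostLE body fun _ => 1) (d j : ℕ) :
    CostLE (walk e body d j) fun n => (bounds n .level + 1) ^ d := by
  have h1 : ∀ d n, 1 ≤ (bounds n .level + 1) ^ d := fun d n => Nat.one_le_pow _ _ (Nat.succ_pos _)
  induction d generalizing j with
  | zero => simpa [Cmd.walk] using hb
  | succ d ih =>
    refine .seq ((CostLE.asg _ _).mono (h1 _)) ?_
    refine (CostLE.loop (X := fun n => (bounds n .level + 1) ^ d) (.seq (.ite (.seq
      ((CostLE.asg _ _).mono (h1 _)) (ih _)) (CostLE.skip.mono (h1 _)))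
      ((CostLE.asg _ _).mono (h1 _)))).mono fun n => ?_
    rw [pow_succ']

theorem pow_le_tableTime {d : ℕ} (hd : d ≤ 6) (n : ℕ) :
    (bounds n .level + 1) ^ d ≤ tableTime n := Nat.pow_le_pow_right (Nat.succ_pos _) hd

theorem CostLE.store {A d : ℕ} (hd : d ≤ 6) (e : ℕ → Exp) (i v : Exp) :
    CostLE (store A d e i v) tableTime :=
  .seq (.each (fun _ _ => (CostLE.asg _ _).mono one_le_tableTime) one_le_tableTime)
    (.seq ((CostLE.asg _ _).mono one_le_tableTime) (.seq ((CostLE.asg _ _).mono one_le_tableTime)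
      ((CostLE.walk (.seq (.asg _ _) (.ite (.put _ _ _) .skip)) _ _).mono (pow_le_tableTime hd))))

theorem CostLE.look {A d : ℕ} (hd : d ≤ 6) (e : ℕ → Exp) (i : Exp) :
    CostLE (look A d e i) tableTime :=
  .seq (.each (fun _ _ => (CostLE.asg _ _).mono one_le_tableTime) one_le_tableTime)
    (.seq ((CostLE.asg _ _).mono one_le_tableTime) (.seq ((CostLE.asg _ _).mono one_le_tableTime)
      ((CostLE.walk (.seq (.asg _ _) (.ite (.asg _ _) .skip)) _ _).mono (pow_le_tableTime hd))))

theorem CostLE.stageZero (s : Bool) (A : ℕ) : CostLE (stageZero s A) totalTime := by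
  refine .seq ((CostLE.forLoop (.store le_rfl _ _ _) one_le_tableTime).mono item_table_le)
    ((CostLE.forLoop (.seq (.look le_rfl _ _) ?_) one_le_tableTime).mono item_table_le)
  exact .ite (.seq (.look le_rfl _ _) (.ite ((CostLE.asg _ _).mono one_le_tableTime)
    (CostLE.skip.mono one_le_tableTime))) (CostLE.skip.mono one_le_tableTime)

theorem CostLE.fillCells (K : List ℕ) (s : Bool) (A : ℕ) :
    CostLE (fillCells K s A) totalTime := by
  have hone : ∀ n, 1 ≤ (bounds n .item + 1) * tableTime n := fun n =>
    Nat.mul_pos (Nat.succ_pos _) (one_le_tableTime n)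
  have hlows : CostLE (lows K) fun _ => 1 := .seq (.asg _ _)
    (.each (fun _ _ => .seq (.asg _ _) (.asg _ _)) fun _ => le_rfl)
  have hcell : CostLE (fillCell K s A) fun n => (bounds n .item + 1) * tableTime n :=
    .forLoop (.seq (.look le_rfl _ _) (.ite (.store le_rfl _ _ _)
      (CostLE.skip.mono one_le_tableTime))) one_le_tableTime
  exact .seq ((CostLE.asg _ _).mono one_le_totalTime) (.seq
    (.each (fun _ _ => (CostLE.asg _ _).mono one_le_totalTime) one_le_totalTime)
    ((CostLE.forLoop (.seq (hlows.mono hone) hcell) hone).mono block_item_table_le))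

theorem CostLE.guard {c : Cmd} {X : ℕ → ℕ} (hc : CostLE c X) (hX : ∀ n, 1 ≤ X n) (K : List ℕ) :
    CostLE (guard K c) X := by
  induction K with
  | nil => exact hc
  | cons i K ih => exact .ite ih (CostLE.skip.mono hX)

theorem CostLE.scan {c : Cmd} (hc : CostLE c tableTime) (K : List ℕ) :
    CostLE (scan K c) scanTime := by
  have hs := CostLE.skip.mono one_le_tableTime
  exact .each (fun i _ => .seq ((CostLE.asg _ _).mono one_le_scanTime)
    (.seq ((CostLE.asg _ _).mono one_le_scanTime)
      (.forLoop (.seq ((CostLE.asg _ _).mono one_le_tableTime)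
        (.ite (.ite (hc.guard one_le_tableTime K) hs) hs)) one_le_tableTime))) one_le_scanTime

theorem CostLE.insertItem (A x y z : ℕ) : CostLE (insertItem A x y z) tableTime :=
  .store (by omega) _ _ _

theorem CostLE.lookPair (A : ℕ) (e f : Exp) : CostLE (lookPair A e f) tableTime :=
  .look (by omega) _ _

theorem CostLE.probe (K : List ℕ) (x y z A : ℕ) : CostLE (probe K x y z A) tableTime :=
  .seq (.lookPair _ _ _) (.seq ((CostLE.asg _ _).mono one_le_tableTime)
    (.seq (.look le_rfl _ _) (.ite ((CostLE.asg _ _).mono one_le_tableTime)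
      (CostLE.skip.mono one_le_tableTime))))

theorem CostLE.stage (K : List ℕ) (s : Bool) (x y z A : ℕ) :
    CostLE (stage K s x y z A) totalTime := by
  have ha : ∀ y e, CostLE (y ≔ e) tableTime := fun y e => (CostLE.asg _ _).mono one_le_tableTime
  have hs : ∀ {c : Cmd}, CostLE c tableTime → CostLE c scanTime := fun h =>
    h.mono table_le_scanTime
  have hcell : CostLE (findCell K) tableTime :=
    .seq (ha _ _) (.each (fun _ _ => ha _ _) one_le_tableTime)
  have hplanes : CostLE (fillPlanes K x y z A) scanTime :=
    .scan (.seq (.insertItem _ _ _ _) (.seq (.insertItem _ _ _ _) (.insertItem _ _ _ _))) _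
  have hprobe : CostLE (probeAll K x y z A) scanTime :=
    .seq (hs (ha _ _)) (.seq (hs (ha _ _)) (.seq (hs (.probe _ _ _ _ _)) (.scan
      (.seq (.lookPair _ _ _) (.seq (ha _ _) (.seq (ha _ _) (.seq (.probe _ _ _ _ _)
        (.seq (.lookPair _ _ _) (.seq (ha _ _) (.seq (ha _ _) (.probe _ _ _ _ _)))))))) _)))
  exact .seq (.fillCells _ _ _) ((CostLE.forLoop (.seq (hs hcell) (.seq hplanes hprobe))
    one_le_scanTime).mono item_scan_le)

theorem CostLE.sizes : CostLE sizes totalTime := by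
  have ha : ∀ y e, CostLE (y ≔ e) totalTime := fun y e => (CostLE.asg _ _).mono one_le_totalTime
  refine .seq (ha _ _) (.seq (ha _ _) (.seq (ha _ _) (.seq (ha _ _) (.seq (ha _ _) (.seq ?_
    (.seq (ha _ _) (.seq (ha _ _) (.seq ?_ (ha _ _)))))))))
  · refine (CostLE.loop (.asg _ _)).mono fun n => ?_
    rw [mul_one]
    exact (level_le_tableTime n).trans (table_le_totalTime n)
  · refine (CostLE.loop (.asg _ _)).mono fun n => ?_
    rw [mul_one]
    refine le_trans (Nat.succ_le_succ ?_) (block_le_totalTime n)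
    exact Nat.le_self_pow (by omega) _

theorem CostLE.fillKeys (s B : ℕ) (count : Var) (off : Exp) :
    CostLE (fillKeys s B count off) totalTime := by
  refine (CostLE.forLoop (X := tableTime) (.each (fun d _ => ?_) one_le_tableTime)
    one_le_tableTime).mono item_table_le
  split_ifs
  · exact (CostLE.rcopy _ _ _ _).mono one_le_tableTime
  · exact (CostLE.rneg _ _ _ _).mono one_le_tableTime

theorem CostLE.rank (i : ℕ) : CostLE (rank i) totalTime := by
  have ha : ∀ y e, CostLE (y ≔ e) tableTime := fun y e => (CostLE.asg _ _).mono one_le_tableTime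
  have hp : ∀ A e f, CostLE (Cmd.put A e f) tableTime := fun A e f =>
    (CostLE.put _ _ _).mono one_le_tableTime
  have hplay : ∀ B, CostLE (play B) fun _ => 1 := fun B =>
    .ite (.asg _ _) (.ite (.ite (.asg _ _) .skip) .skip)
  have hleaf : ∀ A B j f, CostLE (setLeaf A B j f) tableTime := fun A B j f =>
    .seq (ha _ _) (.seq (hp _ _ _) ((CostLE.loop (.seq (.asg _ _) (.seq (.asg _ _)
      (.seq (.asg _ _) (.seq (hplay _) (.put _ _ _)))))).mono
        fun n => by rw [mul_one]; exact level_le_tableTime n))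
  exact .seq ((CostLE.forLoop (hleaf _ _ _ _) one_le_tableTime).mono item_table_le)
    ((CostLE.forLoop (.seq (ha _ _) (.seq (hp _ _ _) (.seq (hp _ _ _) (hleaf _ _ _ _))))
      one_le_tableTime).mono item_table_le)

theorem CostLE.solve : CostLE solve totalTime := by
  have ha : ∀ y e, CostLE (y ≔ e) totalTime := fun y e => (CostLE.asg _ _).mono one_le_totalTime
  have htable : CostLE fillTable totalTime :=
    (CostLE.forLoop (.store le_rfl _ _ _) one_le_tableTime).mono item_table_le
  have hcheck : CostLE checkAll totalTime := .seq (.stageZero _ _) (.seq (.stageZero _ _)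
    (.each (fun _ _ => .seq (.stage _ _ _ _ _ _) (.stage _ _ _ _ _ _)) one_le_totalTime))
  exact .seq .sizes (.seq (.fillKeys _ _ _ _) (.seq (.fillKeys _ _ _ _) (.seq (.fillKeys _ _ _ _)
    (.seq (.each (fun i _ => .rank i) one_le_totalTime) (.seq htable (.seq (ha _ _)
      (.seq hcheck (ha _ _))))))))

end Cmd

theorem rpow_le_root6 (n : ℕ) : (n : ℝ) ^ (1 / 6 : ℝ) ≤ root6 n := by
  have h : (n : ℝ) ≤ (root6 n : ℝ) ^ (6 : ℕ) := by exact_mod_cast le_root6_pow n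
  calc (n : ℝ) ^ (1 / 6 : ℝ) ≤ ((root6 n : ℝ) ^ (6 : ℕ)) ^ (1 / 6 : ℝ) :=
        Real.rpow_le_rpow (by positivity) h (by norm_num)
    _ = root6 n := by
        rw [← Real.rpow_natCast, ← Real.rpow_mul (by positivity)]
        norm_num

theorem root6_le_rpow {n : ℕ} (hn : 1 ≤ n) : (root6 n : ℝ) ≤ 2 * (n : ℝ) ^ (1 / 6 : ℝ) := by
  have hn' : (1 : ℝ) ≤ (n : ℝ) ^ (1 / 6 : ℝ) :=
    Real.one_le_rpow (by exact_mod_cast hn) (by norm_num)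
  have h1 : root6 n ≤ ⌈(n : ℝ) ^ (1 / 6 : ℝ)⌉₊ := by
    refine root6_le (Nat.one_le_ceil_iff.2 (by positivity)) ?_
    have h2 : (n : ℝ) ≤ (⌈(n : ℝ) ^ (1 / 6 : ℝ)⌉₊ : ℝ) ^ (6 : ℕ) := by
      calc (n : ℝ) = ((n : ℝ) ^ (1 / 6 : ℝ)) ^ (6 : ℕ) := by
            rw [← Real.rpow_natCast, ← Real.rpow_mul (by positivity)]
            norm_num
        _ ≤ _ := pow_le_pow_left₀ (by positivity) (Nat.le_ceil _) 6
    exact_mod_cast h2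
  have h3 := Nat.ceil_lt_add_one (show (0 : ℝ) ≤ (n : ℝ) ^ (1 / 6 : ℝ) by positivity)
  have h4 : (root6 n : ℝ) ≤ ⌈(n : ℝ) ^ (1 / 6 : ℝ)⌉₊ := by exact_mod_cast h1
  linarith

/-- With slabs of width about `n ^ (5 / 6)`, both the number of cells and the number of boxes in
the slabs of a box are `O(n ^ (5 / 6))`. -/
theorem slab_add_block_le {n : ℕ} (hn : 1 ≤ n) :
    (((bounds n .slab + 1) + (bounds n .block + 1) : ℕ) : ℝ) ≤ 36 * (n : ℝ) ^ (5 / 6 : ℝ) := by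
  have hn0 : (0 : ℝ) < n := by exact_mod_cast hn
  have h1 : (1 : ℝ) ≤ (n : ℝ) ^ (5 / 6 : ℝ) :=
    Real.one_le_rpow (by exact_mod_cast hn) (by norm_num)
  have h2 : ((n / root6 n : ℕ) : ℝ) ≤ (n : ℝ) ^ (5 / 6 : ℝ) := by
    refine Nat.cast_div_le.trans ?_
    rw [div_le_iff₀ (by exact_mod_cast one_le_root6 n)]
    calc (n : ℝ) = (n : ℝ) ^ (5 / 6 : ℝ) * (n : ℝ) ^ (1 / 6 : ℝ) := by
          rw [← Real.rpow_add hn0]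
          norm_num
      _ ≤ _ := mul_le_mul_of_nonneg_left (rpow_le_root6 n) (by positivity)
  have h3 : ((root6 n ^ 5 : ℕ) : ℝ) ≤ 32 * (n : ℝ) ^ (5 / 6 : ℝ) := by
    push_cast
    calc (root6 n : ℝ) ^ 5 ≤ (2 * (n : ℝ) ^ (1 / 6 : ℝ)) ^ 5 :=
          pow_le_pow_left₀ (by positivity) (root6_le_rpow hn) 5
      _ = 32 * (n : ℝ) ^ (5 / 6 : ℝ) := by
          rw [mul_pow, ← Real.rpow_natCast ((n : ℝ) ^ (1 / 6 : ℝ)), ← Real.rpow_mul hn0.le]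
          norm_num
  simp only [bounds]
  push_cast at h2 h3 ⊢
  linarith

theorem level_le (k : ℕ) {n : ℕ} (hn : 3 ≤ n) :
    ((bounds (k * n) .level + 1 : ℕ) : ℝ) ≤ (2 * Real.log (k + 1) + 4) * Real.log n := by
  have hn0 : (0 : ℝ) < n := by exact_mod_cast (show 0 < n by omega)
  have hlog : 1 ≤ Real.log n := by
    rw [Real.le_log_iff_exp_le hn0]
    have h1 := Real.exp_one_lt_d9
    have h2 : (3 : ℝ) ≤ n := by exact_mod_cast hn
    linarith
  have hk : 0 ≤ Real.log ((k : ℝ) + 1) := Real.log_nonneg (by linarith [k.cast_nonneg (α := ℝ)])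
  have h2 : (1 : ℝ) / 2 ≤ Real.log 2 := by
    have := Real.log_two_gt_d9
    linarith
  set c := Nat.clog 2 (k * n + 2) with hc
  have h3 : ((c - 1 : ℕ) : ℝ) * Real.log 2 ≤ Real.log ((k + 1) * n) := by
    rw [← Real.log_pow]
    refine Real.log_le_log (by positivity) ?_
    have h4 := Nat.pow_pred_clog_lt_self (b := 2) (by omega) (x := k * n + 2) (by omega)
    have h5 : 2 ^ (c - 1) ≤ (k + 1) * n := by
      rw [← hc, Nat.pred_eq_sub_one] at h4
      rw [add_mul]
      omega
    exact_mod_cast h5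
  rw [Real.log_mul (by positivity) hn0.ne'] at h3
  have h6 : (c : ℝ) ≤ ((c - 1 : ℕ) : ℝ) + 1 := by
    exact_mod_cast (show c ≤ c - 1 + 1 by omega)
  have h7 : ((c - 1 : ℕ) : ℝ) * (1 / 2) ≤ ((c - 1 : ℕ) : ℝ) * Real.log 2 :=
    mul_le_mul_of_nonneg_left h2 (by positivity)
  simp only [bounds]
  push_cast
  rw [← hc]
  nlinarith [mul_le_mul_of_nonneg_left hlog hk]

/-- The running time is `Õ(n ^ (11 / 6))`, also if the input is copied `k` times. -/
theorem isSoftO_totalTime (C k : ℕ) (hk : 1 ≤ k) :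
    IsSoftO (fun n => C * Cmd.totalTime (k * n)) fun n => (n : ℝ) ^ (11 / 6 : ℝ) := by
  refine ⟨6, Asymptotics.IsBigO.of_bound (C * ((3 * k) * (36 * (k : ℝ) ^ (5 / 6 : ℝ)) *
    (2 * Real.log (k + 1) + 4) ^ 6)) (Filter.eventually_atTop.2 ⟨3, fun n hn => ?_⟩)⟩
  have hn0 : (0 : ℝ) < n := by exact_mod_cast (show 0 < n by omega)
  have hk0 : (1 : ℝ) ≤ k := by exact_mod_cast hk
  have hn1 : (1 : ℝ) ≤ n := by exact_mod_cast (show 1 ≤ n by omega)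
  have hlog : 0 ≤ Real.log n := Real.log_nonneg hn1
  have h1 : ((bounds (k * n) .item + 1 : ℕ) : ℝ) ≤ 3 * k * n := by
    simp only [bounds]
    push_cast
    nlinarith
  have h2 := slab_add_block_le (n := k * n) (Nat.mul_pos hk (by omega))
  rw [Nat.cast_mul, Real.mul_rpow (by positivity) hn0.le] at h2
  have h3 := pow_le_pow_left₀ (by positivity) (level_le k hn) 6
  rw [Real.norm_of_nonneg (by positivity), Real.norm_of_nonneg (by positivity)]
  have h4 : (n : ℝ) ^ (11 / 6 : ℝ) = n * (n : ℝ) ^ (5 / 6 : ℝ) := by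
    rw [← Real.rpow_one_add' hn0.le (by norm_num)]
    norm_num
  beta_reduce
  rw [h4, Nat.cast_mul, Cmd.totalTime, Cmd.tableTime, Nat.cast_mul, Nat.cast_mul, Nat.cast_pow]
  calc _ ≤ (C : ℝ) * (3 * k * n * (36 * ((k : ℝ) ^ (5 / 6 : ℝ) * (n : ℝ) ^ (5 / 6 : ℝ))) *
        ((2 * Real.log (k + 1) + 4) * Real.log n) ^ 6) := by gcongr
    _ = _ := by ring

end BoxCover

/-! ### Boxes and graphs -/

namespace Box3

theorem intersects_iff {p q : Box3} :
    p.Intersects q ↔ ∀ a, p.fst a ≤ q.snd a ∧ q.fst a ≤ p.snd a := by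
  rw [Intersects, Set.Icc_inter_Icc, Set.nonempty_Icc, sup_le_iff, le_inf_iff, le_inf_iff]
  have hp := p.fst_le_snd
  have hq := q.fst_le_snd
  simp only [Pi.le_def] at *
  exact ⟨fun h a => ⟨h.1.2 a, h.2.1 a⟩, fun h => ⟨⟨hp, fun a => (h a).1⟩, fun a => (h a).2, hq⟩⟩

theorem Intersects.symm {p q : Box3} (h : p.Intersects q) : q.Intersects p := by
  rw [intersects_iff] at *
  exact fun a => (h a).symm

theorem Intersects.refl (p : Box3) : p.Intersects p :=
  intersects_iff.2 fun a => ⟨p.fst_le_snd a, p.fst_le_snd a⟩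

/-- The diameter is at most `2` if and only if every two boxes have a common neighbour; as a box
intersects itself, there is no need to treat equal and adjacent boxes separately. -/
theorem ediam_intersectionGraph_le_two (B : List Box3) :
    (intersectionGraph B).ediam ≤ 2 ↔
      ∀ p ∈ B, ∀ r ∈ B, ∃ q ∈ B, q.Intersects p ∧ q.Intersects r := by
  have adj : ∀ i j, B.get i |>.Intersects (B.get j) → (intersectionGraph B).edist i j ≤ 1 := by
    intro i j h
    rw [SimpleGraph.edist_le_one_iff_adj_or_eq]
    by_cases hij : i = j
    exacts [.inr hij, .inl ⟨hij, h⟩]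
  rw [SimpleGraph.ediam_le_iff]
  constructor
  · intro h p hp r hr
    obtain ⟨i, rfl⟩ := List.get_of_mem hp
    obtain ⟨j, rfl⟩ := List.get_of_mem hr
    by_contra hn
    push Not at hn
    have hn' : ∀ k, (B.get k).Intersects (B.get i) → ¬ (B.get k).Intersects (B.get j) :=
      fun k => hn _ (List.get_mem B k)
    refine absurd (h i j) (not_le.2 (SimpleGraph.two_lt_edist_iff.2 ⟨?_, ?_, ?_⟩))
    · rintro rfl
      exact hn' i (.refl _) (.refl _)
    · exact fun ha => hn' i (.refl _) ha.2
    · ext k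
      simp only [SimpleGraph.mem_commonNeighbors, Set.mem_empty_iff_false, iff_false]
      exact fun hk => hn' k hk.1.2.symm hk.2.2.symm
  · intro h i j
    obtain ⟨q, hq, h1, h2⟩ := h _ (List.get_mem B i) _ (List.get_mem B j)
    obtain ⟨k, rfl⟩ := List.get_of_mem hq
    calc _ ≤ (intersectionGraph B).edist i k + (intersectionGraph B).edist k j :=
          SimpleGraph.edist_triangle
      _ ≤ 1 + 1 := add_le_add (adj i k h1.symm) (adj k j h2)
      _ = 2 := one_add_one_eq_two

theorem getD_flatMap_coords (B : List Box3) {u j : ℕ} (hu : u < B.length) (hj : j < 6) :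
    (B.flatMap coords).getD (6 * u + j) 0 = B[u].coords.getD j 0 := by
  induction B generalizing u with
  | nil => simp at hu
  | cons b B ih =>
    have hlen : b.coords.length = 6 := rfl
    rw [List.flatMap_cons]
    cases u with
    | zero =>
      rw [List.getD_append _ _ _ _ (by omega)]
      simp
    | succ u =>
      rw [List.getD_append_right _ _ _ _ (by omega), hlen,
        show 6 * (u + 1) + j - 6 = 6 * u + j by omega, ih (by simpa using hu)]
      simp

end Box3

namespace BoxCover

open RealRAM

/-- The memory contents represented by a machine state. -/
def Mem.ofState (s : State) : Mem := ⟨fun y => s.wreg y.code, s.wmem, s.rmem⟩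

theorem Mem.sim_ofState (s : State) : Sim (Mem.ofState s) s := ⟨fun _ => rfl, rfl, rfl⟩

/-- The real array `A` contains the coordinates of the boxes in the list `B`. -/
def Holds (σ : Mem) (A : ℕ) (B : List Box3) : Prop :=
  ∀ (u : ℕ) (hu : u < B.length), ∀ j < 6, σ.x A (6 * u + j) = B[u].coords.getD j 0

theorem holds_ofState (l : List (List Box3)) (k : ℕ) :
    Holds (Mem.ofState (Box3.inputState l)) k (l.getD k []) :=
  fun _ hu _ hj => Box3.getD_flatMap_coords _ hu hj

theorem meets_iff {σ : Mem} {A : ℕ} {B Q : List Box3} (hQ : Holds σ 1 Q) (hB : Holds σ A B)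
    {q u : ℕ} (hq : q < Q.length) (hu : u < B.length) :
    Meets σ A q u ↔ Q[q].Intersects B[u] := by
  have h1 := hQ q hq
  have h2 := hB u hu
  have h1' : σ.x 1 (6 * q) = _ := h1 0 (by omega)
  have h2' : σ.x A (6 * u) = _ := h2 0 (by omega)
  rw [Box3.intersects_iff]
  constructor
  · intro h a
    fin_cases a
    · have e0 := h 0 (by omega)
      have e1 := h 1 (by omega)
      simp [keyOf, h1, h2, h1', h2', Box3.coords] at e0 e1
      exact ⟨e0, e1⟩
    · have e0 := h 2 (by omega)
      have e1 := h 3 (by omega)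
      simp [keyOf, h1, h2, Box3.coords] at e0 e1
      exact ⟨e0, e1⟩
    · have e0 := h 4 (by omega)
      have e1 := h 5 (by omega)
      simp [keyOf, h1, h2, Box3.coords] at e0 e1
      exact ⟨e0, e1⟩
  · intro h d hd
    interval_cases d
    · simpa [keyOf, h1', h2, Box3.coords] using (h 0).1
    · simpa [keyOf, h1, h2', Box3.coords] using (h 0).2
    · simpa [keyOf, h1, h2, Box3.coords] using (h 1).1
    · simpa [keyOf, h1, h2, Box3.coords] using (h 1).2
    · simpa [keyOf, h1, h2, Box3.coords] using (h 2).1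
    · simpa [keyOf, h1, h2, Box3.coords] using (h 2).2

namespace Cmd

theorem wp_solve_of_holds {Z : ℕ} {σ : Mem} {Q' : Mem → Prop} {P Q R : List Box3}
    (hp : σ.v .np = P.length) (hq : σ.v .nq = Q.length) (hr : σ.v .nr = R.length)
    (hZ : (4 * (P.length + Q.length + R.length + 2)) ^ 12 ≤ Z) (ha : ∀ A, σ.a A = fun _ => 0)
    (hP : Holds σ 0 P) (hQ : Holds σ 1 Q) (hR : Holds σ 2 R)
    (h : ∀ τ : Mem,
      ((∀ p ∈ P, ∀ r ∈ R, ∃ q ∈ Q, q.Intersects p ∧ q.Intersects r) ∧ τ.v .np = 1) ∨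
      (¬ (∀ p ∈ P, ∀ r ∈ R, ∃ q ∈ Q, q.Intersects p ∧ q.Intersects r) ∧ τ.v .np = 0) → Q' τ) :
    solve.wp Z (bounds (P.length + Q.length + R.length)) Q' σ := by
  have key : (∀ p < P.length, ∀ r < R.length, ∃ q < Q.length, Meets σ 0 q p ∧ Meets σ 2 q r) ↔
      ∀ p ∈ P, ∀ r ∈ R, ∃ q ∈ Q, q.Intersects p ∧ q.Intersects r := by
    rw [List.forall_mem_iff_getElem]
    refine forall₂_congr fun p hp => ?_
    rw [List.forall_mem_iff_getElem]
    refine forall₂_congr fun r hr => ?_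
    rw [List.exists_mem_iff_getElem]
    constructor
    · rintro ⟨q, hq, h1, h2⟩
      exact ⟨q, hq, (meets_iff hQ hP hq hp).1 h1, (meets_iff hQ hR hq hr).1 h2⟩
    · rintro ⟨q, hq, h1, h2⟩
      exact ⟨q, hq, (meets_iff hQ hP hq hp).2 h1, (meets_iff hQ hR hq hr).2 h2⟩
  refine wp_solve hp hq hr hZ ha fun τ hτ => h τ ?_
  rw [key] at hτ
  exact hτ.imp And.symm And.symm

/-- Copies the first list of boxes to the other two. -/
def copyLists : Cmd :=
  .nq ≔ .var .np ;; .nr ≔ .var .np ;;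
  forLoop .item .u 0 .np (each (List.range 6) fun d =>
    rcopy 1 (6 * .var .u + .lit d) 0 (6 * .var .u + .lit d) ;;
    rcopy 2 (6 * .var .u + .lit d) 0 (6 * .var .u + .lit d))

theorem wp_copyLists {Z : ℕ} {β : Kind → ℕ} {σ : Mem} {Q : Mem → Prop} {B : List Box3}
    (hp : σ.v .np = B.length) (hZ : 6 * B.length + 12 < Z) (hβ : B.length ≤ β .item)
    (hB : Holds σ 0 B)
    (hQ : ∀ τ : Mem, τ.v .np = B.length → τ.v .nq = B.length → τ.v .nr = B.length → τ.a = σ.a →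
      Holds τ 0 B → Holds τ 1 B → Holds τ 2 B → Q τ) :
    copyLists.wp Z β Q σ := by
  refine (wp_seq ..).2 ((wp_asg ..).2 ⟨trivial, (wp_seq ..).2 ((wp_asg ..).2 ⟨trivial, ?_⟩)⟩)
  refine wp_forLoop (l := 0) (h := B.length) (fun k τ => τ.v .np = B.length ∧ τ.v .nq = B.length ∧
    τ.v .nr = B.length ∧ τ.a = σ.a ∧ τ.x 0 = σ.x 0 ∧
    ∀ i < 6 * k, τ.x 1 i = σ.x 0 i ∧ τ.x 2 i = σ.x 0 i) (by simp; omega) (by simp)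
    (by simpa using hp) (by omega) (by omega) (by omega) ⟨by simp [hp], by simp [hp], by simp [hp], rfl, rfl, by simp⟩
    ?_ ?_
  · rintro u τ - hu hτu hτn ⟨-, g2, g3, g4, g5, g6⟩
    refine wp_each (fun l υ => υ.v = τ.v ∧ υ.a = σ.a ∧ υ.x 0 = σ.x 0 ∧
      ∀ i < 6 * u + l.length, υ.x 1 i = σ.x 0 i ∧ υ.x 2 i = σ.x 0 i) ⟨rfl, g4, g5, g6⟩ ?_ ?_
    · rintro l₁ d l₂ υ hl ⟨k1, k2, k3, k4⟩
      have hd : d = l₁.length ∧ d < 6 := by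
        have h1 : (List.range 6)[l₁.length]? = some d := by rw [hl]; simp
        rw [List.getElem?_eq_some_iff] at h1
        obtain ⟨h2, h3⟩ := h1
        simp at h2 h3
        omega
      have ev : ∀ υ : Mem, υ.v = τ.v → (6 * .var .u + .lit d : Exp).eval υ = 6 * u + d :=
        fun υ h => by simp [h, hτu]
      have ok : ∀ υ : Mem, υ.v = τ.v → (6 * .var .u + .lit d : Exp).Ok Z υ := fun υ h => by
        simp [h, hτu]
        omega
      refine (wp_seq ..).2 ⟨ok υ k1, ok υ k1, ?_⟩
      rw [ev υ k1, k3]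
      set ξ := υ.rput 1 (6 * u + d) (σ.x 0 (6 * u + d)) with hξ
      have hξv : ξ.v = τ.v := k1
      have hξ0 : ξ.x 0 = σ.x 0 := by rw [hξ, Mem.rput_x_of_ne _ _ _ (by omega), k3]
      refine ⟨ok ξ hξv, ok ξ hξv, ?_⟩
      rw [ev ξ hξv, hξ0]
      refine ⟨hξv, k2, by rw [Mem.rput_x_of_ne _ _ _ (by omega), hξ0], fun i hi => ?_⟩
      rw [Mem.rput_x_self, Mem.rput_x_of_ne _ _ _ (by omega), hξ, Mem.rput_x_self,
        Mem.rput_x_of_ne _ _ _ (by omega)]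
      by_cases hiu : i = 6 * u + d
      · simp [hiu]
      · rw [Function.update_of_ne hiu, Function.update_of_ne hiu]
        refine k4 i ?_
        simp at hi
        omega
    · rintro υ ⟨k1, k2, k3, k4⟩
      refine ⟨by rw [k1, hτu], by rw [k1, hτn], by simp [k1, hτn], by simp [k1, hτn],
        by simp [k1, g2], by simp [k1, g3], k2, k3, fun i hi => k4 i ?_⟩
      simp
      omega
  · rintro τ - - ⟨g1, g2, g3, g4, g5, g6⟩
    refine hQ τ g1 g2 g3 g4 (fun u hu j hj => ?_) (fun u hu j hj => ?_) fun u hu j hj => ?_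
    · rw [g5, hB u hu j hj]
    · rw [(g6 _ (by omega)).1, hB u hu j hj]
    · rw [(g6 _ (by omega)).2, hB u hu j hj]

theorem CostLE.copyLists : CostLE copyLists totalTime :=
  .seq ((CostLE.asg _ _).mono one_le_totalTime) (.seq ((CostLE.asg _ _).mono one_le_totalTime)
    ((CostLE.forLoop (X := tableTime) (.each (fun _ _ =>
      .seq ((CostLE.rcopy _ _ _ _).mono one_le_tableTime)
        ((CostLE.rcopy _ _ _ _).mono one_le_tableTime)) one_le_tableTime) one_le_tableTime).mono
      item_table_le))

end Cmd

/-- Words with `60 * (⌊log₂ n⌋ + 1)` bits are long enough, even for three copies of the input. -/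
theorem pow_le_of_word {n N w : ℕ} (hw : 60 * (Nat.log 2 n + 1) ≤ w) (hN : N ≤ 3 * n) :
    (4 * (N + 2)) ^ 12 ≤ 2 ^ w := by
  have h1 : n < 2 ^ (Nat.log 2 n + 1) := Nat.lt_pow_succ_log_self (by omega) n
  have h2 : 2 ^ 4 ≤ (2 ^ (Nat.log 2 n + 1)) ^ 4 :=
    Nat.pow_le_pow_left (Nat.le_self_pow (Nat.succ_ne_zero _) 2) 4
  calc (4 * (N + 2)) ^ 12 ≤ (2 ^ 4 * 2 ^ (Nat.log 2 n + 1)) ^ 12 :=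
        Nat.pow_le_pow_left (by omega) 12
    _ ≤ ((2 ^ (Nat.log 2 n + 1)) ^ 4 * 2 ^ (Nat.log 2 n + 1)) ^ 12 :=
        Nat.pow_le_pow_left (Nat.mul_le_mul_right _ h2) 12
    _ = 2 ^ (60 * (Nat.log 2 n + 1)) := by
        rw [← pow_succ, ← pow_mul, ← pow_mul]
        congr 1
        ring
    _ ≤ 2 ^ w := Nat.pow_le_pow_right (by omega) hw

/-- A structured program with a correctness proof yields a machine program that decides. -/
theorem decides_of_wp {c : Cmd} {C k : ℕ} {l : List (List Box3)} {A : Prop}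
    (hC : ∀ n, c.cost (bounds n) ≤ C * Cmd.totalTime n)
    (h : ∀ w, 60 * (Nat.log 2 (Box3.inputSize l) + 1) ≤ w →
      c.wp (2 ^ w) (bounds (k * Box3.inputSize l))
        (fun τ => (A ∧ τ.v .np = 1) ∨ (¬ A ∧ τ.v .np = 0)) (Mem.ofState (Box3.inputState l))) :
    Box3.Decides c.compile 60 (fun n => C * Cmd.totalTime (k * n)) l A := by
  intro w hw
  obtain ⟨t, s, σ, h1, h2, h3, h4⟩ := Cmd.compile_exec c (h w hw) (Mem.sim_ofState _)
  refine ⟨t, s, h1, h2.trans (hC _), ?_⟩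
  rwa [show s.wreg 0 = σ.v .np from h3.1 .np]

/-- The program for three lists of boxes. -/
theorem exists_prog_cover : ∃ (prog : Prog) (κ : ℕ) (T : ℕ → ℕ),
    IsSoftO T (fun n => (n : ℝ) ^ (11 / 6 : ℝ)) ∧
    ∀ P Q R : List Box3, Box3.Decides prog κ T [P, Q, R]
      (∀ p ∈ P, ∀ r ∈ R, ∃ q ∈ Q, q.Intersects p ∧ q.Intersects r) := by
  obtain ⟨C, hC⟩ := Cmd.CostLE.solve
  refine ⟨Cmd.solve.compile, 60, _, isSoftO_totalTime C 1 le_rfl, fun P Q R => ?_⟩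
  refine decides_of_wp hC fun w hw => ?_
  have hsize : Box3.inputSize [P, Q, R] = P.length + Q.length + R.length := by
    simp [Box3.inputSize, add_assoc]
  rw [one_mul, hsize]
  exact Cmd.wp_solve_of_holds rfl rfl rfl (pow_le_of_word hw (by omega)) (fun _ => rfl)
    (holds_ofState _ 0) (holds_ofState _ 1) (holds_ofState _ 2) fun _ h => h

/-- The program for the diameter. -/
theorem exists_prog_diam : ∃ (prog : Prog) (κ : ℕ) (T : ℕ → ℕ),
    IsSoftO T (fun n => (n : ℝ) ^ (11 / 6 : ℝ)) ∧
    ∀ B : List Box3, Box3.Decides prog κ T [B] ((Box3.intersectionGraph B).ediam ≤ 2) := by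
  obtain ⟨C, hC⟩ := Cmd.CostLE.copyLists.seq Cmd.CostLE.solve
  refine ⟨(Cmd.copyLists ;; Cmd.solve).compile, 60, _, isSoftO_totalTime C 3 (by omega),
    fun B => ?_⟩
  rw [Box3.ediam_intersectionGraph_le_two]
  refine decides_of_wp hC fun w hw => ?_
  have hsize : Box3.inputSize [B] = B.length := by simp [Box3.inputSize]
  rw [hsize] at hw ⊢
  have hZ := pow_le_of_word hw (N := B.length + B.length + B.length) (by omega)
  have hZ' : 6 * B.length + 12 < 2 ^ w := by
    refine lt_of_lt_of_le ?_ ((Nat.pow_le_pow_right (by omega) (show 2 ≤ 12 by omega)).trans hZ)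
    nlinarith
  have hn : 3 * B.length = B.length + B.length + B.length := by omega
  rw [hn]
  refine (Cmd.wp_seq ..).2 (Cmd.wp_copyLists (B := B) rfl hZ'
    (show B.length ≤ 2 * (B.length + B.length + B.length) by omega) (holds_ofState _ 0)
    fun τ h1 h2 h3 h4 h5 h6 h7 => ?_)
  exact Cmd.wp_solve_of_holds h1 h2 h3 hZ (fun _ => by rw [h4]; rfl) h5 h6 h7 fun _ h => h

end BoxCover

theorem mainTheorem5 :
    (∃ (prog : RealRAM.Prog) (κ : ℕ) (T : ℕ → ℕ),
      IsSoftO T (fun n => (n : ℝ) ^ (11 / 6 : ℝ)) ∧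
      ∀ P Q R : List Box3, Box3.Decides prog κ T [P, Q, R]
        (∀ p ∈ P, ∀ r ∈ R, ∃ q ∈ Q, q.Intersects p ∧ q.Intersects r)) ∧
    (∃ (prog : RealRAM.Prog) (κ : ℕ) (T : ℕ → ℕ),
      IsSoftO T (fun n => (n : ℝ) ^ (11 / 6 : ℝ)) ∧
      ∀ B : List Box3, Box3.Decides prog κ T [B]
        ((Box3.intersectionGraph B).ediam ≤ 2)) :=
  ⟨BoxCover.exists_prog_cover, BoxCover.exists_prog_diam⟩
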